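/- **Setting.** Fusion rules $\mathfrak V(4,3)$: central charge $c=\tfrac12$, fields $1,0,\tfrac14,\tfrac1{32}$, and the symmetric product $\star$ with $1\star\theta=\{\theta\}$ for every field $\theta$, $0\star0=\{1,0\}$, $0\star\tfrac14=\{\tfrac14\}$, $0\star\tfrac1{32}=\{\tfrac1{32}\}$, $\tfrac14\star\tfrac14=\{1,0\}$, $\tfrac14\star\tfrac1{32}=\{\tfrac1{32}\}$, $\tfrac1{32}\star\tfrac1{32}=\{1,0,\tfrac14\}$. Let $R$ be a nonzero commutative ring containing $\mathbb Q$ and $A$ a commutative, not necessarily associative, $R$-algebra; for $a\in A$ and $\theta\in\mathbb Q$ put $A_\theta=\{x\in A: ax=\theta x\}$. An element $a$ is a $\mathfrak V(4,3)$-axis if $aa=a$, $A=A_1\oplus A_0\oplus A_{1/4}\oplus A_{1/32}$, $A_1=Ra$, and $A_\theta A_\eta\subseteq\sum_{\zeta\in\theta\star\eta}A_\zeta$ for all fields $\theta,\eta$. Its Miyamoto involution $\tau(a)$ is the automorphism of $A$ which is $1$ on $A_1\oplus A_0\oplus A_{1/4}$ and $-1$ on $A_{1/32}$. A $2$-generated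 Frobenius $\mathfrak V(4,3)$-axial algebra is such an $A$ with an $R$-bilinear form satisfying $\langle xy,z\rangle=\langle x,yz\rangle$ and two marked $\mathfrak V(4,3)$-axes $a_0,a_1$ which generate $A$ and satisfy $\langle a_i,a_i\rangle=2c=1$. A morphism is a ring homomorphism of the coefficient rings together with a compatible additive and multiplicative map of the algebras preserving the forms and the marked axes. Let $\hat X$ be the free commutative nonassociative magma on $\hat a_0,\hat a_1$, let $\hat R$ be the polynomial ring over $\mathbb Q$ in indeterminates $\lambda_{[x,y]}$ indexed by the classes of pairs in $\hat X\times\hat X$ under the equivalence relation generated by $(xy,z)\sim(x,yz)$, and let $\hat M=\hat R\hat X$ be the magma algebra with form $\langle x,y\rangle=\lambda_{[x,y]}$. Let $U$, with coefficient ring $R$, be the quotient of $(\hat R,\hat M)$ presented by the relators $\langle m,m\rangle-1$, $mm-m$, $f(\mathrm{ad}_m)x^\perp$ and $f_{\theta\star\eta}(\mathrm{ad}_m)\bigl(f_\theta(\mathrm{ad}_m)x^\perp\cdot f_\eta(\mathrm{ad}_m)y^\perp\bigr)$, where $m\in\{\hat a_0,\hat a_1\}$, $x,y\in\hat X$, $\theta,\eta\in\{0,\tfrac14,\tfrac1{32}\}$,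 $x^\perp=x-\langle m,x\rangle m$, $f(t)=t(t-\tfrac14)(t-\tfrac1{32})$, $f_\theta=f/(t-\theta)$ and $f_{\theta\star\eta}=\prod_{\zeta\in\theta\star\eta}(t-\zeta)$. Here, if $I_0$ is the ideal of $\hat M$ generated by the relators that lie in $\hat M$, and $J$ is the ideal of $\hat R$ generated by the other relators and all $\langle i,x\rangle,\langle x,i\rangle$ with $i\in I_0$, $x\in\hat M$, then $R=\hat R/J$ and $U=\hat M/(I_0+J\hat M)$. Write $a_0,a_1$ also for the images of $\hat a_0,\hat a_1$ in $U$. **Theorem.** $U$ is the universal $2$-generated Frobenius $\mathfrak V(4,3)$-axial algebra: it is a $2$-generated Frobenius $\mathfrak V(4,3)$-axial algebra with marked axes $a_0,a_1$, and it has exactly one morphism to every other one. The Miyamoto involutions $\tau_0=\tau(a_0)$ and $\tau_1=\tau(a_1)$ exist. Let $\rho$ be $\tau_0$ followed by $\tau_1$, let $a_{2i}=\rho^i(a_0)$ and $a_{2i+1}=\rho^i(a_1)$ for $i\in\mathbb Z$, and put $\lambda=\langle a_0,a_1\rangle$, $\mu=\langle a_0,a_2\rangle$, $\sigma(m,n)=mn-\tfrac1{32}(m+n)$,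 $\sigma_1=\sigma(a_0,a_1)$, $\sigma_2^e=\sigma(a_0,a_2)$, $\sigma_2^o=\sigma(a_{-1},a_1)$; write $\sigma_2^{(i)}$ for $\sigma_2^e$ if $i$ is even and for $\sigma_2^o$ if $i$ is odd. Then: 1. The coefficient ring is $R=R_0:=\mathbb Q[\lambda,\mu]$, the $\mathbb Q$-subalgebra generated by $\lambda$ and $\mu$. 2. $U$ is spanned over $R_0$ by $a_{-2},a_{-1},a_0,a_1,a_2,\sigma_1,\sigma_2^e,\sigma_2^o$. 3. For all $i\in\mathbb Z$ (which expresses all $a_j$, and all products of the eight elements, through the eight elements with explicit coefficients in $R_0$): $$\begin{aligned} a_{i+3}={}&a_{i-2}+(256\lambda-6)(a_{i-1}-a_{i+2})\\ &+\left(\tfrac{32768}{7}\lambda^2-\tfrac{2304}{7}\lambda+\tfrac{128}{7}\mu+\tfrac{33}{7}\right)(a_i-a_{i+1})+32\bigl(\sigma_2^{(i+1)}-\sigma_2^{(i)}\bigr) \end{aligned}$$ $$a_ia_i=a_i,\qquad a_ia_{i+1}=\sigma_1+\tfrac1{32}(a_i+a_{i+1}),\qquad a_ia_{i+2}=\sigma_2^{(i)}+\tfrac1{32}(a_i+a_{i+2})$$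 $$\begin{aligned} a_ia_{i+3} ={}&\ \left(\tfrac{88064}{21}\lambda^{2}-\tfrac{5576}{21}\lambda-\tfrac{160}{21}\mu+\tfrac{1363}{336}\right)a_i\\ &+\left(\tfrac{40}{3}\lambda-\tfrac{37}{96}\right)a_{i-1}\\ &+\left(-\tfrac{1024}{7}\lambda^{2}+\tfrac{328}{21}\lambda-\tfrac{4}{7}\mu-\tfrac{29}{84}\right)a_{i+1}\\ &+\left(-\tfrac{1}{24}\right)a_{i-2}\\ &+\left(-8\lambda+\tfrac{11}{96}\right)a_{i+2}\\ &+\left(-\tfrac{32768}{7}\lambda^{2}+\tfrac{19456}{21}\lambda-\tfrac{128}{7}\mu-\tfrac{491}{21}\right)\sigma_1\\ &+\left(-256\lambda+\tfrac{7}{3}\right)\sigma_2^{(i)} \end{aligned}$$ $$\begin{aligned} a_ia_{i+4} ={}&\ \left(-\tfrac{22544384}{21}\lambda^{3}+\tfrac{654336}{7}\lambda^{2}+\tfrac{40960}{21}\lambda\mu-\tfrac{51008}{21}\lambda-\tfrac{428}{21}\mu+\tfrac{12709}{672}\right)a_i\\ &+\left(-\tfrac{10240}{3}\lambda^{2}+\tfrac{520}{3}\lambda-\tfrac{25}{12}\right)a_{i-1}\\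 &+\left(\tfrac{262144}{7}\lambda^{3}-\tfrac{99328}{21}\lambda^{2}+\tfrac{1024}{7}\lambda\mu+\tfrac{3496}{21}\lambda-\tfrac{20}{7}\mu-\tfrac{145}{84}\right)a_{i+1}\\ &+\left(\tfrac{32}{3}\lambda-\tfrac{17}{96}\right)a_{i-2}\\ &+\left(\tfrac{13312}{7}\lambda^{2}-\tfrac{1408}{21}\lambda-\tfrac{4}{7}\mu+\tfrac{103}{168}\right)a_{i+2}\\ &+\left(\tfrac{8388608}{7}\lambda^{3}-\tfrac{5472256}{21}\lambda^{2}+\tfrac{32768}{7}\lambda\mu+\tfrac{228352}{21}\lambda-\tfrac{640}{7}\mu-\tfrac{2560}{21}\right)\sigma_1\\ &+\left(\tfrac{425984}{7}\lambda^{2}-\tfrac{37888}{21}\lambda-\tfrac{128}{7}\mu+\tfrac{293}{21}\right)\sigma_2^{(i)} \end{aligned}$$ $$\begin{aligned} a_i\sigma_1 ={}&\ \left(\tfrac{3}{4}\lambda-\tfrac{25}{1024}\right)a_i\\ &+\tfrac{7}{2048}(a_{i-1}+a_{i+1})\\ &+\tfrac{7}{32}\sigma_1 \end{aligned}$$ $$\begin{aligned}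 a_i\sigma_2^{(i)} ={}&\ \left(\tfrac{3}{4}\mu-\tfrac{25}{1024}\right)a_i\\ &+\tfrac{7}{2048}(a_{i-2}+a_{i+2})\\ &+\tfrac{7}{32}\sigma_2^{(i)} \end{aligned}$$ $$\begin{aligned} a_i\sigma_2^{(i+1)} ={}&\ \left(-\tfrac{32}{3}\lambda^{2}+\tfrac{5}{3}\lambda-\tfrac{1}{24}\mu-\tfrac{127}{3072}\right)a_i\\ &+\left(\tfrac{1}{6}\lambda-\tfrac{19}{3072}\right)(a_{i-1}+a_{i+1})\\ &+\tfrac{7}{6144}(a_{i-2}+a_{i+2})\\ &+\left(\tfrac{32}{3}\lambda-\tfrac{19}{48}\right)\sigma_1\\ &+\tfrac{7}{96}\sigma_2^{(i)} \end{aligned}$$ $$\begin{aligned} \sigma_1\sigma_1 ={}&\ \left(\tfrac{7}{6}\lambda^{2}-\tfrac{7}{384}\lambda+\tfrac{7}{1536}\mu-\tfrac{7}{98304}\right)a_i\\ &+\left(\tfrac{49}{768}\lambda-\tfrac{245}{196608}\right)(a_{i-1}+a_{i+1})\\ &+\tfrac{49}{196608}(a_{i-2}+a_{i+2})\\ &+\left(-\tfrac{5}{12}\lambda-\tfrac{13}{1536}\right)\sigma_1\\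 &+\left(-\tfrac{7}{1536}\right)\sigma_2^{(i)}\\ &+\tfrac{7}{2048}\sigma_2^{(i+1)} \end{aligned}$$ $$\begin{aligned} \sigma_1\sigma_2^{(i)} ={}&\ \left(\tfrac{256}{3}\lambda^{3}-\tfrac{9}{2}\lambda^{2}+\tfrac{1}{3}\lambda\mu+\tfrac{17}{384}\lambda-\tfrac{19}{1536}\mu+\tfrac{19}{98304}\right)a_i\\ &+\left(\tfrac{14}{3}\lambda^{2}-\tfrac{203}{768}\lambda+\tfrac{665}{196608}\right)(a_{i-1}+a_{i+1})\\ &+\left(\tfrac{7}{384}\lambda-\tfrac{133}{196608}\right)(a_{i-2}+a_{i+2})\\ &+\left(-\tfrac{304}{3}\lambda^{2}+\tfrac{41}{6}\lambda+\tfrac{17}{16}\mu-\tfrac{197}{1536}\right)\sigma_1\\ &+\left(-\tfrac{17}{24}\lambda+\tfrac{11}{768}\right)\sigma_2^{(i)}\\ &+\left(-\tfrac{7}{8}\lambda+\tfrac{49}{2048}\right)\sigma_2^{(i+1)} \end{aligned}$$ $$\begin{aligned} \sigma_2^{(i)}\sigma_2^{(i)} ={}&\ \left(2621440\lambda^{4}-\tfrac{820096}{3}\lambda^{3}-10880\lambda^{2}\mu+\tfrac{20303}{2}\lambda^{2}+\tfrac{2329}{6}\lambda\mu+\tfrac{3}{2}\mu^{2}-\tfrac{61409}{384}\lambda-\tfrac{5315}{1536}\mu+\tfrac{89069}{98304}\right)a_i\\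 &+\left(3584\lambda^{3}-\tfrac{791}{3}\lambda^{2}+\tfrac{2317}{384}\lambda-\tfrac{8645}{196608}\right)(a_{i-1}+a_{i+1})\\ &+\left(-49\lambda^{2}+\tfrac{343}{192}\lambda+\tfrac{21}{256}\mu-\tfrac{3563}{196608}\right)(a_{i-2}+a_{i+2})\\ &+\left(-3145728\lambda^{4}+737280\lambda^{3}-12288\lambda^{2}\mu-\tfrac{120368}{3}\lambda^{2}+448\lambda\mu+\tfrac{4819}{6}\lambda-\tfrac{65}{16}\mu-\tfrac{65}{12}\right)\sigma_1\\ &+\left(-49152\lambda^{3}-1584\lambda^{2}-192\lambda\mu+\tfrac{2837}{24}\lambda+\tfrac{47}{16}\mu-\tfrac{4079}{3072}\right)\sigma_2^{(i)}\\ &+\left(-672\lambda^{2}+\tfrac{49}{2}\lambda-\tfrac{455}{2048}\right)\sigma_2^{(i+1)} \end{aligned}$$ $$\begin{aligned} \sigma_2^{(i)}\sigma_2^{(i+1)} ={}&\ \left(\tfrac{54427648}{21}\lambda^{4}-\tfrac{808576}{3}\lambda^{3}-\tfrac{233344}{21}\lambda^{2}\mu+\tfrac{139721}{14}\lambda^{2}+\tfrac{2419}{6}\lambda\mu+\tfrac{22}{21}\mu^{2}-\tfrac{105347}{672}\lambda-\tfrac{1877}{512}\mu+\tfrac{609391}{688128}\right)a_i\\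 &+\left(\tfrac{98304}{7}\lambda^{4}+\tfrac{23936}{21}\lambda^{3}+\tfrac{384}{7}\lambda^{2}\mu-\tfrac{403}{3}\lambda^{2}-\tfrac{113}{42}\lambda\mu+\tfrac{4433}{1344}\lambda+\tfrac{85}{2688}\mu-\tfrac{32635}{1376256}\right)(a_{i-1}+a_{i+1})\\ &+\left(768\lambda^{3}-\tfrac{346}{3}\lambda^{2}+3\lambda\mu+\tfrac{927}{256}\lambda-\tfrac{1}{768}\mu-\tfrac{6751}{196608}\right)(a_{i-2}+a_{i+2})\\ &+\left(-3145728\lambda^{4}+\tfrac{15515648}{21}\lambda^{3}-12288\lambda^{2}\mu-\tfrac{847888}{21}\lambda^{2}+\tfrac{9536}{21}\lambda\mu+\tfrac{34201}{42}\lambda-\tfrac{1441}{336}\mu-\tfrac{29899}{5376}\right)\sigma_1\\ &+\left(-49152\lambda^{3}-\tfrac{4240}{3}\lambda^{2}-192\lambda\mu+\tfrac{889}{8}\lambda+\tfrac{137}{48}\mu-\tfrac{3865}{3072}\right)\sigma_2^{(i)}\\ &+\left(-864\lambda^{2}+\tfrac{137}{4}\lambda-\tfrac{707}{2048}\right)\sigma_2^{(i+1)}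 \end{aligned}$$ 4. The form is symmetric, and for all $i\in\mathbb Z$: $$\langle a_i,a_i\rangle=1,\quad\langle a_i,a_{i+1}\rangle=\lambda,\quad\langle a_i,a_{i+2}\rangle=\mu$$ $$\langle a_i,a_{i+3}\rangle=-\tfrac{32768}{7}\lambda^{3}+\tfrac{36864}{7}\lambda^{2}-\tfrac{1920}{7}\lambda\mu-\tfrac{2169}{7}\lambda-\tfrac{33}{7}\mu+\tfrac{33}{7}$$ $$\langle a_i,a_{i+4}\rangle=\tfrac{8388608}{7}\lambda^{4}-\tfrac{9601024}{7}\lambda^{3}+65536\lambda^{2}\mu+110592\lambda^{2}-\tfrac{640}{7}\lambda\mu-\tfrac{128}{7}\mu^{2}-\tfrac{19840}{7}\lambda-3\mu+\tfrac{156}{7}$$ $$\langle a_i,\sigma_1\rangle=\tfrac1{32}(31\lambda-1),\quad\langle a_i,\sigma_2^{(i)}\rangle=\tfrac1{32}(31\mu-1),\quad\langle a_i,\sigma_2^{(i+1)}\rangle=\tfrac1{32}(30\lambda+\mu-1)$$ $$\langle\sigma_1,\sigma_1\rangle=\tfrac{3}{4}\lambda^{2}+\tfrac{65}{512}\lambda+\tfrac{7}{2048}\mu-\tfrac{3}{2048}$$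 $$\langle\sigma_1,\sigma_2^{(i)}\rangle=-16\lambda^{3}+18\lambda^{2}-\tfrac{3}{16}\lambda\mu-\tfrac{463}{512}\lambda-\tfrac{83}{2048}\mu+\tfrac{23}{2048}$$ $$\langle\sigma_2^{(i)},\sigma_2^{(i)}\rangle=4096\lambda^{4}-4688\lambda^{3}+224\lambda^{2}\mu+378\lambda^{2}-\tfrac{5}{16}\lambda\mu+\tfrac{11}{16}\mu^{2}-\tfrac{155}{16}\lambda+\tfrac{239}{2048}\mu+\tfrac{153}{2048}$$ $$\langle\sigma_2^{(i)},\sigma_2^{(i+1)}\rangle=\tfrac{4096}{7}\lambda^{4}-656\lambda^{3}+\tfrac{128}{7}\lambda^{2}\mu+\tfrac{366}{7}\lambda^{2}+\tfrac{277}{112}\lambda\mu-\tfrac{1}{16}\mu^{2}-\tfrac{335}{256}\lambda+\tfrac{761}{14336}\mu+\tfrac{135}{14336}$$ -/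

import Mathlib

universe u v

noncomputable section

namespace Axial

open Module (End)

/-! ### Fusion rules -/

/-- Fusion rules over `ℚ`: a nonzero central charge, a finite set of fields, and a product `⋆`
of fields with values in the subsets of the set of fields. -/
structure FusionRules where
  charge : ℚ
  charge_ne_zero : charge ≠ 0
  fields : Finset ℚ
  star : ℚ → ℚ → Finset ℚ
  star_subset : ∀ θ ∈ fields, ∀ η ∈ fields, star θ η ⊆ fields

/-- The table of the fusion rules `𝔙(4,3)`; the last line is the case where exactly one of
`θ`, `η` is `1 / 32` and the other one is `1 / 4`. -/
def starV43 (θ η : ℚ) : Finset ℚ :=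
  if θ = 1 then {η}
  else if η = 1 then {θ}
  else if θ = 0 then (if η = 0 then {1, 0} else {η})
  else if η = 0 then {θ}
  else if θ = 1 / 4 ∧ η = 1 / 4 then {1, 0}
  else if θ = 1 / 32 ∧ η = 1 / 32 then {1, 0, 1 / 4}
  else {1 / 32}

/-- The Virasoro fusion rules `𝔙(4,3)`: central charge `1 / 2`, fields `1, 0, 1 / 4, 1 / 32`. -/
def V43 : FusionRules where
  charge := 1 / 2
  charge_ne_zero := by norm_num
  fields := {1, 0, 1 / 4, 1 / 32}
  star := starV43
  star_subset := by
    intro θ hθ η hη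
    simp only [Finset.mem_insert, Finset.mem_singleton] at hθ hη
    rcases hθ with rfl | rfl | rfl | rfl <;> rcases hη with rfl | rfl | rfl | rfl <;>
      norm_num [starV43, Finset.subset_iff]

/-- The positive part of the `ℤ/2`-grading of `𝔙(4,3)`. -/
def plusV43 : Finset ℚ := {1, 0, 1 / 4}

/-- The negative part of the `ℤ/2`-grading of `𝔙(4,3)`. -/
def minusV43 : Finset ℚ := {1 / 32}

/-! ### Axes and Frobenius axial algebras -/

section Axes

variable {R A : Type*} [CommRing R] [Algebra ℚ R] [NonUnitalNonAssocCommRing A] [Module R A]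
  [IsScalarTower R A A] [SMulCommClass R A A]

/-- The `θ`-eigenspace `A_θ` of the multiplication by `a`. -/
def eig (R : Type*) {A : Type*} [CommRing R] [Algebra ℚ R] [NonUnitalNonAssocCommRing A]
    [Module R A] [IsScalarTower R A A] [SMulCommClass R A A] (a : A) (θ : ℚ) : Submodule R A :=
  End.eigenspace (LinearMap.mulLeft R a) (algebraMap ℚ R θ)

/-- `a` is an `𝔉`-axis: an idempotent for which `A` is the sum of the eigenspaces `A_θ`, `θ ∈ 𝔉`
(such a sum is direct, since distinct rationals differ by a unit of `R`), which spans `A_1`,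
and whose eigenspaces multiply according to `⋆`. -/
structure IsAxis (R : Type*) {A : Type*} [CommRing R] [Algebra ℚ R] [NonUnitalNonAssocCommRing A]
    [Module R A] [IsScalarTower R A A] [SMulCommClass R A A] (F : FusionRules) (a : A) :
    Prop where
  idem : a * a = a
  semisimple : ⨆ θ ∈ F.fields, eig R a θ = ⊤
  primitive : eig R a 1 = Submodule.span R {a}
  fusion : ∀ θ ∈ F.fields, ∀ η ∈ F.fields, ∀ x ∈ eig R a θ, ∀ y ∈ eig R a η,
    x * y ∈ ⨆ ζ ∈ F.star θ η, eig R a ζ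

/-- `A`, with the bilinear form `B` and the marked elements `g 0`, `g 1`, is a Frobenius
`𝔉`-axial algebra on two marked generators, over a coefficient ring `R` containing `ℚ`. -/
structure IsFrobeniusAxial (F : FusionRules) (B : A →ₗ[R] A →ₗ[R] R) (g : Fin 2 → A) :
    Prop where
  nontrivial : Nontrivial R
  assoc : ∀ x y z, B (x * y) z = B x (y * z)
  axis : ∀ i, IsAxis R F (g i)
  norm_axis : ∀ i, B (g i) (g i) = algebraMap ℚ R (2 * F.charge)
  generate : NonUnitalAlgebra.adjoin R (Set.range g) = ⊤

/-- `(R, A, B, g)` is a universal Frobenius `𝔉`-axial algebra on two marked generators: it is one,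
and for every other one `(S, C, D, h)` there is exactly one pair of a ring homomorphism
`R → S` and a compatible map of algebras `A → C` preserving forms and marked generators. -/
def IsUniversal.{u₁, u₂, u₃, u₄} {R : Type u₃} {A : Type u₄} [CommRing R] [Algebra ℚ R]
    [NonUnitalNonAssocCommRing A] [Module R A] [IsScalarTower R A A] [SMulCommClass R A A]
    (F : FusionRules) (B : A →ₗ[R] A →ₗ[R] R) (g : Fin 2 → A) : Prop :=
  IsFrobeniusAxial F B g ∧
    ∀ (S : Type u₁) (C : Type u₂) [CommRing S] [Algebra ℚ S] [NonUnitalNonAssocCommRing C]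
      [Module S C] [IsScalarTower S C C] [SMulCommClass S C C]
      (D : C →ₗ[S] C →ₗ[S] S) (h : Fin 2 → C), IsFrobeniusAxial F D h →
      ∃! p : (R →+* S) × (A →+ C),
        (∀ r x, p.2 (r • x) = p.1 r • p.2 x) ∧ (∀ x y, p.2 (x * y) = p.2 x * p.2 y) ∧
        (∀ x y, D (p.2 x) (p.2 y) = p.1 (B x y)) ∧ ∀ i, p.2 (g i) = h i

/-- `τ` is the Miyamoto involution `τ(a)` of the `𝔙(4,3)`-axis `a`: the algebra automorphism
acting as `1` on `A_+` and as `-1` on `A_-`. -/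
structure IsMiyamoto (a : A) (τ : A ≃ₗ[R] A) : Prop where
  map_mul : ∀ x y, τ (x * y) = τ x * τ y
  plus : ∀ θ ∈ plusV43, ∀ x ∈ eig R a θ, τ x = x
  minus : ∀ θ ∈ minusV43, ∀ x ∈ eig R a θ, τ x = -x

/-- The sequence `a_{2i} = a₀ ^ (ρ ^ i)`, `a_{2i+1} = a₁ ^ (ρ ^ i)`, where `ρ` is `τ₀` followed by
`τ₁`. -/
def axisSeq (τ₀ τ₁ : A ≃ₗ[R] A) (a₀ a₁ : A) (j : ℤ) : A :=
  ((τ₁ * τ₀) ^ (j / 2)) (if Even j then a₀ else a₁)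

end Axes

/-! ### The free commutative magma and the universal algebra with associative form -/

/-- The free commutative (nonassociative) magma on two generators. -/
abbrev CMagma : Type :=
  (conGen fun x y : FreeMagma (Fin 2) => ∃ u v, x = u * v ∧ y = v * u).Quotient

/-- The generators of the free commutative magma. -/
def CMagma.gen (i : Fin 2) : CMagma := ((FreeMagma.of i : FreeMagma (Fin 2)) : CMagma)

theorem CMagma.mul_comm (x y : CMagma) : x * y = y * x := by
  induction x using Con.induction_on with | _ x => ?_
  induction y using Con.induction_on with | _ y => ?_
  rw [← Con.coe_mul, ← Con.coe_mul]
  exact (Con.eq _).2 (ConGen.Rel.of _ _ ⟨x, y, rfl, rfl⟩)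

/-- The classes `[x, y]` of pairs, for the equivalence relation generated by
`(x y, z) ∼ (x, y z)`. -/
def PairClass : Type :=
  Quot fun p q : CMagma × CMagma => ∃ x y z, p = (x * y, z) ∧ q = (x, y * z)

/-- The polynomial ring over `ℚ` in the indeterminates `λ_[x, y]`. -/
abbrev FreeCoeff : Type := MvPolynomial PairClass ℚ

/-- The indeterminate `λ_[x, y]`. -/
def lamVar (x y : CMagma) : FreeCoeff := MvPolynomial.X (Quot.mk _ (x, y))

/-- The free `FreeCoeff`-module on the magma, with the multiplication extended bilinearly. -/
abbrev FreeAlg : Type := MonoidAlgebra FreeCoeff CMagma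

theorem FreeAlg.mul_comm (x y : FreeAlg) : x * y = y * x := by
  induction x using MonoidAlgebra.induction_linear with
  | zero => simp
  | add f g hf hg => rw [add_mul, mul_add, hf, hg]
  | single m r =>
    induction y using MonoidAlgebra.induction_linear with
    | zero => simp
    | add f g hf hg => rw [add_mul, mul_add, hf, hg]
    | single n s =>
      rw [MonoidAlgebra.single_mul_single, MonoidAlgebra.single_mul_single, CMagma.mul_comm,
        _root_.mul_comm r s]

instance : NonUnitalNonAssocCommRing FreeAlg :=
  { (inferInstance : NonUnitalNonAssocRing FreeAlg) with mul_comm := FreeAlg.mul_comm }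

/-- A magma element as an element of the free algebra. -/
def FreeAlg.of (x : CMagma) : FreeAlg := MonoidAlgebra.single x 1

/-- The bilinear form with `⟨x, y⟩ = λ_[x, y]` for `x`, `y` in the magma. -/
def freeForm : FreeAlg →ₗ[FreeCoeff] FreeAlg →ₗ[FreeCoeff] FreeCoeff :=
  (Finsupp.linearCombination FreeCoeff fun x : CMagma =>
      (Finsupp.linearCombination FreeCoeff fun y : CMagma => lamVar x y) ∘ₗ
        (MonoidAlgebra.coeffLinearEquiv FreeCoeff).toLinearMap) ∘ₗ
    (MonoidAlgebra.coeffLinearEquiv FreeCoeff).toLinearMap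

/-! ### The presentation of the universal Frobenius axial algebra -/

section Presentation

variable (F : FusionRules)

/-- `f(ad m) x` for a polynomial `f` over `ℚ`. -/
def polyAd (f : Polynomial ℚ) (m x : FreeAlg) : FreeAlg :=
  Polynomial.aeval (R := FreeCoeff) (LinearMap.mulLeft FreeCoeff m)
    (f.map (algebraMap ℚ FreeCoeff)) x

/-- The marked generators of the free algebra. -/
def mark (i : Fin 2) : FreeAlg := FreeAlg.of (CMagma.gen i)

/-- `x - ⟨m, x⟩ m`, for `m` the `i`-th marked generator, the form being rescaled so that `m` has
length `1` (for `𝔙(4,3)` the factor is `1`). -/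
def perpPart (i : Fin 2) (x : CMagma) : FreeAlg :=
  FreeAlg.of x -
    (algebraMap ℚ FreeCoeff (2 * F.charge)⁻¹ * freeForm (mark i) (FreeAlg.of x)) • mark i

/-- `∏ (t - θ)` over a finite set of rationals. -/
def rootPoly (s : Finset ℚ) : Polynomial ℚ := ∏ θ ∈ s, (Polynomial.X - Polynomial.C θ)

/-- The algebra relators: the marked generators are idempotents, their eigenspaces for the
fields other than `1` span `m^⊥`, and these eigenspaces multiply according to the fusion rules. -/
def algRelators : Set FreeAlg :=
  {u | ∃ i, u = mark i * mark i - mark i} ∪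
  {u | ∃ i x, u = polyAd (rootPoly (F.fields.erase 1)) (mark i) (perpPart F i x)} ∪
  {u | ∃ i x y, ∃ θ ∈ F.fields.erase 1, ∃ η ∈ F.fields.erase 1,
    u = polyAd (rootPoly (F.star θ η)) (mark i)
      (polyAd (rootPoly ((F.fields.erase 1).erase θ)) (mark i) (perpPart F i x) *
        polyAd (rootPoly ((F.fields.erase 1).erase η)) (mark i) (perpPart F i y))}

/-- The coefficient relators: `⟨m, m⟩ = 2 c` for the marked generators `m`. -/
def coeffRelators : Set FreeCoeff :=
  {v | ∃ i, v = freeForm (mark i) (mark i) - algebraMap ℚ FreeCoeff (2 * F.charge)}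

/-- The ideal of the free algebra generated by the algebra relators. -/
def relIdeal : Submodule FreeCoeff FreeAlg :=
  sInf {N | algRelators F ⊆ N ∧ ∀ x ∈ N, ∀ y : FreeAlg, x * y ∈ N}

/-- The ideal of the coefficient ring: generated by the coefficient relators and by the values of
the form on `relIdeal`, in either argument. -/
def coeffIdeal : Ideal FreeCoeff :=
  Ideal.span (coeffRelators F ∪
    {v | ∃ x ∈ relIdeal F, ∃ y : FreeAlg, v = freeForm x y ∨ v = freeForm y x})

/-- The ideal of the algebra: the sum of `relIdeal` and `coeffIdeal` times the algebra. -/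
def algIdeal : Submodule FreeCoeff FreeAlg :=
  relIdeal F ⊔ coeffIdeal F • (⊤ : Submodule FreeCoeff FreeAlg)

theorem relIdeal_mul {x : FreeAlg} (hx : x ∈ relIdeal F) (y : FreeAlg) : x * y ∈ relIdeal F := by
  simp only [relIdeal, Submodule.mem_sInf] at hx ⊢
  exact fun N hN => hN.2 x (hx N hN) y

theorem algIdeal_mul {x : FreeAlg} (hx : x ∈ algIdeal F) (y : FreeAlg) : x * y ∈ algIdeal F := by
  rw [algIdeal, Submodule.mem_sup] at hx
  obtain ⟨u, hu, v, hv, rfl⟩ := hx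
  rw [add_mul]
  refine add_mem (Submodule.mem_sup_left (relIdeal_mul F hu y)) (Submodule.mem_sup_right ?_)
  refine Submodule.smul_induction_on hv (fun r hr z _ => ?_) (fun z w hz hw => ?_)
  · rw [smul_mul_assoc]
    exact Submodule.smul_mem_smul hr trivial
  · rw [add_mul]
    exact add_mem hz hw

theorem algIdeal_form {x : FreeAlg} (hx : x ∈ algIdeal F) (y : FreeAlg) :
    freeForm x y ∈ coeffIdeal F ∧ freeForm y x ∈ coeffIdeal F := by
  rw [algIdeal, Submodule.mem_sup] at hx
  obtain ⟨u, hu, v, hv, rfl⟩ := hx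
  have h1 : freeForm u y ∈ coeffIdeal F :=
    Ideal.subset_span (Or.inr ⟨u, hu, y, Or.inl rfl⟩)
  have h2 : freeForm y u ∈ coeffIdeal F :=
    Ideal.subset_span (Or.inr ⟨u, hu, y, Or.inr rfl⟩)
  have h3 : freeForm v y ∈ coeffIdeal F ∧ freeForm y v ∈ coeffIdeal F := by
    refine Submodule.smul_induction_on hv (fun r hr z _ => ?_) (fun z w hz hw => ?_)
    · simp only [map_smul, LinearMap.smul_apply, smul_eq_mul]
      exact ⟨Ideal.mul_mem_right _ _ hr, Ideal.mul_mem_right _ _ hr⟩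
    · simp only [map_add, LinearMap.add_apply]
      exact ⟨add_mem hz.1 hw.1, add_mem hz.2 hw.2⟩
  simp only [map_add, LinearMap.add_apply]
  exact ⟨add_mem h1 h3.1, add_mem h2 h3.2⟩

/-- The coefficient ring of the universal Frobenius `𝔉`-axial algebra on two generators. -/
abbrev UCoeff : Type := FreeCoeff ⧸ coeffIdeal F

/-- The universal Frobenius `𝔉`-axial algebra on two generators. -/
def UAlg : Type := FreeAlg ⧸ algIdeal F

namespace UAlg

/-- The class of an element of the free algebra. -/
def mk (x : FreeAlg) : UAlg F := (algIdeal F).mkQ x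

theorem ind {p : UAlg F → Prop} (h : ∀ x, p (mk F x)) (u : UAlg F) : p u := by
  obtain ⟨x, rfl⟩ := (algIdeal F).mkQ_surjective u
  exact h x

instance : AddCommGroup (UAlg F) := inferInstanceAs (AddCommGroup (FreeAlg ⧸ algIdeal F))

theorem isTorsion :
    Module.IsTorsionBySet FreeCoeff (FreeAlg ⧸ algIdeal F) (coeffIdeal F : Set FreeCoeff) := by
  rintro u ⟨r, hr⟩
  obtain ⟨x, rfl⟩ := (algIdeal F).mkQ_surjective u
  change r • (algIdeal F).mkQ x = 0
  rw [← map_smul, Submodule.mkQ_apply, Submodule.Quotient.mk_eq_zero]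
  exact Submodule.mem_sup_right (Submodule.smul_mem_smul hr trivial)

instance : Module (UCoeff F) (UAlg F) := (isTorsion F).module

theorem mk_add (x y : FreeAlg) : mk F (x + y) = mk F x + mk F y := rfl

theorem mk_zero : mk F 0 = 0 := rfl

theorem mk_smul (r : FreeCoeff) (x : FreeAlg) :
    mk F (r • x) = (Ideal.Quotient.mk (coeffIdeal F) r : UCoeff F) • mk F x := rfl

theorem mk_eq {x y : FreeAlg} : mk F x = mk F y ↔ x - y ∈ algIdeal F :=
  Submodule.Quotient.eq (algIdeal F)

instance : Mul (UAlg F) where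
  mul := Quotient.map₂ (fun x y : FreeAlg => x * y) (by
    intro x x₁ hx y y₁ hy
    have hx := (Submodule.quotientRel_def (algIdeal F)).1 hx
    have hy := (Submodule.quotientRel_def (algIdeal F)).1 hy
    refine (Submodule.quotientRel_def (algIdeal F)).2 ?_
    have e : x * y - x₁ * y₁ = (x - x₁) * y + (y - y₁) * x₁ := by
      rw [sub_mul, sub_mul, mul_comm y x₁, mul_comm y₁ x₁]; abel
    rw [e]
    exact add_mem (algIdeal_mul F hx y) (algIdeal_mul F hy x₁))

theorem mk_mul (x y : FreeAlg) : mk F (x * y) = mk F x * mk F y := rfl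

instance : NonUnitalNonAssocCommRing (UAlg F) :=
  { (inferInstance : AddCommGroup (UAlg F)), (inferInstance : Mul (UAlg F)) with
    left_distrib := fun a b c => by
      induction a using ind with | _ a => ?_
      induction b using ind with | _ b => ?_
      induction c using ind with | _ c => ?_
      exact congrArg (mk F) (mul_add a b c)
    right_distrib := fun a b c => by
      induction a using ind with | _ a => ?_
      induction b using ind with | _ b => ?_
      induction c using ind with | _ c => ?_
      exact congrArg (mk F) (add_mul a b c)
    zero_mul := fun a => by
      induction a using ind with | _ a => ?_
      exact congrArg (mk F) (zero_mul a)
    mul_zero := fun a => by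
      induction a using ind with | _ a => ?_
      exact congrArg (mk F) (mul_zero a)
    mul_comm := fun a b => by
      induction a using ind with | _ a => ?_
      induction b using ind with | _ b => ?_
      exact congrArg (mk F) (mul_comm a b) }

instance : IsScalarTower (UCoeff F) (UAlg F) (UAlg F) where
  smul_assoc r a b := by
    obtain ⟨r, rfl⟩ := Ideal.Quotient.mk_surjective r
    induction a using ind with | _ a => ?_
    induction b using ind with | _ b => ?_
    exact congrArg (mk F) (smul_mul_assoc r a b)

instance : SMulCommClass (UCoeff F) (UAlg F) (UAlg F) where
  smul_comm r a b := by
    obtain ⟨r, rfl⟩ := Ideal.Quotient.mk_surjective r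
    induction a using ind with | _ a => ?_
    induction b using ind with | _ b => ?_
    exact congrArg (mk F) (mul_smul_comm r a b).symm

/-- The underlying function of the form of the universal algebra. -/
def formFun : UAlg F → UAlg F → UCoeff F :=
  Quotient.lift₂ (fun x y : FreeAlg => (Ideal.Quotient.mk (coeffIdeal F) (freeForm x y))) (by
    intro x y x₁ y₁ hx hy
    have hx := (Submodule.quotientRel_def (algIdeal F)).1 hx
    have hy := (Submodule.quotientRel_def (algIdeal F)).1 hy
    refine Ideal.Quotient.eq.2 ?_
    have e : freeForm x y - freeForm x₁ y₁ = freeForm (x - x₁) y + freeForm x₁ (y - y₁) := by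
      simp only [map_sub, LinearMap.sub_apply]; abel
    rw [e]
    exact add_mem (algIdeal_form F hx y).1 (algIdeal_form F hy x₁).2)

/-- The bilinear form of the universal algebra, induced by that of the free algebra. -/
def form : UAlg F →ₗ[UCoeff F] UAlg F →ₗ[UCoeff F] UCoeff F :=
  LinearMap.mk₂ (UCoeff F) (formFun F)
    (fun a b c => by
      induction a using ind with | _ a => ?_
      induction b using ind with | _ b => ?_
      induction c using ind with | _ c => ?_
      exact congrArg (Ideal.Quotient.mk (coeffIdeal F)) (freeForm.map_add₂ a b c))
    (fun r a b => by
      obtain ⟨r, rfl⟩ := Ideal.Quotient.mk_surjective r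
      induction a using ind with | _ a => ?_
      induction b using ind with | _ b => ?_
      exact congrArg (Ideal.Quotient.mk (coeffIdeal F)) (freeForm.map_smul₂ r a b))
    (fun a b c => by
      induction a using ind with | _ a => ?_
      induction b using ind with | _ b => ?_
      induction c using ind with | _ c => ?_
      exact congrArg (Ideal.Quotient.mk (coeffIdeal F)) ((freeForm a).map_add b c))
    (fun r a b => by
      obtain ⟨r, rfl⟩ := Ideal.Quotient.mk_surjective r
      induction a using ind with | _ a => ?_
      induction b using ind with | _ b => ?_
      exact congrArg (Ideal.Quotient.mk (coeffIdeal F)) ((freeForm a).map_smul r b))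

theorem form_mk (x y : FreeAlg) :
    form F (mk F x) (mk F y) = Ideal.Quotient.mk (coeffIdeal F) (freeForm x y) := rfl

/-- The marked generators of the universal algebra. -/
def gen (i : Fin 2) : UAlg F := mk F (mark i)

end UAlg

end Presentation

/-! ### The multiplication table and the values of the form -/

section Tables

variable {R A : Type*} [CommRing R] [Algebra ℚ R] [NonUnitalNonAssocCommRing A] [Module R A]

/-- A rational number as an element of the coefficient ring. -/
abbrev rat (R : Type*) [CommRing R] [Algebra ℚ R] (c : ℚ) : R := algebraMap ℚ R c

/-- `σ(m, n) = m n - (1 / 32) (m + n)`. -/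
def sig (R : Type*) {A : Type*} [CommRing R] [Algebra ℚ R] [NonUnitalNonAssocCommRing A]
    [Module R A] (m n : A) : A :=
  m * n - rat R (1 / 32) • (m + n)

/-- The products, where `s i` is `σ₂ᵉ` for even `i` and `σ₂ᵒ` for odd `i`. All `a i` with
`i > 2` or `i < -2` are linear combinations of `a (-2), …, a 2` and `s 0`, `s 1` by `recurrence`,
read upwards or downwards. -/
structure IsMulTable (lam mu : R) (a : ℤ → A) (s₁ : A) (s : ℤ → A) : Prop where
  recurrence : ∀ i, a (i + 3) = a (i - 2) + (rat R 256 * lam - rat R 6) • (a (i - 1) - a (i + 2))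
        + (rat R (32768 / 7) * lam ^ 2 - rat R (2304 / 7) * lam + rat R (128 / 7) * mu
          + rat R (33 / 7)) • (a i - a (i + 1))
        + rat R 32 • (s (i + 1) - s i)
  axis_zero : ∀ i, a i * a i = a i
  axis_one : ∀ i, a i * a (i + 1) = s₁ + rat R (1 / 32) • (a i + a (i + 1))
  axis_two : ∀ i, a i * a (i + 2) = s i + rat R (1 / 32) • (a i + a (i + 2))
  axis_three : ∀ i, a i * a (i + 3) =
      (rat R (88064/21) * lam ^ 2 - rat R (5576/21) * lam - rat R (160/21) * mu
          + rat R (1363/336)) • a i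
        + (rat R (40/3) * lam - rat R (37/96)) • a (i - 1)
        + (-(rat R (1024/7) * lam ^ 2) + rat R (328/21) * lam - rat R (4/7) * mu
          - rat R (29/84)) • a (i + 1)
        + (-(rat R (1/24))) • a (i - 2)
        + (-(rat R 8 * lam) + rat R (11/96)) • a (i + 2)
        + (-(rat R (32768/7) * lam ^ 2) + rat R (19456/21) * lam - rat R (128/7) * mu
          - rat R (491/21)) • s₁
        + (-(rat R 256 * lam) + rat R (7/3)) • s i
  axis_four : ∀ i, a i * a (i + 4) =
      (-(rat R (22544384/21) * lam ^ 3) + rat R (654336/7) * lam ^ 2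
          + rat R (40960/21) * lam * mu - rat R (51008/21) * lam - rat R (428/21) * mu
          + rat R (12709/672)) • a i
        + (-(rat R (10240/3) * lam ^ 2) + rat R (520/3) * lam - rat R (25/12)) • a (i - 1)
        + (rat R (262144/7) * lam ^ 3 - rat R (99328/21) * lam ^ 2
          + rat R (1024/7) * lam * mu + rat R (3496/21) * lam - rat R (20/7) * mu
          - rat R (145/84)) • a (i + 1)
        + (rat R (32/3) * lam - rat R (17/96)) • a (i - 2)
        + (rat R (13312/7) * lam ^ 2 - rat R (1408/21) * lam - rat R (4/7) * mu
          + rat R (103/168)) • a (i + 2)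
        + (rat R (8388608/7) * lam ^ 3 - rat R (5472256/21) * lam ^ 2
          + rat R (32768/7) * lam * mu + rat R (228352/21) * lam - rat R (640/7) * mu
          - rat R (2560/21)) • s₁
        + (rat R (425984/7) * lam ^ 2 - rat R (37888/21) * lam - rat R (128/7) * mu
          + rat R (293/21)) • s i
  axis_sig_one : ∀ i, a i * s₁ =
      (rat R (3/4) * lam - rat R (25/1024)) • a i
        + (rat R (7/2048)) • (a (i - 1) + a (i + 1))
        + (rat R (7/32)) • s₁
  axis_sig_same : ∀ i, a i * s i =
      (rat R (3/4) * mu - rat R (25/1024)) • a i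
        + (rat R (7/2048)) • (a (i - 2) + a (i + 2))
        + (rat R (7/32)) • s i
  axis_sig_other : ∀ i, a i * s (i + 1) =
      (-(rat R (32/3) * lam ^ 2) + rat R (5/3) * lam - rat R (1/24) * mu - rat R (127/3072)) • a i
        + (rat R (1/6) * lam - rat R (19/3072)) • (a (i - 1) + a (i + 1))
        + (rat R (7/6144)) • (a (i - 2) + a (i + 2))
        + (rat R (32/3) * lam - rat R (19/48)) • s₁
        + (rat R (7/96)) • s i
  sig_one_sig_one : ∀ i, s₁ * s₁ =
      (rat R (7/6) * lam ^ 2 - rat R (7/384) * lam + rat R (7/1536) * mu - rat R (7/98304)) • a i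
        + (rat R (49/768) * lam - rat R (245/196608)) • (a (i - 1) + a (i + 1))
        + (rat R (49/196608)) • (a (i - 2) + a (i + 2))
        + (-(rat R (5/12) * lam) - rat R (13/1536)) • s₁
        + (-(rat R (7/1536))) • s i
        + (rat R (7/2048)) • s (i + 1)
  sig_one_sig : ∀ i, s₁ * s i =
      (rat R (256/3) * lam ^ 3 - rat R (9/2) * lam ^ 2 + rat R (1/3) * lam * mu
          + rat R (17/384) * lam - rat R (19/1536) * mu + rat R (19/98304)) • a i
        + (rat R (14/3) * lam ^ 2 - rat R (203/768) * lam
          + rat R (665/196608)) • (a (i - 1) + a (i + 1))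
        + (rat R (7/384) * lam - rat R (133/196608)) • (a (i - 2) + a (i + 2))
        + (-(rat R (304/3) * lam ^ 2) + rat R (41/6) * lam + rat R (17/16) * mu
          - rat R (197/1536)) • s₁
        + (-(rat R (17/24) * lam) + rat R (11/768)) • s i
        + (-(rat R (7/8) * lam) + rat R (49/2048)) • s (i + 1)
  sig_same : ∀ i, s i * s i =
      (rat R 2621440 * lam ^ 4 - rat R (820096/3) * lam ^ 3 - rat R 10880 * lam ^ 2 * mu
          + rat R (20303/2) * lam ^ 2 + rat R (2329/6) * lam * mu + rat R (3/2) * mu ^ 2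
          - rat R (61409/384) * lam - rat R (5315/1536) * mu + rat R (89069/98304)) • a i
        + (rat R 3584 * lam ^ 3 - rat R (791/3) * lam ^ 2 + rat R (2317/384) * lam
          - rat R (8645/196608)) • (a (i - 1) + a (i + 1))
        + (-(rat R 49 * lam ^ 2) + rat R (343/192) * lam + rat R (21/256) * mu
          - rat R (3563/196608)) • (a (i - 2) + a (i + 2))
        + (-(rat R 3145728 * lam ^ 4) + rat R 737280 * lam ^ 3 - rat R 12288 * lam ^ 2 * mu
          - rat R (120368/3) * lam ^ 2 + rat R 448 * lam * mu + rat R (4819/6) * lam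
          - rat R (65/16) * mu - rat R (65/12)) • s₁
        + (-(rat R 49152 * lam ^ 3) - rat R 1584 * lam ^ 2 - rat R 192 * lam * mu
          + rat R (2837/24) * lam + rat R (47/16) * mu - rat R (4079/3072)) • s i
        + (-(rat R 672 * lam ^ 2) + rat R (49/2) * lam - rat R (455/2048)) • s (i + 1)
  sig_other : ∀ i, s i * s (i + 1) =
      (rat R (54427648/21) * lam ^ 4 - rat R (808576/3) * lam ^ 3
          - rat R (233344/21) * lam ^ 2 * mu + rat R (139721/14) * lam ^ 2
          + rat R (2419/6) * lam * mu + rat R (22/21) * mu ^ 2 - rat R (105347/672) * lam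
          - rat R (1877/512) * mu + rat R (609391/688128)) • a i
        + (rat R (98304/7) * lam ^ 4 + rat R (23936/21) * lam ^ 3
          + rat R (384/7) * lam ^ 2 * mu - rat R (403/3) * lam ^ 2
          - rat R (113/42) * lam * mu + rat R (4433/1344) * lam + rat R (85/2688) * mu
          - rat R (32635/1376256)) • (a (i - 1) + a (i + 1))
        + (rat R 768 * lam ^ 3 - rat R (346/3) * lam ^ 2 + rat R 3 * lam * mu
          + rat R (927/256) * lam - rat R (1/768) * mu
          - rat R (6751/196608)) • (a (i - 2) + a (i + 2))
        + (-(rat R 3145728 * lam ^ 4) + rat R (15515648/21) * lam ^ 3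
          - rat R 12288 * lam ^ 2 * mu - rat R (847888/21) * lam ^ 2
          + rat R (9536/21) * lam * mu + rat R (34201/42) * lam - rat R (1441/336) * mu
          - rat R (29899/5376)) • s₁
        + (-(rat R 49152 * lam ^ 3) - rat R (4240/3) * lam ^ 2 - rat R 192 * lam * mu
          + rat R (889/8) * lam + rat R (137/48) * mu - rat R (3865/3072)) • s i
        + (-(rat R 864 * lam ^ 2) + rat R (137/4) * lam - rat R (707/2048)) • s (i + 1)

/-- The values of the form, where `s i` is `σ₂ᵉ` for even `i` and `σ₂ᵒ` for odd `i`. -/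
structure IsFormTable (lam mu : R) (B : A →ₗ[R] A →ₗ[R] R) (a : ℤ → A) (s₁ : A) (s : ℤ → A) :
    Prop where
  symm : ∀ x y, B x y = B y x
  axis_zero : ∀ i, B (a i) (a i) = 1
  axis_one : ∀ i, B (a i) (a (i + 1)) = lam
  axis_two : ∀ i, B (a i) (a (i + 2)) = mu
  axis_three : ∀ i, B (a i) (a (i + 3)) =
      -(rat R (32768/7) * lam ^ 3) + rat R (36864/7) * lam ^ 2 - rat R (1920/7) * lam * mu
          - rat R (2169/7) * lam - rat R (33/7) * mu + rat R (33/7)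
  axis_four : ∀ i, B (a i) (a (i + 4)) =
      rat R (8388608/7) * lam ^ 4 - rat R (9601024/7) * lam ^ 3 + rat R 65536 * lam ^ 2 * mu
          + rat R 110592 * lam ^ 2 - rat R (640/7) * lam * mu - rat R (128/7) * mu ^ 2
          - rat R (19840/7) * lam - rat R 3 * mu + rat R (156/7)
  axis_sig_one : ∀ i, B (a i) s₁ = rat R (31 / 32) * lam - rat R (1 / 32)
  axis_sig_same : ∀ i, B (a i) (s i) = rat R (31 / 32) * mu - rat R (1 / 32)
  axis_sig_other : ∀ i, B (a i) (s (i + 1)) =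
      rat R (15 / 16) * lam + rat R (1 / 32) * mu - rat R (1 / 32)
  sig_one_sig_one : B s₁ s₁ =
      rat R (3/4) * lam ^ 2 + rat R (65/512) * lam + rat R (7/2048) * mu - rat R (3/2048)
  sig_one_sig : ∀ i, B s₁ (s i) =
      -(rat R 16 * lam ^ 3) + rat R 18 * lam ^ 2 - rat R (3/16) * lam * mu
          - rat R (463/512) * lam - rat R (83/2048) * mu + rat R (23/2048)
  sig_same : ∀ i, B (s i) (s i) =
      rat R 4096 * lam ^ 4 - rat R 4688 * lam ^ 3 + rat R 224 * lam ^ 2 * mu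
          + rat R 378 * lam ^ 2 - rat R (5/16) * lam * mu + rat R (11/16) * mu ^ 2
          - rat R (155/16) * lam + rat R (239/2048) * mu + rat R (153/2048)
  sig_other : ∀ i, B (s i) (s (i + 1)) =
      rat R (4096/7) * lam ^ 4 - rat R 656 * lam ^ 3 + rat R (128/7) * lam ^ 2 * mu
          + rat R (366/7) * lam ^ 2 + rat R (277/112) * lam * mu - rat R (1/16) * mu ^ 2
          - rat R (335/256) * lam + rat R (761/14336) * mu + rat R (135/14336)

end Tables

/-- The coefficient ring of the universal Frobenius `𝔙(4,3)`-axial algebra on two generators. -/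
abbrev R43 : Type := UCoeff V43

/-- The universal Frobenius `𝔙(4,3)`-axial algebra on two generators. -/
abbrev U43 : Type := UAlg V43

/-- The form of the universal algebra. -/
abbrev form43 : U43 →ₗ[R43] U43 →ₗ[R43] R43 := UAlg.form V43

end Axial

end

namespace Axial

open Module (End)

/-! ### Computation with formal linear combinations -/

/-! Universality is formal. Distinct rationals differ by units of R, so a sum of eigenspaces of `ad
a` is the kernel of a product of coprime linear factors. Hence, for an associative form with ⟨a, a⟩
= 1, being an axis is equivalent to the polynomial identities of `IsPolyAxis` (`IsAxis.isPolyAxis`,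
`IsPolyAxis.isAxis`). These identities are linear in x and y, so imposing them on magma elements
imposes them on all of U. Conversely, the evaluation map into an algebra satisfying them kills every
relator (`UAlg.exists_lift`, `UAlg.lift_unique`). The algebra ℚ with axis 1 shows that the
coefficient ring is nonzero.

The tables rest on dihedral symmetry. The ℤ/2-grading makes τ₀ and τ₁ automorphisms preserving the
form, and they reflect the sequence a_j in a_0 and a_1 (`isDihedral_axisSeq`). An identity around
a_0 proved for every such sequence therefore holds after every shift and reflection. Since a_i acts
as 1/32 on the odd vector a_{i+k} - a_{i-k}, the element σ(a_i, a_{i+k}) is unchanged when k changes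
sign; so σ₁ is common to all adjacent pairs and σ₂ depends only on parity.

Write a_k + a_{-k} = 2⟨a_0, a_k⟩ a_0 + x_k + y_k with x_k in A_0 and y_k in A_{1/4}; here y_k
contains 8 σ(a_0, a_k). The form sharpens the fusion rules: A_0 A_0 lies in A_0, and a_0 (y y) =
(1/4)⟨y, y⟩ a_0 for y in A_{1/4}. The consequences are these relations. - a_0 y_k = y_k / 4
determines a_0 σ(a_0, a_k) for k = 1, 2. - a_0 (x_1² - y_1²) = -(1/4)⟨y_1, y_1⟩ a_0 involves no
product of two σ's, and determines a_0 σ₂ᵒ. Pairing the result with a_0 forces ⟨a_0, a_2⟩ = ⟨a_1,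
a_{-1}⟩, so a single μ suffices (`IsDihedralOne.form_two_eq`). - a_0 (x_k (x_n + y_n)) = x_k y_n / 4
determines σ₁², σ₁σ₂ᵉ and (σ₂ᵉ)². - σ₁² has one expression around a_0 and another around a_1. Their
difference is the recurrence for a_3 (`IsDihedralTwo.recurrence`), which yields a_0 a_3 and a_0 a_4
and, multiplied by σ₂ᵉ, also σ₂ᵉσ₂ᵒ. - The remaining values of the form follow from its
associativity.

The arithmetic is done by reflection. Formal combinations of atoms over ℚ[λ, μ] are evaluated in A
or R by linear maps, and every table entry is certified by a vanishing test run in the kernel, often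
after subtracting a rational multiple of a known relation.

The ℚ[λ, μ]-span of the eight elements is closed under products, contains a_0 and a_1, and has form
values in ℚ[λ, μ]. It therefore contains all magma elements, and every λ_[x, y] lies in ℚ[λ, μ].
This gives the coefficient ring and the spanning statement (`adjoin_eq_top`, `span_eq_top`). -/

/-- Polynomials in two variables with rational coefficients, as lists of monomials
`(i, j, c)`, which stand for `c λ ^ i μ ^ j`. -/
abbrev Poly : Type := List (ℕ × ℕ × ℚ)

/-- Names for elements of an algebra that contains a sequence of axes: the unit of the coefficient
ring, the axes, the elements `σ₁`, `σ₂ᵉ`, `σ₂ᵒ`, and products. -/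
inductive Atom : Type
  | one : Atom
  | ax (i : ℤ) : Atom
  | sigOne : Atom
  | sigTwo (odd : Bool) : Atom
  | prod (x y : Atom) : Atom
  deriving DecidableEq

/-- Formal linear combinations of atoms. -/
abbrev Comb : Type := List (Atom × Poly)

namespace Poly

variable {R : Type*} [CommRing R] [Algebra ℚ R] (l m : R)

/-- The value of a polynomial at `l`, `m`. -/
def eval : Poly → R
  | [] => 0
  | t :: p => algebraMap ℚ R t.2.2 * (l ^ t.1 * m ^ t.2.1) + eval p

/-- Add a monomial. -/
def insert (t : ℕ × ℕ × ℚ) : Poly → Poly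
  | [] => [t]
  | t' :: p =>
    bif t.1 == t'.1 && t.2.1 == t'.2.1 then (t.1, t.2.1, t.2.2 + t'.2.2) :: p
    else t' :: insert t p

theorem eval_insert (t : ℕ × ℕ × ℚ) (p : Poly) :
    eval l m (insert t p) = algebraMap ℚ R t.2.2 * (l ^ t.1 * m ^ t.2.1) + eval l m p := by
  induction p with
  | nil => rfl
  | cons t' p ih =>
    rw [insert]
    cases h : (t.1 == t'.1 && t.2.1 == t'.2.1)
    · rw [cond_false, eval, eval, ih]; ring
    · simp only [Bool.and_eq_true, beq_iff_eq] at h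
      rw [cond_true, eval, eval, map_add, ← h.1, ← h.2]; ring

/-- The sum of two polynomials. -/
def add (p q : Poly) : Poly := p.foldr insert q

theorem eval_add (p q : Poly) : eval l m (add p q) = eval l m p + eval l m q := by
  induction p with
  | nil => simp [add, eval]
  | cons t p ih =>
    have : add (t :: p) q = insert t (add p q) := rfl
    rw [this, eval_insert, ih, eval]; ring

/-- The product of a polynomial by a monomial. -/
def mulMonomial (t : ℕ × ℕ × ℚ) (p : Poly) : Poly :=
  p.map fun t' => (t.1 + t'.1, t.2.1 + t'.2.1, t.2.2 * t'.2.2)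

theorem eval_mulMonomial (t : ℕ × ℕ × ℚ) (p : Poly) :
    eval l m (mulMonomial t p) = algebraMap ℚ R t.2.2 * (l ^ t.1 * m ^ t.2.1) * eval l m p := by
  induction p with
  | nil => simp [mulMonomial, eval]
  | cons t' p ih =>
    have : mulMonomial t (t' :: p) =
      (t.1 + t'.1, t.2.1 + t'.2.1, t.2.2 * t'.2.2) :: mulMonomial t p := rfl
    rw [this, eval, eval, ih, map_mul]; ring

/-- The product of two polynomials. -/
def mul (p q : Poly) : Poly := p.foldr (fun t r => add (mulMonomial t q) r) []

theorem eval_mul (p q : Poly) : eval l m (mul p q) = eval l m p * eval l m q := by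
  induction p with
  | nil => simp [mul, eval]
  | cons t p ih =>
    have : mul (t :: p) q = add (mulMonomial t q) (mul p q) := rfl
    rw [this, eval_add, eval_mulMonomial, ih, eval]; ring

/-- All coefficients vanish. -/
def isZero (p : Poly) : Bool := p.all fun t => t.2.2.num == 0

theorem eval_of_isZero {p : Poly} (h : isZero p = true) : eval l m p = 0 := by
  induction p with
  | nil => rfl
  | cons t p ih =>
    simp only [isZero, List.all_cons, Bool.and_eq_true, beq_iff_eq, Rat.num_eq_zero] at h
    rw [eval, h.1, map_zero, zero_mul, zero_add]
    exact ih h.2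

/-- A constant polynomial. -/
def const (c : ℚ) : Poly := [(0, 0, c)]

theorem eval_const (c : ℚ) : eval l m (const c) = algebraMap ℚ R c := by
  simp [const, eval]

theorem eval_mem (S : Subalgebra ℚ R) (hl : l ∈ S) (hm : m ∈ S) (p : Poly) : eval l m p ∈ S := by
  induction p with
  | nil => exact S.zero_mem
  | cons t p ih =>
    exact S.add_mem (S.mul_mem (S.algebraMap_mem _)
      (S.mul_mem (S.pow_mem hl _) (S.pow_mem hm _))) ih

end Poly

namespace Comb

section

variable {R A M : Type*} [CommRing R] [Algebra ℚ R] [AddCommGroup A] [Module R A]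
  [AddCommGroup M] [Module R M] (l m : R) (v : Atom → A) (w : Atom → M)

/-- The value of a formal linear combination. -/
def eval : Comb → A
  | [] => 0
  | t :: x => t.2.eval l m • v t.1 + eval x

/-- Add a term. -/
def insert (t : Atom × Poly) : Comb → Comb
  | [] => [t]
  | t' :: x => if t.1 = t'.1 then (t.1, t.2.add t'.2) :: x else t' :: insert t x

theorem eval_insert (t : Atom × Poly) (x : Comb) :
    eval l m v (insert t x) = t.2.eval l m • v t.1 + eval l m v x := by
  induction x with
  | nil => rfl
  | cons t' x ih =>
    rw [insert]
    split_ifs with h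
    · rw [eval, eval, Poly.eval_add, add_smul, ← h, add_assoc]
    · rw [eval, eval, ih, add_left_comm]

/-- The sum of two linear combinations. -/
def add (x y : Comb) : Comb := x.foldr insert y

theorem eval_add (x y : Comb) : eval l m v (add x y) = eval l m v x + eval l m v y := by
  induction x with
  | nil => simp [add, eval]
  | cons t x ih =>
    have : add (t :: x) y = insert t (add x y) := rfl
    rw [this, eval_insert, ih, eval, add_assoc]

/-- A multiple of a linear combination. -/
def smul (p : Poly) (x : Comb) : Comb := x.map fun t => (t.1, p.mul t.2)

theorem eval_smul (p : Poly) (x : Comb) :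
    eval l m v (smul p x) = p.eval l m • eval l m v x := by
  induction x with
  | nil => simp [smul, eval]
  | cons t x ih =>
    have : smul p (t :: x) = (t.1, p.mul t.2) :: smul p x := rfl
    rw [this, eval, eval, ih, Poly.eval_mul, smul_add, mul_smul]

/-- The linear extension of a map on atoms. -/
def lift (r : Atom → Comb) (x : Comb) : Comb := x.foldr (fun t y => add (smul t.2 (r t.1)) y) []

/-- The engine of the computations: a linear map known on atoms is computed symbolically on every
combination. Source and target may use different interpretations of atoms, so values of the form are
also covered. -/
theorem eval_lift (f : A →ₗ[R] M) (r : Atom → Comb) (h : ∀ s, f (v s) = eval l m w (r s))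
    (x : Comb) : eval l m w (lift r x) = f (eval l m v x) := by
  induction x with
  | nil => simp [lift, eval]
  | cons t x ih =>
    have : lift r (t :: x) = add (smul t.2 (r t.1)) (lift r x) := rfl
    rw [this, eval_add, eval_smul, ih, eval, map_add, map_smul, h]

/-- The bilinear extension of a map on pairs of atoms. -/
def lift₂ (r : Atom → Atom → Comb) (x y : Comb) : Comb := lift (fun s => lift (r s) y) x

theorem eval_lift₂ (f : A →ₗ[R] A →ₗ[R] M) (r : Atom → Atom → Comb)
    (h : ∀ s t, f (v s) (v t) = eval l m w (r s t)) (x y : Comb) :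
    eval l m w (lift₂ r x y) = f (eval l m v x) (eval l m v y) :=
  eval_lift l m v w (f.flip (eval l m v y)) _
    (fun s => (eval_lift l m v w (f (v s)) (r s) (h s) y).symm) x

/-- All coefficients vanish. -/
def isZero (x : Comb) : Bool := x.all fun t => t.2.isZero

theorem eval_of_isZero {x : Comb} (h : isZero x = true) : eval l m v x = 0 := by
  induction x with
  | nil => rfl
  | cons t x ih =>
    simp only [isZero, List.all_cons, Bool.and_eq_true] at h
    rw [eval, Poly.eval_of_isZero l m h.1, zero_smul, zero_add]
    exact ih h.2

/-- A rational multiple of a linear combination. -/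
def ratSmul (c : ℚ) (x : Comb) : Comb := smul (Poly.const c) x

theorem eval_ratSmul (c : ℚ) (x : Comb) :
    eval l m v (ratSmul c x) = algebraMap ℚ R c • eval l m v x := by
  rw [ratSmul, eval_smul, Poly.eval_const]

/-- The difference of two linear combinations. -/
def sub (x y : Comb) : Comb := add x (ratSmul (-1) y)

theorem eval_sub (x y : Comb) : eval l m v (sub x y) = eval l m v x - eval l m v y := by
  rw [sub, eval_add, eval_ratSmul, map_neg, map_one, neg_one_smul, sub_eq_add_neg]

theorem eval_eq {x y : Comb} (h : isZero (sub x y) = true) : eval l m v x = eval l m v y :=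
  sub_eq_zero.1 ((eval_sub l m v x y).symm.trans (eval_of_isZero l m v h))

/-- An atom as a linear combination. -/
def single (s : Atom) : Comb := [(s, Poly.const 1)]

theorem eval_single (s : Atom) : eval l m v (single s) = v s := by
  simp [single, eval, Poly.eval_const]

theorem eval_mem {N : AddSubmonoid A} (x : Comb) (h : ∀ t ∈ x, t.2.eval l m • v t.1 ∈ N) :
    eval l m v x ∈ N := by
  induction x with
  | nil => exact N.zero_mem
  | cons t x ih =>
    exact N.add_mem (h t List.mem_cons_self) (ih fun t ht => h t (List.mem_cons_of_mem _ ht))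

end

end Comb

/-! ### Eigenspaces and axes -/

section Axes

variable {R A : Type*} [CommRing R] [Algebra ℚ R] [NonUnitalNonAssocCommRing A] [Module R A]
  [IsScalarTower R A A] [SMulCommClass R A A]

theorem mem_eig {a x : A} {θ : ℚ} : x ∈ eig R a θ ↔ a * x = rat R θ • x :=
  Module.End.mem_eigenspace_iff

theorem rat_zero : rat R 0 = 0 := map_zero _

theorem rat_one : rat R 1 = 1 := map_one _

theorem rat_add (c d : ℚ) : rat R (c + d) = rat R c + rat R d := map_add _ c d

theorem rat_sub (c d : ℚ) : rat R (c - d) = rat R c - rat R d := map_sub _ c d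

theorem rat_mul (c d : ℚ) : rat R (c * d) = rat R c * rat R d := map_mul _ c d

/-- A nonzero rational is a unit of R. This is what replaces working over a field. -/
theorem rat_mul_cancel {M : Type*} [AddCommGroup M] [Module R M] {c : ℚ} (hc : c ≠ 0) {x : M}
    (h : rat R c • x = 0) : x = 0 := by
  have h' : rat R c⁻¹ • rat R c • x = 0 := by rw [h, smul_zero]
  rwa [smul_smul, ← rat_mul, inv_mul_cancel₀ hc, rat_one, one_smul] at h'

/-- The form is associative. -/
def IsAssocForm (B : A →ₗ[R] A →ₗ[R] R) : Prop := ∀ x y z, B (x * y) z = B x (y * z)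

section Form

variable {B : A →ₗ[R] A →ₗ[R] R} (hB : IsAssocForm B)
include hB

/-- Eigenvectors for different eigenvalues are orthogonal. -/
theorem IsAssocForm.orthogonal {a x y : A} {θ η : ℚ} (hne : θ ≠ η) (hx : x ∈ eig R a θ)
    (hy : y ∈ eig R a η) : B x y = 0 := by
  have h : rat R θ • B x y = rat R η • B x y := by
    have h1 := hB x a y
    rw [mul_comm x a, mem_eig.1 hx, mem_eig.1 hy, map_smul, map_smul, LinearMap.smul_apply] at h1
    exact h1
  refine rat_mul_cancel (R := R) (sub_ne_zero.2 hne) ?_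
  rw [rat_sub, sub_smul, h, sub_self]

end Form

/-- The subspace on which the Miyamoto involution is `1`. -/
def plusPart (R : Type*) {A : Type*} [CommRing R] [Algebra ℚ R] [NonUnitalNonAssocCommRing A]
    [Module R A] [IsScalarTower R A A] [SMulCommClass R A A] (a : A) : Submodule R A :=
  eig R a 1 ⊔ eig R a 0 ⊔ eig R a (1 / 4)

variable {a : A}

theorem mem_one_zero {x : A} (h : IsAxis R V43 a) (hx : x ∈ eig R a 1 ⊔ eig R a 0) :
    ∃ r : R, ∃ y ∈ eig R a 0, x = r • a + y := by
  obtain ⟨u, hu, y, hy, rfl⟩ := Submodule.mem_sup.1 hx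
  rw [h.primitive, Submodule.mem_span_singleton] at hu
  obtain ⟨r, rfl⟩ := hu
  exact ⟨r, y, hy, rfl⟩

theorem IsAxis.mem_eig_one (h : IsAxis R V43 a) : a ∈ eig R a 1 :=
  mem_eig.2 (by rw [h.idem, rat_one, one_smul])

section Form

variable {B : A →ₗ[R] A →ₗ[R] R} (hB : IsAssocForm B) (h : IsAxis R V43 a)
include hB h

theorem IsAxis.form_eig {x : A} {θ : ℚ} (hθ : θ ≠ 1) (hx : x ∈ eig R a θ) : B a x = 0 :=
  hB.orthogonal hθ.symm h.mem_eig_one hx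

theorem IsAxis.form_eig' {x : A} {θ : ℚ} (hθ : θ ≠ 1) (hx : x ∈ eig R a θ) : B x a = 0 :=
  hB.orthogonal hθ hx h.mem_eig_one

variable (hn : B a a = 1)
include hn

/-- Multiplication by a keeps only the A_1-component, and the form reads off its coefficient because
a is orthogonal to A_0. -/
theorem IsAxis.mul_of_mem_one_zero {x : A} (hx : x ∈ eig R a 1 ⊔ eig R a 0) :
    a * x = B a x • a := by
  obtain ⟨r, y, hy, rfl⟩ := mem_one_zero h hx
  rw [map_add, map_smul, hn, h.form_eig hB (by norm_num) hy, mul_add, mul_smul_comm, h.idem,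
    mem_eig.1 hy, rat_zero, zero_smul, smul_eq_mul, mul_one, add_zero, add_zero]

/-- The rule 0 ⋆ 0 = {1, 0} allows an A_1-component, but its coefficient is ⟨a, xy⟩ = ⟨ax, y⟩ = 0.
-/
theorem IsAxis.mul_zero_zero {x y : A} (hx : a * x = 0) (hy : a * y = 0) : a * (x * y) = 0 := by
  have e : ∀ {z : A}, a * z = 0 → z ∈ eig R a 0 := fun hz =>
    mem_eig.2 (by rw [hz, rat_zero, zero_smul])
  have hf := h.fusion 0 (by simp [V43]) 0 (by simp [V43]) x (e hx) y (e hy)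
  have hs : V43.star 0 0 = {1, 0} := by norm_num [V43, starV43]
  rw [hs, Finset.iSup_insert, Finset.iSup_singleton] at hf
  rw [h.mul_of_mem_one_zero hB hn hf, ← hB, hx, map_zero, LinearMap.zero_apply, zero_smul]

/-- The product lies in A_1 + A_0, and the coefficient of a is ⟨a, xy⟩ = ⟨ax, y⟩. -/
theorem IsAxis.mul_quarter_quarter {x y : A} (hx : a * x = rat R (1 / 4) • x)
    (hy : a * y = rat R (1 / 4) • y) : a * (x * y) = (rat R (1 / 4) * B x y) • a := by
  have hf := h.fusion (1 / 4) (by simp [V43]) (1 / 4) (by simp [V43]) x (mem_eig.2 hx) y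
    (mem_eig.2 hy)
  have hs : V43.star (1 / 4) (1 / 4) = {1, 0} := by norm_num [V43, starV43]
  rw [hs, Finset.iSup_insert, Finset.iSup_singleton] at hf
  rw [h.mul_of_mem_one_zero hB hn hf, ← hB, hx, map_smul, LinearMap.smul_apply, smul_eq_mul]

end Form

theorem IsAxis.mul_zero_quarter (h : IsAxis R V43 a) {x y : A} (hx : a * x = 0)
    (hy : a * y = rat R (1 / 4) • y) : a * (x * y) = rat R (1 / 4) • (x * y) := by
  have hf := h.fusion 0 (by simp [V43]) (1 / 4) (by simp [V43]) x
    (mem_eig.2 (by rw [hx, rat_zero, zero_smul])) y (mem_eig.2 hy)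
  have hs : V43.star 0 (1 / 4) = {1 / 4} := by norm_num [V43, starV43]
  rw [hs, Finset.iSup_singleton] at hf
  exact mem_eig.1 hf

section Even

variable {B : A →ₗ[R] A →ₗ[R] R} (hB : IsAssocForm B) (h : IsAxis R V43 a) (hn : B a a = 1)
  {x : A} (hx : x ∈ plusPart R a)
include hB h hn hx

/-- Pairing with a kills A_0 and A_{1/4}, so the coefficient of a is forced. -/
theorem IsAxis.plus_decomp : ∃ y ∈ eig R a 0, ∃ z ∈ eig R a (1 / 4), x = B a x • a + y + z := by
  obtain ⟨u, hu, z, hz, rfl⟩ := Submodule.mem_sup.1 hx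
  obtain ⟨r, y, hy, rfl⟩ := mem_one_zero h hu
  refine ⟨y, hy, z, hz, ?_⟩
  rw [map_add, map_add, map_smul, hn, h.form_eig hB (by norm_num) hy,
    h.form_eig hB (by norm_num) hz, smul_eq_mul, mul_one, add_zero, add_zero]

/-- The component in `A_{1/4}` of an element of the positive part. -/
theorem IsAxis.plus_quarter :
    a * (rat R 4 • (a * x - B a x • a)) = rat R (1 / 4) • (rat R 4 • (a * x - B a x • a)) := by
  obtain ⟨y, hy, z, hz, e⟩ := h.plus_decomp hB hn hx
  -- Multiplication by a fixes a, kills y and scales z by 1/4, which isolates z.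
  have e' : rat R 4 • (a * x - B a x • a) = z := by
    have ha : a * x = B a x • a + rat R (1 / 4) • z := by
      conv_lhs => rw [e]
      rw [mul_add, mul_add, mul_smul_comm, h.idem, mem_eig.1 hy, mem_eig.1 hz, rat_zero,
        zero_smul, add_zero]
    rw [ha, add_sub_cancel_left, smul_smul, ← rat_mul]
    norm_num
  rw [e', mem_eig.1 hz]

/-- The component in `A_0` of an element of the positive part. -/
theorem IsAxis.plus_zero :
    a * (x - B a x • a - rat R 4 • (a * x - B a x • a)) = 0 := by
  rw [mul_sub, h.plus_quarter hB hn hx, smul_smul, ← rat_mul, mul_sub, mul_smul_comm, h.idem]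
  norm_num

end Even

/-! ### Miyamoto involutions -/

theorem iSup_V43 {L : Type*} [CompleteLattice L] (p : ℚ → L) :
    ⨆ θ ∈ V43.fields, p θ = p 1 ⊔ (p 0 ⊔ (p (1 / 4) ⊔ p (1 / 32))) := by
  have : V43.fields = {1, 0, 1 / 4, 1 / 32} := rfl
  rw [this, Finset.iSup_insert, Finset.iSup_insert, Finset.iSup_insert, Finset.iSup_singleton]

theorem mem_plusPart {θ : ℚ} (hθ : θ ∈ plusV43) {x : A} (hx : x ∈ eig R a θ) :
    x ∈ plusPart R a := by
  simp only [plusV43, Finset.mem_insert, Finset.mem_singleton] at hθ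
  rcases hθ with rfl | rfl | rfl
  · exact Submodule.mem_sup_left (Submodule.mem_sup_left hx)
  · exact Submodule.mem_sup_left (Submodule.mem_sup_right hx)
  · exact Submodule.mem_sup_right hx

theorem IsAxis.exists_decomp (h : IsAxis R V43 a) (x : A) :
    ∃ y ∈ plusPart R a, ∃ z ∈ eig R a (1 / 32), x = y + z := by
  have hx : x ∈ plusPart R a ⊔ eig R a (1 / 32) := by
    rw [plusPart, sup_assoc, sup_assoc, ← iSup_V43 (eig R a), h.semisimple]
    trivial
  obtain ⟨y, hy, z, hz, rfl⟩ := Submodule.mem_sup.1 hx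
  exact ⟨y, hy, z, hz, rfl⟩

/-- Induction over the positive part. -/
theorem plusPart_induction {p : A → Prop} (hp : ∀ θ ∈ plusV43, ∀ x ∈ eig R a θ, p x)
    (hadd : ∀ x y, p x → p y → p (x + y)) {x : A} (hx : x ∈ plusPart R a) : p x := by
  obtain ⟨u, hu, z, hz, rfl⟩ := Submodule.mem_sup.1 hx
  obtain ⟨w, hw, y, hy, rfl⟩ := Submodule.mem_sup.1 hu
  exact hadd _ _ (hadd _ _ (hp 1 (by simp [plusV43]) _ hw) (hp 0 (by simp [plusV43]) _ hy))
    (hp (1 / 4) (by simp [plusV43]) _ hz)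

/-- The polynomial `t (t - 1) (t - 1 / 4)`, normalized to be `2` at `1 / 32`. -/
def miyamotoPoly (R : Type*) {A : Type*} [CommRing R] [Algebra ℚ R]
    [NonUnitalNonAssocCommRing A] [Module R A] [IsScalarTower R A A] [SMulCommClass R A A]
    (a : A) : A →ₗ[R] A :=
  let T := LinearMap.mulLeft R a
  rat R (65536 / 217) • (T ∘ₗ (T - 1) ∘ₗ (T - rat R (1 / 4) • 1))

theorem miyamotoPoly_apply {θ : ℚ} {x : A} (hx : x ∈ eig R a θ) :
    miyamotoPoly R a x = rat R (65536 / 217 * (θ * (θ - 1) * (θ - 1 / 4))) • x := by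
  have hx := mem_eig.1 hx
  simp only [miyamotoPoly, LinearMap.smul_apply, LinearMap.comp_apply, LinearMap.sub_apply,
    LinearMap.mulLeft_apply, Module.End.one_apply, hx, ← sub_smul, mul_smul_comm, smul_smul,
    map_mul, map_sub, map_one]
  congr 1
  ring

/-- The linear map which is `1` on the positive and `-1` on the negative part. -/
def miyamotoMap (R : Type*) {A : Type*} [CommRing R] [Algebra ℚ R]
    [NonUnitalNonAssocCommRing A] [Module R A] [IsScalarTower R A A] [SMulCommClass R A A]
    (a : A) : A →ₗ[R] A := 1 - miyamotoPoly R a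

theorem miyamotoMap_plus {x : A} (hx : x ∈ plusPart R a) : miyamotoMap R a x = x := by
  refine plusPart_induction (p := fun x => miyamotoMap R a x = x) (fun θ hθ x hx => ?_)
    (fun x y h1 h2 => by rw [map_add, h1, h2]) hx
  rw [miyamotoMap, LinearMap.sub_apply, miyamotoPoly_apply hx, Module.End.one_apply]
  have : θ * (θ - 1) * (θ - 1 / 4) = 0 := by
    simp only [plusV43, Finset.mem_insert, Finset.mem_singleton] at hθ
    rcases hθ with rfl | rfl | rfl <;> norm_num
  rw [this, mul_zero, rat_zero, zero_smul, sub_zero]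

theorem miyamotoMap_minus {x : A} (hx : x ∈ eig R a (1 / 32)) : miyamotoMap R a x = -x := by
  rw [miyamotoMap, LinearMap.sub_apply, miyamotoPoly_apply hx, Module.End.one_apply]
  have : (65536 / 217 * (1 / 32 * (1 / 32 - 1) * (1 / 32 - 1 / 4)) : ℚ) = 1 + 1 := by
    norm_num
  rw [this, rat_add, rat_one, add_smul, one_smul]
  abel

theorem iSup_eig_le_plusPart {s : Finset ℚ} (hs : s ⊆ plusV43) :
    ⨆ ζ ∈ s, eig R a ζ ≤ plusPart R a :=
  iSup₂_le fun _ hζ _ hx => mem_plusPart (hs hζ) hx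

/-! ### The ℤ/2-grading and the existence of Miyamoto involutions -/

section Grading

variable (h : IsAxis R V43 a)
include h

theorem IsAxis.plus_mul_plus {x y : A} (hx : x ∈ plusPart R a) (hy : y ∈ plusPart R a) :
    x * y ∈ plusPart R a := by
  refine plusPart_induction (p := fun x => x * y ∈ plusPart R a) (fun θ hθ x hx => ?_)
    (fun x z h1 h2 => by rw [add_mul]; exact add_mem h1 h2) hx
  refine plusPart_induction (p := fun y => x * y ∈ plusPart R a) (fun η hη y hy => ?_)
    (fun x z h1 h2 => by rw [mul_add]; exact add_mem h1 h2) hy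
  have hsub : plusV43 ⊆ V43.fields := by simp [plusV43, V43, Finset.subset_iff]
  refine iSup_eig_le_plusPart ?_ (h.fusion θ (hsub hθ) η (hsub hη) x hx y hy)
  simp only [plusV43, Finset.mem_insert, Finset.mem_singleton] at hθ hη
  rcases hθ with rfl | rfl | rfl <;> rcases hη with rfl | rfl | rfl <;>
    norm_num [V43, starV43, plusV43, Finset.subset_iff]

theorem IsAxis.plus_mul_minus {x y : A} (hx : x ∈ plusPart R a) (hy : y ∈ eig R a (1 / 32)) :
    x * y ∈ eig R a (1 / 32) := by
  refine plusPart_induction (p := fun x => x * y ∈ eig R a (1 / 32)) (fun θ hθ x hx => ?_)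
    (fun x z h1 h2 => by rw [add_mul]; exact add_mem h1 h2) hx
  have hsub : plusV43 ⊆ V43.fields := by simp [plusV43, V43, Finset.subset_iff]
  have hf := h.fusion θ (hsub hθ) (1 / 32) (by simp [V43]) x hx y hy
  have hs : V43.star θ (1 / 32) = {1 / 32} := by
    simp only [plusV43, Finset.mem_insert, Finset.mem_singleton] at hθ
    rcases hθ with rfl | rfl | rfl <;> norm_num [V43, starV43]
  rwa [hs, Finset.iSup_singleton] at hf

theorem IsAxis.minus_mul_minus {x y : A} (hx : x ∈ eig R a (1 / 32))
    (hy : y ∈ eig R a (1 / 32)) : x * y ∈ plusPart R a := by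
  have hf := h.fusion (1 / 32) (by simp [V43]) (1 / 32) (by simp [V43]) x hx y hy
  refine iSup_eig_le_plusPart ?_ hf
  norm_num [V43, starV43, plusV43]

theorem IsAxis.miyamotoMap_miyamotoMap (x : A) : miyamotoMap R a (miyamotoMap R a x) = x := by
  obtain ⟨y, hy, z, hz, rfl⟩ := h.exists_decomp x
  rw [map_add, miyamotoMap_plus hy, miyamotoMap_minus hz, map_add, map_neg, miyamotoMap_plus hy,
    miyamotoMap_minus hz, neg_neg]

theorem IsAxis.miyamotoMap_mul (x y : A) :
    miyamotoMap R a (x * y) = miyamotoMap R a x * miyamotoMap R a y := by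
  obtain ⟨x, hx, x', hx', rfl⟩ := h.exists_decomp x
  obtain ⟨y, hy, y', hy', rfl⟩ := h.exists_decomp y
  have e : (x + x') * (y + y') = (x * y + x' * y') + (x * y' + y * x') := by
    rw [add_mul, mul_add, mul_add, mul_comm x' y]; abel
  rw [e, map_add, miyamotoMap_plus (add_mem (h.plus_mul_plus hx hy) (h.minus_mul_minus hx' hy')),
    miyamotoMap_minus (add_mem (h.plus_mul_minus hx hy') (h.plus_mul_minus hy hx')), map_add,
    map_add, miyamotoMap_plus hx, miyamotoMap_plus hy, miyamotoMap_minus hx',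
    miyamotoMap_minus hy', add_mul, mul_add, mul_add, mul_comm y x', neg_mul_neg, mul_neg, neg_mul]
  abel

/-- The sign map is a polynomial in `ad a`, so its linearity needs no choice of components. It is
its own inverse, and the grading makes it multiplicative. -/
theorem IsAxis.exists_miyamoto : ∃ τ : A ≃ₗ[R] A, IsMiyamoto a τ := by
  refine ⟨LinearEquiv.ofLinearMap (miyamotoMap R a) (miyamotoMap R a)
    (LinearMap.ext h.miyamotoMap_miyamotoMap) (LinearMap.ext h.miyamotoMap_miyamotoMap),
    h.miyamotoMap_mul, fun θ hθ x hx => miyamotoMap_plus (mem_plusPart hθ hx),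
    fun θ hθ x hx => miyamotoMap_minus ?_⟩
  rwa [minusV43, Finset.mem_singleton.1 hθ] at *

end Grading

/-! ### Action of a Miyamoto involution on the algebra and on the form -/

section Miyamoto

variable {τ : A ≃ₗ[R] A} (hτ : IsMiyamoto a τ)
include hτ

theorem IsMiyamoto.map_plus {x : A} (hx : x ∈ plusPart R a) : τ x = x :=
  plusPart_induction (p := fun x => τ x = x) hτ.plus
    (fun x y h1 h2 => by rw [map_add, h1, h2]) hx

theorem IsMiyamoto.map_minus {x : A} (hx : x ∈ eig R a (1 / 32)) : τ x = -x :=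
  hτ.minus _ (by simp [minusV43]) x hx

variable (h : IsAxis R V43 a)
include h

theorem IsMiyamoto.map_self : τ a = a :=
  hτ.map_plus (mem_plusPart (by simp [plusV43]) h.mem_eig_one)

theorem IsMiyamoto.map_map (x : A) : τ (τ x) = x := by
  obtain ⟨y, hy, z, hz, rfl⟩ := h.exists_decomp x
  rw [map_add, hτ.map_plus hy, hτ.map_minus hz, map_add, map_neg, hτ.map_plus hy,
    hτ.map_minus hz, neg_neg]

theorem IsMiyamoto.add_mem_plus (x : A) : x + τ x ∈ plusPart R a := by
  obtain ⟨y, hy, z, hz, rfl⟩ := h.exists_decomp x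
  rw [map_add, hτ.map_plus hy, hτ.map_minus hz]
  have : y + z + (y + -z) = y + y := by abel
  rw [this]
  exact add_mem hy hy

theorem IsMiyamoto.sub_mem_minus (x : A) : x - τ x ∈ eig R a (1 / 32) := by
  obtain ⟨y, hy, z, hz, rfl⟩ := h.exists_decomp x
  rw [map_add, hτ.map_plus hy, hτ.map_minus hz]
  have : y + z - (y + -z) = z + z := by abel
  rw [this]
  exact add_mem hz hz

/-- The positive and negative parts are orthogonal, having no eigenvalue in common; in the product
of two negative parts the signs cancel. -/
theorem IsMiyamoto.form {B : A →ₗ[R] A →ₗ[R] R} (hB : IsAssocForm B) (x y : A) :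
    B (τ x) (τ y) = B x y := by
  have o : ∀ {p q : A}, p ∈ plusPart R a → q ∈ eig R a (1 / 32) → B p q = 0 ∧ B q p = 0 := by
    intro p q hp hq
    refine plusPart_induction (p := fun p => B p q = 0 ∧ B q p = 0) (fun θ hθ x hx => ?_)
      (fun x y h1 h2 => by simp [h1, h2]) hp
    have hne : θ ≠ 1 / 32 := by
      simp only [plusV43, Finset.mem_insert, Finset.mem_singleton] at hθ
      rcases hθ with rfl | rfl | rfl <;> norm_num
    exact ⟨hB.orthogonal hne hx hq, hB.orthogonal hne.symm hq hx⟩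
  obtain ⟨x, hx, x', hx', rfl⟩ := h.exists_decomp x
  obtain ⟨y, hy, y', hy', rfl⟩ := h.exists_decomp y
  simp [hτ.map_plus hx, hτ.map_plus hy, hτ.map_minus hx', hτ.map_minus hy', o hx hy', o hy hx']

end Miyamoto

end Axes

/-! ### Dihedral sequences of axes -/

namespace Atom

/-- Renaming of the axes by `i ↦ j + d * i`, for `d = 1` or `d = -1`. -/
def move (j d : ℤ) : Atom → Atom
  | one => one
  | ax i => ax (j + d * i)
  | sigOne => sigOne
  | sigTwo b => sigTwo (xor b (j % 2 == 1))
  | prod s t => prod (move j d s) (move j d t)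

end Atom

/-- Renaming of the axes in a linear combination. -/
def Comb.move (j d : ℤ) (x : Comb) : Comb := x.map fun t => (t.1.move j d, t.2)

theorem Comb.eval_move {R A : Type*} [CommRing R] [Algebra ℚ R] [AddCommGroup A] [Module R A]
    (l m : R) {v w : Atom → A} {j d : ℤ} (h : ∀ s, w s = v (s.move j d)) (x : Comb) :
    Comb.eval l m v (x.move j d) = Comb.eval l m w x := by
  induction x with
  | nil => rfl
  | cons t x ih =>
    have : Comb.move j d (t :: x) = (t.1.move j d, t.2) :: Comb.move j d x := rfl
    rw [this, eval, eval, ih, h]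

section Dihedral

variable {R A : Type*} [CommRing R] [Algebra ℚ R] [NonUnitalNonAssocCommRing A] [Module R A]
  [IsScalarTower R A A] [SMulCommClass R A A]

/-- A sequence of axes indexed by `ℤ`, such that the Miyamoto involution of each axis reflects
the sequence in that axis. -/
structure IsDihedral (B : A →ₗ[R] A →ₗ[R] R) (a : ℤ → A) : Prop where
  symm : ∀ x y, B x y = B y x
  assoc : IsAssocForm B
  axis : ∀ i, IsAxis R V43 (a i)
  norm : ∀ i, B (a i) (a i) = 1
  odd : ∀ i k, a (i + k) - a (i - k) ∈ eig R (a i) (1 / 32)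
  even : ∀ i k, a (i + k) + a (i - k) ∈ plusPart R (a i)
  form_refl : ∀ i j k, B (a (2 * i - j)) (a (2 * i - k)) = B (a j) (a k)

variable {B : A →ₗ[R] A →ₗ[R] R} {a : ℤ → A}

theorem IsDihedral.move (h : IsDihedral B a) (j d : ℤ) :
    IsDihedral B fun i => a (j + d * i) where
  symm := h.symm
  assoc := h.assoc
  axis _ := h.axis _
  norm _ := h.norm _
  odd i k := by
    have := h.odd (j + d * i) (d * k)
    rwa [add_assoc, ← mul_add, add_sub_assoc, ← mul_sub] at this
  even i k := by
    have := h.even (j + d * i) (d * k)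
    rwa [add_assoc, ← mul_add, add_sub_assoc, ← mul_sub] at this
  form_refl i k n := by
    have := h.form_refl (j + d * i) (j + d * k) (j + d * n)
    rwa [show 2 * (j + d * i) - (j + d * k) = j + d * (2 * i - k) by ring,
      show 2 * (j + d * i) - (j + d * n) = j + d * (2 * i - n) by ring] at this

/-- This is the eigenvalue equation of a_i on a_{i+k} - a_{i-k}; the correction term 1/32 in σ is
chosen to make it hold. -/
theorem IsDihedral.sig_refl (h : IsDihedral B a) (i k : ℤ) :
    sig R (a i) (a (i - k)) = sig R (a i) (a (i + k)) := by
  have := mem_eig.1 (h.odd i k)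
  rw [mul_sub, smul_sub] at this
  rw [sig, sig, smul_add, smul_add, ← sub_eq_zero]
  rw [← sub_eq_zero] at this
  rw [← neg_eq_zero, ← this]
  abel

omit [IsScalarTower R A A] [SMulCommClass R A A] in
theorem sig_comm (x y : A) : sig R x y = sig R y x := by
  rw [sig, sig, mul_comm, add_comm]

theorem IsDihedral.sig_one_succ (h : IsDihedral B a) (i : ℤ) :
    sig R (a (i + 1)) (a (i + 1 + 1)) = sig R (a i) (a (i + 1)) := by
  rw [← h.sig_refl (i + 1), add_sub_cancel_right, sig_comm]

theorem IsDihedral.sig_one (h : IsDihedral B a) (i : ℤ) :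
    sig R (a i) (a (i + 1)) = sig R (a 0) (a 1) := by
  induction i using Int.induction_on with
  | zero => rw [zero_add]
  | succ i ih => rw [h.sig_one_succ, ih]
  | pred i ih => rw [← ih, ← h.sig_one_succ]; congr 2 <;> ring_nf

theorem IsDihedral.sig_two_succ (h : IsDihedral B a) (i : ℤ) :
    sig R (a (i + 2)) (a (i + 2 + 2)) = sig R (a i) (a (i + 2)) := by
  rw [← h.sig_refl (i + 2), add_sub_cancel_right, sig_comm]

/-- The elements named by atoms. -/
def atomVal (R : Type*) {A : Type*} [CommRing R] [Algebra ℚ R] [NonUnitalNonAssocCommRing A]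
    [Module R A] (a : ℤ → A) : Atom → A
  | .one => 0
  | .ax i => a i
  | .sigOne => sig R (a 0) (a 1)
  | .sigTwo b => if b then sig R (a 1) (a 3) else sig R (a 0) (a 2)
  | .prod s t => atomVal R a s * atomVal R a t

/-- The coefficients named by atoms. -/
def atomForm (B : A →ₗ[R] A →ₗ[R] R) (a : ℤ → A) : Atom → R
  | .one => 1
  | .prod s t => B (atomVal R a s) (atomVal R a t)
  | _ => 0

/-- Reflection in a_{i+2} carries the pair (i, i+2) to (i+4, i+2), so only the parity of i matters.
-/
theorem IsDihedral.sig_two (h : IsDihedral B a) (i : ℤ) :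
    sig R (a i) (a (i + 2)) = atomVal R a (.sigTwo (i % 2 == 1)) := by
  have key : ∀ k : ℤ, ∀ e : ℤ, sig R (a (e + 2 * k)) (a (e + 2 * k + 2)) =
      sig R (a e) (a (e + 2)) := by
    intro k e
    induction k using Int.induction_on with
    | zero => simp
    | succ k ih => rw [← ih, ← h.sig_two_succ (e + 2 * k)]; congr 2 <;> ring_nf
    | pred k ih => rw [← ih, ← h.sig_two_succ]; congr 2 <;> ring_nf
  rcases Int.emod_two_eq_zero_or_one i with hi | hi
  · have := key (i / 2) 0
    rw [show 0 + 2 * (i / 2) = i by omega] at this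
    rw [this, hi]; rfl
  · have := key (i / 2) 1
    rw [show 1 + 2 * (i / 2) = i by omega] at this
    rw [this, hi]; rfl

theorem IsDihedral.sig_two' (h : IsDihedral B a) (i : ℤ) :
    sig R (a i) (a (i - 2)) = atomVal R a (.sigTwo (i % 2 == 1)) := by
  rw [h.sig_refl, h.sig_two]

/-- Renaming atoms amounts to replacing the sequence. A formula proved around a_0 for all dihedral
sequences thereby becomes a formula around every a_j, read in either direction. -/
theorem IsDihedral.atomVal_move (h : IsDihedral B a) (j : ℤ) {d : ℤ} (hd : d = 1 ∨ d = -1)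
    (s : Atom) : atomVal R (fun i => a (j + d * i)) s = atomVal R a (s.move j d) := by
  have e1 : sig R (a j) (a (j + d)) = sig R (a 0) (a 1) := by
    rcases hd with rfl | rfl
    · exact h.sig_one j
    · rw [← sub_eq_add_neg, h.sig_refl, h.sig_one]
  have e2 : ∀ j, sig R (a j) (a (j + d * 2)) = atomVal R a (.sigTwo (j % 2 == 1)) := by
    intro j
    rcases hd with rfl | rfl
    · exact h.sig_two j
    · exact h.sig_two' j
  induction s with
  | one => rfl
  | ax i => rfl
  | sigOne => simpa [atomVal, Atom.move] using e1
  | sigTwo b =>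
    cases b
    · simpa [atomVal, Atom.move] using e2 j
    -- The odd σ₂ is σ(a_1, a_3), which becomes σ(a_{j+d}, a_{j+3d}); as d is odd, the parity of its
    -- index is opposite to that of j.
    · have e3 := e2 (j + d)
      have h3 : j + d + d * 2 = j + d * 3 := by ring
      have h4 : ((j + d) % 2 == 1) = !(j % 2 == 1) := by
        rcases hd with rfl | rfl <;> rcases Int.emod_two_eq_zero_or_one j with hj | hj <;>
        · rw [hj, Bool.eq_iff_iff]
          simp
          omega
      rw [h3, h4] at e3
      simpa [atomVal, Atom.move] using e3
  | prod s t hs ht => exact congrArg₂ (· * ·) hs ht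

theorem IsDihedral.atomForm_move (h : IsDihedral B a) (j : ℤ) {d : ℤ} (hd : d = 1 ∨ d = -1)
    (s : Atom) : atomForm B (fun i => a (j + d * i)) s = atomForm B a (s.move j d) := by
  cases s with
  | prod s t => exact congrArg₂ (fun x y => B x y) (h.atomVal_move j hd s) (h.atomVal_move j hd t)
  | _ => rfl

/-! ### Tables -/

/-- The values of a bilinear map on the axes and the elements `σ`. -/
structure Table where
  ax : ℕ → Comb
  axSigOne : Comb
  axSigSame : Comb
  axSigOther : Comb
  sigOneSigOne : Comb
  sigOneSigTwo : Comb
  sigSame : Comb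
  sigOther : Comb

namespace Table

open Atom

/-- The table in which nothing is known. -/
def unknown : Table where
  ax n := Comb.single (.prod (.ax 0) (.ax n))
  axSigOne := Comb.single (.prod (.ax 0) .sigOne)
  axSigSame := Comb.single (.prod (.ax 0) (.sigTwo false))
  axSigOther := Comb.single (.prod (.ax 0) (.sigTwo true))
  sigOneSigOne := Comb.single (.prod .sigOne .sigOne)
  sigOneSigTwo := Comb.single (.prod .sigOne (.sigTwo false))
  sigSame := Comb.single (.prod (.sigTwo false) (.sigTwo false))
  sigOther := Comb.single (.prod (.sigTwo false) (.sigTwo true))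

/-- The values of the bilinear map on pairs of atoms. -/
def rule (T : Table) : Atom → Atom → Comb
  | .ax i, .ax j =>
    if i ≤ j then (T.ax (j - i).toNat).move i 1 else (T.ax (i - j).toNat).move i (-1)
  | .ax i, .sigOne => T.axSigOne.move i 1
  | .sigOne, .ax i => T.axSigOne.move i 1
  | .ax i, .sigTwo b =>
    if b = (i % 2 == 1) then T.axSigSame.move i 1 else T.axSigOther.move i 1
  | .sigTwo b, .ax i =>
    if b = (i % 2 == 1) then T.axSigSame.move i 1 else T.axSigOther.move i 1
  | .sigOne, .sigOne => T.sigOneSigOne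
  | .sigOne, .sigTwo b => T.sigOneSigTwo.move (if b then 1 else 0) 1
  | .sigTwo b, .sigOne => T.sigOneSigTwo.move (if b then 1 else 0) 1
  | .sigTwo b, .sigTwo c =>
    if b = c then T.sigSame.move (if b then 1 else 0) 1
    else T.sigOther.move (if b then 1 else 0) 1
  | s, t => Comb.single (.prod s t)

variable {M : Type*} [AddCommGroup M] [Module R M]

/-- The table is valid for all sequences in a class `Q`. -/
structure Valid (Q : (ℤ → A) → Prop) (l m : R) (f : A →ₗ[R] A →ₗ[R] M)
    (V : (ℤ → A) → Atom → M) (T : Table) : Prop where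
  ax : ∀ a, Q a → ∀ n : ℕ, f (a 0) (a n) = Comb.eval l m (V a) (T.ax n)
  axSigOne : ∀ a, Q a →
    f (a 0) (atomVal R a sigOne) = Comb.eval l m (V a) T.axSigOne
  axSigSame : ∀ a, Q a →
    f (a 0) (atomVal R a (sigTwo false)) = Comb.eval l m (V a) T.axSigSame
  axSigOther : ∀ a, Q a →
    f (a 0) (atomVal R a (sigTwo true)) = Comb.eval l m (V a) T.axSigOther
  sigOneSigOne : ∀ a, Q a →
    f (atomVal R a sigOne) (atomVal R a sigOne) = Comb.eval l m (V a) T.sigOneSigOne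
  sigOneSigTwo : ∀ a, Q a →
    f (atomVal R a sigOne) (atomVal R a (sigTwo false)) = Comb.eval l m (V a) T.sigOneSigTwo
  sigSame : ∀ a, Q a →
    f (atomVal R a (sigTwo false)) (atomVal R a (sigTwo false)) = Comb.eval l m (V a) T.sigSame
  sigOther : ∀ a, Q a →
    f (atomVal R a (sigTwo false)) (atomVal R a (sigTwo true)) = Comb.eval l m (V a) T.sigOther

/-- A class of dihedral sequences closed under renaming. -/
structure Class (B : A →ₗ[R] A →ₗ[R] R) (Q : (ℤ → A) → Prop) : Prop where
  dihedral : ∀ a, Q a → IsDihedral B a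
  move : ∀ a, Q a → ∀ j d : ℤ, d = 1 ∨ d = -1 → Q fun i => a (j + d * i)

/-- A bilinear map whose values on atoms are named by atoms. -/
structure Names (Q : (ℤ → A) → Prop) (f : A →ₗ[R] A →ₗ[R] M) (V : (ℤ → A) → Atom → M) :
    Prop where
  symm : ∀ x y, f x y = f y x
  prod : ∀ a s t, V a (.prod s t) = f (atomVal R a s) (atomVal R a t)
  move : ∀ a, Q a → ∀ j d : ℤ, d = 1 ∨ d = -1 → ∀ s,
    V (fun i => a (j + d * i)) s = V a (s.move j d)

variable {Q : (ℤ → A) → Prop} {l m : R} {f : A →ₗ[R] A →ₗ[R] M} {V : (ℤ → A) → Atom → M}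

omit [IsScalarTower R A A] [SMulCommClass R A A] in
theorem valid_unknown (hV : ∀ a s t, V a (.prod s t) = f (atomVal R a s) (atomVal R a t)) :
    Valid Q l m f V unknown := by
  constructor <;> intros <;> simp only [unknown, Comb.eval_single, hV, atomVal]

/-- Entries are stated at a_0, but for all sequences of a class closed under renaming. A shift or
reflection thus brings any pair of atoms covered by the table into the position of an entry. -/
theorem Valid.rule {T : Table} (hQ : Class B Q) (hV : Names Q f V) (h : T.Valid Q l m f V)
    (ha : Q a) (s t : Atom) :
    f (atomVal R a s) (atomVal R a t) = Comb.eval l m (V a) (T.rule s t) := by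
  have hD := hQ.dihedral a ha
  have hm : ∀ (j d : ℤ) (hd : d = 1 ∨ d = -1) (x : Comb),
      Comb.eval l m (V a) (x.move j d) = Comb.eval l m (V fun i => a (j + d * i)) x :=
    fun j d hd x => Comb.eval_move l m (hV.move a ha j d hd) x
  have p1 : (1 : ℤ) = 1 ∨ (1 : ℤ) = -1 := Or.inl rfl
  have hax : ∀ i : ℤ, a i = a (i + 1 * 0) := fun i => by simp
  have h1 : ∀ i, f (a i) (atomVal R a sigOne) =
      Comb.eval l m (V a) (T.axSigOne.move i 1) := fun i => by
    rw [hm i 1 p1, ← h.axSigOne _ (hQ.move a ha i 1 p1), hD.atomVal_move i p1, ← hax]; rfl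
  have h2 : ∀ i b, f (a i) (atomVal R a (sigTwo b)) = Comb.eval l m (V a)
      (if b = (i % 2 == 1) then T.axSigSame.move i 1 else T.axSigOther.move i 1) := fun i b => by
    split_ifs with hb
    · rw [hm i 1 p1, ← h.axSigSame _ (hQ.move a ha i 1 p1), hD.atomVal_move i p1, ← hax]
      simp [Atom.move, hb]
    · rw [hm i 1 p1, ← h.axSigOther _ (hQ.move a ha i 1 p1), hD.atomVal_move i p1, ← hax]
      have : b = (true ^^ (i % 2 == 1)) := by
        cases b <;> cases hi : (i % 2 == 1) <;> simp_all
      simp only [Atom.move, this]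
  have h3 : ∀ b : Bool, f (atomVal R a sigOne) (atomVal R a (sigTwo b)) =
      Comb.eval l m (V a) (T.sigOneSigTwo.move (if b then 1 else 0) 1) := fun b => by
    rw [hm _ 1 p1, ← h.sigOneSigTwo _ (hQ.move a ha _ 1 p1), hD.atomVal_move _ p1,
      hD.atomVal_move _ p1]
    cases b <;> rfl
  cases s with
  | one => rw [show T.rule one t = Comb.single (Atom.prod one t) by cases t <;> rfl,
      Comb.eval_single, hV.prod]
  | prod p q => rw [show T.rule (.prod p q) t = Comb.single (Atom.prod (.prod p q) t) by
      cases t <;> rfl, Comb.eval_single, hV.prod]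
  | ax i =>
    cases t with
    | ax j =>
      simp only [Table.rule]
      split_ifs with hij
      · rw [hm i 1 p1, ← h.ax _ (hQ.move a ha i 1 p1), ← hax, one_mul,
          Int.toNat_of_nonneg (by omega), add_sub_cancel]; rfl
      -- For j < i the reversed sequence k ↦ a_{i-k} puts a_j at a nonnegative distance from its
      -- origin.
      · rw [hm i (-1) (Or.inr rfl), ← h.ax _ (hQ.move a ha i (-1) (Or.inr rfl)), mul_zero,
          add_zero, Int.toNat_of_nonneg (by omega), neg_one_mul, neg_sub, add_sub_cancel]; rfl
    | sigOne => exact h1 i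
    | sigTwo b => exact h2 i b
    | one => simp only [Table.rule, Comb.eval_single, hV.prod]
    | prod p q => simp only [Table.rule, Comb.eval_single, hV.prod]
  | sigOne =>
    cases t with
    | ax j => rw [hV.symm]; exact h1 j
    | sigOne => exact h.sigOneSigOne a ha
    | sigTwo b => exact h3 b
    | one => simp only [Table.rule, Comb.eval_single, hV.prod]
    | prod p q => simp only [Table.rule, Comb.eval_single, hV.prod]
  | sigTwo b =>
    cases t with
    | ax j => rw [hV.symm]; exact h2 j b
    | sigOne => rw [hV.symm]; exact h3 b
    | sigTwo c =>
      simp only [Table.rule]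
      split_ifs with hb hb'
      · rw [hm _ 1 p1, ← h.sigSame _ (hQ.move a ha _ 1 p1), hD.atomVal_move _ p1]
        subst hb hb'; rfl
      · rw [hm _ 1 p1, ← h.sigSame _ (hQ.move a ha _ 1 p1), hD.atomVal_move _ p1]
        subst hb; cases b <;> simp_all [Atom.move]
      · rw [hm _ 1 p1, ← h.sigOther _ (hQ.move a ha _ 1 p1), hD.atomVal_move _ p1,
          hD.atomVal_move _ p1]
        cases c <;> simp_all [Atom.move]
      · rw [hm _ 1 p1, ← h.sigOther _ (hQ.move a ha _ 1 p1), hD.atomVal_move _ p1,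
          hD.atomVal_move _ p1]
        cases b <;> cases c <;> simp_all [Atom.move]
    | one => simp only [Table.rule, Comb.eval_single, hV.prod]
    | prod p q => simp only [Table.rule, Comb.eval_single, hV.prod]

end Table

end Dihedral

/-! ### The multiplication table and the form as tables of linear combinations -/

/-- The expression for `a 3`. -/
def recurrenceComb : Comb := [
    (.ax 0, [(2, 0, 32768/7), (1, 0, -2304/7), (0, 1, 128/7), (0, 0, 33/7)]),
    (.ax (-1), [(1, 0, 256), (0, 0, -6)]),
    (.ax 1, [(2, 0, -32768/7), (1, 0, 2304/7), (0, 1, -128/7), (0, 0, -33/7)]),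
    (.ax (-2), [(0, 0, 1)]),
    (.ax 2, [(1, 0, -256), (0, 0, 6)]),
    (.sigTwo false, [(0, 0, -32)]),
    (.sigTwo true, [(0, 0, 32)])]

/-- The product of `a 0` and `a 3`. -/
def axThreeComb : Comb := [
    (.ax 0, [(2, 0, 88064/21), (1, 0, -5576/21), (0, 1, -160/21), (0, 0, 1363/336)]),
    (.ax (-1), [(1, 0, 40/3), (0, 0, -37/96)]),
    (.ax 1, [(2, 0, -1024/7), (1, 0, 328/21), (0, 1, -4/7), (0, 0, -29/84)]),
    (.ax (-2), [(0, 0, -1/24)]),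
    (.ax 2, [(1, 0, -8), (0, 0, 11/96)]),
    (.sigOne, [(2, 0, -32768/7), (1, 0, 19456/21), (0, 1, -128/7), (0, 0, -491/21)]),
    (.sigTwo false, [(1, 0, -256), (0, 0, 7/3)])]

/-- The product of `a 0` and `a 4`. -/
def axFourComb : Comb := [
    (.ax 0, [(3, 0, -22544384/21), (2, 0, 654336/7), (1, 1, 40960/21), (1, 0, -51008/21),
    (0, 1, -428/21), (0, 0, 12709/672)]),
    (.ax (-1), [(2, 0, -10240/3), (1, 0, 520/3), (0, 0, -25/12)]),
    (.ax 1, [(3, 0, 262144/7), (2, 0, -99328/21), (1, 1, 1024/7), (1, 0, 3496/21), (0, 1, -20/7),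
    (0, 0, -145/84)]),
    (.ax (-2), [(1, 0, 32/3), (0, 0, -17/96)]),
    (.ax 2, [(2, 0, 13312/7), (1, 0, -1408/21), (0, 1, -4/7), (0, 0, 103/168)]),
    (.sigOne, [(3, 0, 8388608/7), (2, 0, -5472256/21), (1, 1, 32768/7), (1, 0, 228352/21),
    (0, 1, -640/7), (0, 0, -2560/21)]),
    (.sigTwo false, [(2, 0, 425984/7), (1, 0, -37888/21), (0, 1, -128/7), (0, 0, 293/21)])]

/-- The product of `a 0` and `σ₁`. -/
def axSigOneComb : Comb := [
    (.ax 0, [(1, 0, 3/4), (0, 0, -25/1024)]),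
    (.ax (-1), [(0, 0, 7/2048)]),
    (.ax 1, [(0, 0, 7/2048)]),
    (.sigOne, [(0, 0, 7/32)])]

/-- The product of `a 0` and `σ₂ᵉ`. -/
def axSigSameComb : Comb := [
    (.ax 0, [(0, 1, 3/4), (0, 0, -25/1024)]),
    (.ax (-2), [(0, 0, 7/2048)]),
    (.ax 2, [(0, 0, 7/2048)]),
    (.sigTwo false, [(0, 0, 7/32)])]

/-- The product of `a 0` and `σ₂ᵒ`. -/
def axSigOtherComb : Comb := [
    (.ax 0, [(2, 0, -32/3), (1, 0, 5/3), (0, 1, -1/24), (0, 0, -127/3072)]),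
    (.ax (-1), [(1, 0, 1/6), (0, 0, -19/3072)]),
    (.ax 1, [(1, 0, 1/6), (0, 0, -19/3072)]),
    (.ax (-2), [(0, 0, 7/6144)]),
    (.ax 2, [(0, 0, 7/6144)]),
    (.sigOne, [(1, 0, 32/3), (0, 0, -19/48)]),
    (.sigTwo false, [(0, 0, 7/96)])]

/-- The square of `σ₁`. -/
def sigOneSigOneComb : Comb := [
    (.ax 0, [(2, 0, 7/6), (1, 0, -7/384), (0, 1, 7/1536), (0, 0, -7/98304)]),
    (.ax (-1), [(1, 0, 49/768), (0, 0, -245/196608)]),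
    (.ax 1, [(1, 0, 49/768), (0, 0, -245/196608)]),
    (.ax (-2), [(0, 0, 49/196608)]),
    (.ax 2, [(0, 0, 49/196608)]),
    (.sigOne, [(1, 0, -5/12), (0, 0, -13/1536)]),
    (.sigTwo false, [(0, 0, -7/1536)]),
    (.sigTwo true, [(0, 0, 7/2048)])]

/-- The product of `σ₁` and `σ₂ᵉ`. -/
def sigOneSigTwoComb : Comb := [
    (.ax 0, [(3, 0, 256/3), (2, 0, -9/2), (1, 1, 1/3), (1, 0, 17/384), (0, 1, -19/1536),
    (0, 0, 19/98304)]),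
    (.ax (-1), [(2, 0, 14/3), (1, 0, -203/768), (0, 0, 665/196608)]),
    (.ax 1, [(2, 0, 14/3), (1, 0, -203/768), (0, 0, 665/196608)]),
    (.ax (-2), [(1, 0, 7/384), (0, 0, -133/196608)]),
    (.ax 2, [(1, 0, 7/384), (0, 0, -133/196608)]),
    (.sigOne, [(2, 0, -304/3), (1, 0, 41/6), (0, 1, 17/16), (0, 0, -197/1536)]),
    (.sigTwo false, [(1, 0, -17/24), (0, 0, 11/768)]),
    (.sigTwo true, [(1, 0, -7/8), (0, 0, 49/2048)])]

/-- The square of `σ₂ᵉ`. -/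
def sigSameComb : Comb := [
    (.ax 0, [(4, 0, 2621440), (3, 0, -820096/3), (2, 1, -10880), (2, 0, 20303/2), (1, 1, 2329/6),
    (0, 2, 3/2), (1, 0, -61409/384), (0, 1, -5315/1536), (0, 0, 89069/98304)]),
    (.ax (-1), [(3, 0, 3584), (2, 0, -791/3), (1, 0, 2317/384), (0, 0, -8645/196608)]),
    (.ax 1, [(3, 0, 3584), (2, 0, -791/3), (1, 0, 2317/384), (0, 0, -8645/196608)]),
    (.ax (-2), [(2, 0, -49), (1, 0, 343/192), (0, 1, 21/256), (0, 0, -3563/196608)]),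
    (.ax 2, [(2, 0, -49), (1, 0, 343/192), (0, 1, 21/256), (0, 0, -3563/196608)]),
    (.sigOne, [(4, 0, -3145728), (3, 0, 737280), (2, 1, -12288), (2, 0, -120368/3), (1, 1, 448),
    (1, 0, 4819/6), (0, 1, -65/16), (0, 0, -65/12)]),
    (.sigTwo false, [(3, 0, -49152), (2, 0, -1584), (1, 1, -192), (1, 0, 2837/24), (0, 1, 47/16),
    (0, 0, -4079/3072)]),
    (.sigTwo true, [(2, 0, -672), (1, 0, 49/2), (0, 0, -455/2048)])]

/-- The product of `σ₂ᵉ` and `σ₂ᵒ`. -/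
def sigOtherComb : Comb := [
    (.ax 0, [(4, 0, 54427648/21), (3, 0, -808576/3), (2, 1, -233344/21), (2, 0, 139721/14),
    (1, 1, 2419/6), (0, 2, 22/21), (1, 0, -105347/672), (0, 1, -1877/512), (0, 0, 609391/688128)]),
    (.ax (-1), [(4, 0, 98304/7), (3, 0, 23936/21), (2, 1, 384/7), (2, 0, -403/3), (1, 1, -113/42),
    (1, 0, 4433/1344), (0, 1, 85/2688), (0, 0, -32635/1376256)]),
    (.ax 1, [(4, 0, 98304/7), (3, 0, 23936/21), (2, 1, 384/7), (2, 0, -403/3), (1, 1, -113/42),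
    (1, 0, 4433/1344), (0, 1, 85/2688), (0, 0, -32635/1376256)]),
    (.ax (-2), [(3, 0, 768), (2, 0, -346/3), (1, 1, 3), (1, 0, 927/256), (0, 1, -1/768),
    (0, 0, -6751/196608)]),
    (.ax 2, [(3, 0, 768), (2, 0, -346/3), (1, 1, 3), (1, 0, 927/256), (0, 1, -1/768),
    (0, 0, -6751/196608)]),
    (.sigOne, [(4, 0, -3145728), (3, 0, 15515648/21), (2, 1, -12288), (2, 0, -847888/21),
    (1, 1, 9536/21), (1, 0, 34201/42), (0, 1, -1441/336), (0, 0, -29899/5376)]),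
    (.sigTwo false, [(3, 0, -49152), (2, 0, -4240/3), (1, 1, -192), (1, 0, 889/8), (0, 1, 137/48),
    (0, 0, -3865/3072)]),
    (.sigTwo true, [(2, 0, -864), (1, 0, 137/4), (0, 0, -707/2048)])]

/-- The value of the form on `a 0` and `a 3`. -/
def axThreePoly : Poly :=
  [(3, 0, -32768/7), (2, 0, 36864/7), (1, 1, -1920/7), (1, 0, -2169/7), (0, 1, -33/7),
  (0, 0, 33/7)]

/-- The value of the form on `a 0` and `a 4`. -/
def axFourPoly : Poly :=
  [(4, 0, 8388608/7), (3, 0, -9601024/7), (2, 1, 65536), (2, 0, 110592), (1, 1, -640/7),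
  (0, 2, -128/7), (1, 0, -19840/7), (0, 1, -3), (0, 0, 156/7)]

/-- The value of the form on `a 0` and `σ₁`. -/
def axSigOnePoly : Poly :=
  [(1, 0, 31/32), (0, 0, -1/32)]

/-- The value of the form on `a 0` and `σ₂ᵉ`. -/
def axSigSamePoly : Poly :=
  [(0, 1, 31/32), (0, 0, -1/32)]

/-- The value of the form on `a 0` and `σ₂ᵒ`. -/
def axSigOtherPoly : Poly :=
  [(1, 0, 15/16), (0, 1, 1/32), (0, 0, -1/32)]

/-- The value of the form on `σ₁` and `σ₁`. -/
def sigOneSigOnePoly : Poly :=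
  [(2, 0, 3/4), (1, 0, 65/512), (0, 1, 7/2048), (0, 0, -3/2048)]

/-- The value of the form on `σ₁` and `σ₂ᵉ`. -/
def sigOneSigTwoPoly : Poly :=
  [(3, 0, -16), (2, 0, 18), (1, 1, -3/16), (1, 0, -463/512), (0, 1, -83/2048), (0, 0, 23/2048)]

/-- The value of the form on `σ₂ᵉ` and `σ₂ᵉ`. -/
def sigSamePoly : Poly :=
  [(4, 0, 4096), (3, 0, -4688), (2, 1, 224), (2, 0, 378), (1, 1, -5/16), (0, 2, 11/16),
  (1, 0, -155/16), (0, 1, 239/2048), (0, 0, 153/2048)]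

/-- The value of the form on `σ₂ᵉ` and `σ₂ᵒ`. -/
def sigOtherPoly : Poly :=
  [(4, 0, 4096/7), (3, 0, -656), (2, 1, 128/7), (2, 0, 366/7), (1, 1, 277/112), (0, 2, -1/16),
  (1, 0, -335/256), (0, 1, 761/14336), (0, 0, 135/14336)]

/-- The product of `a 0` and `a n`, for `n ≤ 4`. -/
def axComb : ℕ → Comb
  | 0 => [(.ax 0, [(0, 0, 1)])]
  | 1 => [(.sigOne, [(0, 0, 1)]), (.ax 0, [(0, 0, 1/32)]), (.ax 1, [(0, 0, 1/32)])]
  | 2 => [(.sigTwo false, [(0, 0, 1)]), (.ax 0, [(0, 0, 1/32)]), (.ax 2, [(0, 0, 1/32)])]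
  | 3 => axThreeComb
  | 4 => axFourComb
  | n => Comb.single (.prod (.ax 0) (.ax n))

/-- The product of `a 0` and `a n`, used only for `n ≤ k`. -/
def axCombUpTo (k n : ℕ) : Comb :=
  if n ≤ k then axComb n else Comb.single (.prod (.ax 0) (.ax n))

/-- The value of the form on `a 0` and `a n`, for `n ≤ 4`. -/
def formAxComb : ℕ → Comb
  | 0 => [(.one, [(0, 0, 1)])]
  | 1 => [(.one, [(1, 0, 1)])]
  | 2 => [(.one, [(0, 1, 1)])]
  | 3 => [(.one, axThreePoly)]
  | 4 => [(.one, axFourPoly)]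
  | n => Comb.single (.prod (.ax 0) (.ax n))

/-- The value of the form on `a 0` and `a n`, used only for `n ≤ k`. -/
def formAxCombUpTo (k n : ℕ) : Comb :=
  if n ≤ k then formAxComb n else Comb.single (.prod (.ax 0) (.ax n))

namespace Table

/-- The defining products of two axes. -/
def axesTable : Table := { unknown with ax := axCombUpTo 2 }

/-- The table with the products of axes and `σ₁`. -/
def sigOneTable : Table := { axesTable with axSigOne := axSigOneComb }

/-- The table with the products of axes and `σ₂`. -/
def sigTwoTable : Table :=
  { sigOneTable with axSigSame := axSigSameComb, axSigOther := axSigOtherComb }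

/-- The table with the square of `σ₁`. -/
def squareTable : Table := { sigTwoTable with sigOneSigOne := sigOneSigOneComb }

/-- The table with the products of axes at distance three. -/
def threeTable : Table := { squareTable with ax := axCombUpTo 3 }

/-- The table with the products of axes at distance four. -/
def fourTable : Table := { threeTable with ax := axCombUpTo 4 }

/-- The table with the products of `σ₁` and `σ₂`. -/
def sigOneSigTwoTable : Table := { fourTable with sigOneSigTwo := sigOneSigTwoComb }

/-- The table with the squares of `σ₂`. -/
def sigSameTable : Table := { sigOneSigTwoTable with sigSame := sigSameComb }

/-- The table of products. -/
def mulTable : Table := { sigSameTable with sigOther := sigOtherComb }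

/-- The values of the form which follow from those on axes at distance at most two. -/
def formSigTable : Table :=
  { unknown with
    ax := formAxCombUpTo 2
    axSigOne := [(.one, axSigOnePoly)]
    axSigSame := [(.one, axSigSamePoly)]
    axSigOther := [(.one, axSigOtherPoly)] }

/-- The values of the form, with axes up to distance three. -/
def formThreeTable : Table := { formSigTable with ax := formAxCombUpTo 3 }

/-- The values of the form, with axes up to distance four. -/
def formFourTable : Table := { formThreeTable with ax := formAxCombUpTo 4 }

/-- The table of values of the form. -/
def formTable : Table :=
  { formFourTable with
    sigOneSigOne := [(.one, sigOneSigOnePoly)]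
    sigOneSigTwo := [(.one, sigOneSigTwoPoly)]
    sigSame := [(.one, sigSamePoly)]
    sigOther := [(.one, sigOtherPoly)] }

end Table

namespace Comb

/-- The product of two linear combinations, computed with a table. -/
def mul (T : Table) (x y : Comb) : Comb := lift₂ T.rule x y

/-- The sum of the axes at distance `k` from `a 0`. -/
def pair (k : ℤ) : Comb := [(.ax k, [(0, 0, 1)]), (.ax (-k), [(0, 0, 1)])]

/-- `pair k` minus its component in `A_1`, if `p` is the value of the form on `a 0`, `a k`. -/
def perp (k : ℤ) (p : Poly) : Comb := sub (pair k) (smul p [(.ax 0, [(0, 0, 2)])])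

/-- The component of `pair k` in `A_{1/4}`. -/
def quarter (T : Table) (k : ℤ) (p : Poly) : Comb :=
  ratSmul 4 (sub (mul T (single (.ax 0)) (pair k)) (smul p [(.ax 0, [(0, 0, 2)])]))

/-- The component of `pair k` in `A_0`. -/
def zero (T : Table) (k : ℤ) (p : Poly) : Comb := sub (perp k p) (quarter T k p)

/-- Replace all axes with index of absolute value greater than `2`. -/
def reduce (x : Comb) : Comb :=
  let r : Atom → Comb
    | .ax i =>
      if 3 ≤ i then recurrenceComb.move (i - 3) 1
      else if i ≤ -3 then recurrenceComb.move (i + 3) (-1)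
      else single (.ax i)
    | s => single s
  lift r (lift r (lift r x))

/-- `a 0` acts as `1 / 4` on the component of `pair k` in `A_{1/4}`. -/
def quarterRelation (T : Table) (k : ℤ) (p : Poly) : Comb :=
  sub (mul T (single (.ax 0)) (quarter T k p)) (ratSmul (1 / 4) (quarter T k p))

/-- The fusion rules for `A_0`, `A_0` and `A_0`, `A_{1/4}`, applied to the components of `pair k`
and `pair n`; `red` is a simplification. -/
def fusionRelation (T : Table) (red : Comb → Comb) (k : ℤ) (p : Poly) (n : ℤ) (q : Poly) : Comb :=
  sub (mul T (single (.ax 0)) (red (mul T (zero T k p) (perp n q))))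
    (ratSmul (1 / 4) (mul T (zero T k p) (quarter T n q)))

/-- The fusion rules for `A_0`, `A_0` and `A_{1/4}`, `A_{1/4}`, applied to the components of
`pair k`, where `q` is the value of the form on the component in `A_{1/4}`. -/
def squareRelation (T : Table) (k : ℤ) (p q : Poly) : Comb :=
  add (mul T (single (.ax 0)) (mul T (perp k p) (sub (perp k p) (ratSmul 2 (quarter T k p)))))
    (smul q [(.ax 0, [(0, 0, 1/4)])])

/-- Up to the simplification `red`, the difference of `x` and `y` is `c` times `e`. -/
def follows (red : Comb → Comb) (x y e : Comb) (c : ℚ) : Bool :=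
  isZero (red (sub (sub x y) (ratSmul c e)))

end Comb

/-! ### Relations forced by the fusion rules -/

section Products

variable {R A : Type*} [CommRing R] [Algebra ℚ R] [NonUnitalNonAssocCommRing A] [Module R A]
  [IsScalarTower R A A] [SMulCommClass R A A]

/-- Certificate for solving a relation: e is known to vanish, and c is the inverse of the
coefficient in e of the unknown x. -/
theorem Comb.eval_eq_of_follows {M : Type*} [AddCommGroup M] [Module R M] {l m : R}
    {v : Atom → M} {red : Comb → Comb}
    (hred : ∀ x, Comb.eval l m v (red x) = Comb.eval l m v x) {x y e : Comb} (c : ℚ)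
    (he : Comb.eval l m v e = 0) (h : Comb.follows red x y e c = true) :
    Comb.eval l m v x = Comb.eval l m v y := by
  have h := Comb.eval_of_isZero l m v h
  rw [hred, Comb.eval_sub, Comb.eval_sub, Comb.eval_ratSmul, he, smul_zero, sub_zero] at h
  exact sub_eq_zero.1 h

/-- Dihedral sequences with a given value of the form on adjacent axes. -/
structure IsDihedralOne (B : A →ₗ[R] A →ₗ[R] R) (l : R) (a : ℤ → A) : Prop
    extends IsDihedral B a where
  form_one : ∀ i, B (a i) (a (i + 1)) = l

/-- Dihedral sequences with given values of the form on axes at distance one and two. -/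
structure IsDihedralTwo (B : A →ₗ[R] A →ₗ[R] R) (l m : R) (a : ℤ → A) : Prop
    extends IsDihedralOne B l a where
  form_two : ∀ i, B (a i) (a (i + 2)) = m

variable {B : A →ₗ[R] A →ₗ[R] R} {a : ℤ → A} {l m : R}

/-- Reflection in a_{i+1} interchanges a_i and a_{i+2} and preserves the form. -/
theorem IsDihedral.isDihedralOne (h : IsDihedral B a) : IsDihedralOne B (B (a 0) (a 1)) a := by
  refine ⟨h, fun i => ?_⟩
  have hs : ∀ i, B (a (i + 1)) (a (i + 1 + 1)) = B (a i) (a (i + 1)) := fun i => by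
    have := h.form_refl (i + 1) (i + 1) i
    rw [show 2 * (i + 1) - (i + 1) = i + 1 by ring, show 2 * (i + 1) - i = i + 1 + 1 by ring,
      h.symm] at this
    rw [h.symm, this, h.symm]
  induction i using Int.induction_on with
  | zero => rw [zero_add]
  | succ i ih => rw [hs, ih]
  | pred i ih => rw [← ih, ← hs]; congr 2 <;> ring_nf

theorem class_one : Table.Class B (IsDihedralOne B l) where
  dihedral _ h := h.toIsDihedral
  move a h j d hd := by
    refine ⟨h.toIsDihedral.move j d, fun i => ?_⟩
    rcases hd with rfl | rfl
    · rw [← h.form_one (j + 1 * i)]; congr 2; ring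
    · rw [h.symm, ← h.form_one (j + -1 * (i + 1))]; congr 2; ring

theorem class_two : Table.Class B (IsDihedralTwo B l m) where
  dihedral _ h := h.toIsDihedral
  move a h j d hd := by
    refine ⟨class_one.move a h.toIsDihedralOne j d hd, fun i => ?_⟩
    rcases hd with rfl | rfl
    · rw [← h.form_two (j + 1 * i)]; congr 2; ring
    · rw [h.symm, ← h.form_two (j + -1 * (i + 2))]; congr 2; ring

variable {Q : (ℤ → A) → Prop} (hQ : Table.Class B Q)
include hQ

theorem Table.Class.names_mul :
    Table.Names Q (LinearMap.mul R A) fun a => atomVal R a where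
  symm := mul_comm
  prod _ _ _ := rfl
  move a ha j _ hd := (hQ.dihedral a ha).atomVal_move j hd

theorem Table.Class.names_form (ha : Q a) : Table.Names Q B fun a => atomForm B a where
  symm := (hQ.dihedral a ha).symm
  prod _ _ _ := rfl
  move a ha j _ hd := (hQ.dihedral a ha).atomForm_move j hd

variable {T : Table} (hT : T.Valid Q l m (LinearMap.mul R A) fun a => atomVal R a) (ha : Q a)
include hT ha

theorem Comb.eval_mul (x y : Comb) : Comb.eval l m (atomVal R a) (Comb.mul T x y) =
    Comb.eval l m (atomVal R a) x * Comb.eval l m (atomVal R a) y :=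
  Comb.eval_lift₂ l m (atomVal R a) (atomVal R a) (LinearMap.mul R A) T.rule
    (hT.rule hQ hQ.names_mul ha) x y

section Components

variable {k : ℤ} {p : Poly} (hp : B (a 0) (a k) = p.eval l m)

omit hT in
include hp in
theorem form_pair : B (a 0) (a k + a (-k)) = 2 * p.eval l m := by
  have := (hQ.dihedral a ha).form_refl 0 0 k
  simp only [mul_zero, zero_sub, neg_zero] at this
  rw [map_add, this, hp]; ring

omit hQ hT ha [IsScalarTower R A A] [SMulCommClass R A A] in
theorem eval_pair : Comb.eval l m (atomVal R a) (Comb.pair k) = a k + a (-k) := by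
  simp [Comb.pair, Comb.eval, Poly.eval, atomVal]

omit hQ hT ha [IsScalarTower R A A] [SMulCommClass R A A] in
theorem eval_twice : Comb.eval l m (atomVal R a) [(.ax 0, [(0, 0, 2)])] = (2 : R) • a 0 := by
  simp [Comb.eval, Poly.eval, atomVal, show algebraMap ℚ R 2 = 2 from map_ofNat _ 2]

omit hT in
theorem pair_mem_plusPart : a k + a (-k) ∈ plusPart R (a 0) := by
  have := (hQ.dihedral a ha).even 0 k
  rwa [zero_add, zero_sub] at this

omit hT in
include hp in
theorem eval_perp : Comb.eval l m (atomVal R a) (Comb.perp k p) =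
    a k + a (-k) - B (a 0) (a k + a (-k)) • a 0 := by
  rw [Comb.perp, Comb.eval_sub, Comb.eval_smul, eval_pair, eval_twice, form_pair hQ ha hp,
    smul_smul, mul_comm]

include hp in
theorem eval_quarter : Comb.eval l m (atomVal R a) (Comb.quarter T k p) =
    rat R 4 • (a 0 * (a k + a (-k)) - B (a 0) (a k + a (-k)) • a 0) := by
  rw [Comb.quarter, Comb.eval_ratSmul, Comb.eval_sub, Comb.eval_mul hQ hT ha, Comb.eval_smul,
    eval_pair, eval_twice, Comb.eval_single, form_pair hQ ha hp, smul_smul, mul_comm (2 : R)]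
  rfl

include hp in
theorem mul_eval_quarter : a 0 * Comb.eval l m (atomVal R a) (Comb.quarter T k p) =
    rat R (1 / 4) • Comb.eval l m (atomVal R a) (Comb.quarter T k p) := by
  have h := hQ.dihedral a ha
  rw [eval_quarter hQ hT ha hp]
  exact (h.axis 0).plus_quarter h.assoc (h.norm 0) (pair_mem_plusPart hQ ha)

include hp in
theorem mul_eval_zero : a 0 * Comb.eval l m (atomVal R a) (Comb.zero T k p) = 0 := by
  have h := hQ.dihedral a ha
  rw [Comb.zero, Comb.eval_sub, eval_perp hQ ha hp, eval_quarter hQ hT ha hp]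
  exact (h.axis 0).plus_zero h.assoc (h.norm 0) (pair_mem_plusPart hQ ha)

include hp in
-- As `quarter` contains 8 σ(a_0, a_k), this eigenvalue equation yields a_0 σ(a_0, a_k) for k = 1,
-- 2.
theorem eval_quarterRelation :
    Comb.eval l m (atomVal R a) (Comb.quarterRelation T k p) = 0 := by
  rw [Comb.quarterRelation, Comb.eval_sub, Comb.eval_mul hQ hT ha, Comb.eval_single,
    Comb.eval_ratSmul]
  exact sub_eq_zero.2 (mul_eval_quarter hQ hT ha hp)

omit hQ hT ha [IsScalarTower R A A] [SMulCommClass R A A] in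
theorem eval_perp_eq : Comb.eval l m (atomVal R a) (Comb.perp k p) =
    Comb.eval l m (atomVal R a) (Comb.zero T k p) +
      Comb.eval l m (atomVal R a) (Comb.quarter T k p) := by
  rw [Comb.zero, Comb.eval_sub, sub_add_cancel]

include hp in
-- Split `perp n` into its components x' in A_0 and y' in A_{1/4}, and let x be the A_0-component
-- for k. Then a_0 kills x x' and acts as 1/4 on x y'. On the left, `perp n` is a combination of
-- axes only, so products of two σ's enter only through x y' on the right.
theorem eval_fusionRelation {n : ℤ} {q : Poly} (hq : B (a 0) (a n) = q.eval l m)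
    {red : Comb → Comb}
    (hred : ∀ x, Comb.eval l m (atomVal R a) (red x) = Comb.eval l m (atomVal R a) x) :
    Comb.eval l m (atomVal R a) (Comb.fusionRelation T red k p n q) = 0 := by
  have h := hQ.dihedral a ha
  have h0 := mul_eval_zero hQ hT ha hp
  rw [Comb.fusionRelation, Comb.eval_sub, Comb.eval_mul hQ hT ha, hred, Comb.eval_mul hQ hT ha,
    Comb.eval_single, Comb.eval_ratSmul, Comb.eval_mul hQ hT ha, eval_perp_eq (T := T), mul_add,
    ← (h.axis 0).mul_zero_quarter h0 (mul_eval_quarter hQ hT ha hq)]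
  have h1 := (h.axis 0).mul_zero_zero h.assoc (h.norm 0) h0 (mul_eval_zero hQ hT ha hq)
  rw [atomVal, mul_add, h1, zero_add, sub_self]

include hp in
-- With x, y the components in A_0 and A_{1/4}, the product (x + y)(x - y) is x² - y², and a_0 acts
-- on both squares in a known way. Since x + y consists of axes, no product of two σ's occurs.
theorem eval_squareRelation {q : Poly}
    (hq : B (Comb.eval l m (atomVal R a) (Comb.quarter T k p))
      (Comb.eval l m (atomVal R a) (Comb.quarter T k p)) = q.eval l m) :
    Comb.eval l m (atomVal R a) (Comb.squareRelation T k p q) = 0 := by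
  have h := hQ.dihedral a ha
  have h0 := mul_eval_zero hQ hT ha hp
  have h1 := mul_eval_quarter hQ hT ha hp
  have h00 := (h.axis 0).mul_zero_zero h.assoc (h.norm 0) h0 h0
  have h11 := (h.axis 0).mul_quarter_quarter h.assoc (h.norm 0) h1 h1
  rw [Comb.squareRelation, Comb.eval_add, Comb.eval_mul hQ hT ha, Comb.eval_mul hQ hT ha,
    Comb.eval_sub, Comb.eval_single, Comb.eval_ratSmul, Comb.eval_smul, eval_perp_eq (T := T),
    atomVal]
  rw [hq] at h11
  set x := Comb.eval l m (atomVal R a) (Comb.zero T k p)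
  set y := Comb.eval l m (atomVal R a) (Comb.quarter T k p)
  have e : (x + y) * (x + y - rat R 2 • y) = x * x - y * y := by
    rw [show rat R 2 = 2 from map_ofNat _ 2, two_smul, add_mul, mul_sub, mul_sub, mul_add, mul_add,
      mul_add, mul_add, mul_comm y x]
    abel
  rw [e, mul_sub, h00, h11]
  simp [Comb.eval, Poly.eval, atomVal, smul_smul, mul_comm]

end Components

end Products

/-! ### Derivation of the multiplication table -/

section Derivation

variable {R A : Type*} [CommRing R] [Algebra ℚ R] [NonUnitalNonAssocCommRing A] [Module R A]
  [IsScalarTower R A A] [SMulCommClass R A A]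
  {B : A →ₗ[R] A →ₗ[R] R} {a : ℤ → A} {l m : R}

/-- Validity of a table of products. -/
abbrev Table.IsMul (T : Table) (l m : R) (Q : (ℤ → A) → Prop) : Prop :=
  T.Valid Q l m (LinearMap.mul R A) fun a => atomVal R a

/-- Validity of a table of values of the form. -/
abbrev Table.IsForm (T : Table) (B : A →ₗ[R] A →ₗ[R] R) (l m : R) (Q : (ℤ → A) → Prop) : Prop :=
  T.Valid Q l m B fun a => atomForm B a

omit [IsScalarTower R A A] [SMulCommClass R A A] in
theorem mul_eq_sig (x y : A) : x * y = sig R x y + rat R (1 / 32) • (x + y) := by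
  rw [sig, sub_add_cancel]

theorem isMul_axesTable {Q : (ℤ → A) → Prop} (hQ : Table.Class B Q) :
    Table.axesTable.IsMul l m Q :=
  { Table.valid_unknown fun _ _ _ => rfl with
    ax := fun a ha n => by
      match n with
      | 0 =>
        have := ((hQ.dihedral a ha).axis 0).idem
        simpa [Table.axesTable, axCombUpTo, axComb, Comb.eval, Poly.eval, atomVal] using this
      | 1 =>
        have := mul_eq_sig (R := R) (a 0) (a 1)
        simpa [Table.axesTable, axCombUpTo, axComb, Comb.eval, Poly.eval, atomVal] using this
      | 2 =>
        have := mul_eq_sig (R := R) (a 0) (a 2)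
        simpa [Table.axesTable, axCombUpTo, axComb, Comb.eval, Poly.eval, atomVal] using this
      | n + 3 => exact (Table.valid_unknown (Q := Q) (l := l) (m := m) (f := LinearMap.mul R A)
          (V := fun a => atomVal R a) fun _ _ _ => rfl).ax a ha (n + 3) }

theorem IsDihedralOne.form_zero_one (h : IsDihedralOne B l a) :
    B (a 0) (a 1) = Poly.eval l m [(1, 0, 1)] := by
  have := h.form_one 0
  rw [zero_add] at this
  simp [this, Poly.eval]

theorem isMul_sigOneTable : Table.sigOneTable.IsMul l m (IsDihedralOne B l) :=
  { isMul_axesTable class_one with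
    axSigOne := fun a ha => by
      have e := eval_quarterRelation class_one (m := m) (isMul_axesTable class_one) ha
        (k := 1) (ha.form_zero_one)
      -- The A_{1/4}-component contains 8 σ₁, hence the factor 1/8.
      have := Comb.eval_eq_of_follows (red := id) (x := Comb.single (.prod (.ax 0) .sigOne))
        (y := axSigOneComb) (fun _ => rfl) (1 / 8) e (by decide +kernel)
      rwa [Comb.eval_single] at this }

/-- The values of the form which follow from the value on adjacent axes. -/
def Table.formOneTable : Table :=
  { Table.unknown with
    ax := fun n => match n with
      | 0 => [(.one, [(0, 0, 1)])]
      | 1 => [(.one, [(1, 0, 1)])]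
      | n => Comb.single (.prod (.ax 0) (.ax n))
    axSigOne := [(.one, [(1, 0, 31/32), (0, 0, -1/32)])]
    axSigSame := [(.prod (.ax 0) (.ax 2), [(0, 0, 31/32)]), (.one, [(0, 0, -1/32)])] }

theorem IsDihedral.form_sig (h : IsDihedral B a) (n : ℤ) :
    B (a 0) (sig R (a 0) (a n)) = rat R (31 / 32) * B (a 0) (a n) - rat R (1 / 32) := by
  rw [sig, map_sub, map_smul, map_add, ← h.assoc, (h.axis 0).idem, h.norm,
    show (31 / 32 : ℚ) = 1 - 1 / 32 by norm_num, rat_sub, rat_one, smul_eq_mul]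
  ring

theorem isForm_formOneTable : Table.formOneTable.IsForm B l m (IsDihedralOne B l) :=
  { Table.valid_unknown fun _ _ _ => rfl with
    ax := fun a ha n => by
      match n with
      | 0 => simpa [Table.formOneTable, Comb.eval, Poly.eval, atomForm] using ha.norm 0
      | 1 => simpa [Table.formOneTable, Comb.eval, Poly.eval, atomForm] using ha.form_one 0
      | n + 2 => exact (Table.valid_unknown (Q := IsDihedralOne B l) (l := l) (m := m) (f := B)
          (V := fun a => atomForm B a) fun _ _ _ => rfl).ax a ha (n + 2)
    axSigOne := fun a ha => by
      have h1 := ha.form_sig 1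
      have h2 := ha.form_one 0
      rw [zero_add] at h2
      rw [h2] at h1
      simp [Table.formOneTable, Comb.eval, Poly.eval, atomForm, atomVal, h1, neg_div, sub_eq_add_neg]
    axSigSame := fun a ha => by
      have h1 := ha.form_sig 2
      simp [Table.formOneTable, Comb.eval, Poly.eval, atomForm, atomVal, h1, neg_div, sub_eq_add_neg] }

/-- The value of the form on two linear combinations, computed with a table. -/
def Comb.form (T : Table) (x y : Comb) : Comb := Comb.lift₂ T.rule x y

theorem Comb.eval_form {Q : (ℤ → A) → Prop} (hQ : Table.Class B Q) {T : Table}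
    (hT : T.IsForm B l m Q) (ha : Q a) (x y : Comb) :
    Comb.eval l m (atomForm B a) (Comb.form T x y) =
      B (Comb.eval l m (atomVal R a) x) (Comb.eval l m (atomVal R a) y) :=
  Comb.eval_lift₂ l m (atomVal R a) (atomForm B a) B T.rule
    (hT.rule hQ (hQ.names_form ha) ha) x y

/-- Give the value `μ` to the form on axes at distance two. -/
def Comb.substTwo (x : Comb) : Comb :=
  Comb.lift (fun s =>
    if s = .prod (.ax 1) (.ax (-1)) ∨ s = .prod (.ax (-1)) (.ax 1) then [(.one, [(0, 1, 1)])]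
    else if s = .prod (.ax 0) (.ax (-2)) then Comb.single (.prod (.ax 0) (.ax 2))
    else Comb.single s) x

/-- Here the second variable stands for ⟨a_1, a_{-1}⟩, while ⟨a_0, a_2⟩ stays an independent atom:
reflections preserve parity, so their equality needs a separate argument. -/
theorem IsDihedral.eval_substTwo (h : IsDihedral B a) (x : Comb) :
    Comb.eval l (B (a 1) (a (-1))) (atomForm B a) (Comb.substTwo x) =
      Comb.eval l (B (a 1) (a (-1))) (atomForm B a) x := by
  refine Comb.eval_lift _ _ (atomForm B a) (atomForm B a) LinearMap.id _ (fun s => ?_) x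
  have h2 := h.form_refl 0 0 2
  have h1 := h.symm (a (-1)) (a 1)
  simp only [mul_zero, zero_sub, neg_zero] at h2
  split_ifs with hs hs'
  · rcases hs with rfl | rfl
    · simp [Comb.eval, Poly.eval, atomForm, atomVal]
    · simp [Comb.eval, Poly.eval, atomForm, atomVal, h1]
  · subst hs'
    rw [Comb.eval_single]
    exact h2
  · rw [Comb.eval_single]; rfl

/-- The value of the form on a linear combination and `σ(u, v)`. -/
def Comb.formSig (F T : Table) (x : Comb) (u v : Atom) : Comb :=
  sub (form F (mul T x (single u)) (single v))
    (ratSmul (1 / 32) (form F x (add (single u) (single v))))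

theorem Comb.eval_formSig {Q : (ℤ → A) → Prop} (hQ : Table.Class B Q) {F T : Table}
    (hF : F.IsForm B l m Q) (hT : T.IsMul l m Q) (ha : Q a) (x : Comb) (u v : Atom) :
    Comb.eval l m (atomForm B a) (Comb.formSig F T x u v) =
      B (Comb.eval l m (atomVal R a) x) (sig R (atomVal R a u) (atomVal R a v)) := by
  rw [formSig, eval_sub, eval_form hQ hF ha, eval_mul hQ hT ha, eval_ratSmul,
    eval_form hQ hF ha, eval_add, eval_single, eval_single, (hQ.dihedral a ha).assoc, sig,
    map_sub, map_smul]

/-! ### Consequences of the single value ⟨a_0, a_1⟩, and the equality of the two values at distance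
two -/

section One

variable (ha : IsDihedralOne B l a)
include ha

/-- This supplies the value ⟨y, y⟩ needed in the square relation. -/
theorem IsDihedralOne.form_quarter :
    B (Comb.eval l (B (a 1) (a (-1))) (atomVal R a) (Comb.quarter .sigOneTable 1 [(1, 0, 1)]))
      (Comb.eval l (B (a 1) (a (-1))) (atomVal R a) (Comb.quarter .sigOneTable 1 [(1, 0, 1)])) =
    Poly.eval l (B (a 1) (a (-1))) [(2, 0, -16), (1, 0, 16), (0, 1, 1/4), (0, 0, -1/4)] := by
  set m := B (a 1) (a (-1)) with hm
  have hp := ha.form_zero_one (m := m)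
  have h0 := mul_eval_zero class_one isMul_sigOneTable ha hp
  have h1 := mul_eval_quarter class_one isMul_sigOneTable ha hp
  -- The two components are orthogonal, so ⟨y, y⟩ = ⟨y, x + y⟩, in which the second argument
  -- involves only axes and no value ⟨σ₁, σ₁⟩ is required.
  have ho := ha.assoc.orthogonal (θ := 1 / 4) (η := 0) (by norm_num) (mem_eig.2 h1)
    (mem_eig.2 (h0.trans (by rw [rat_zero, zero_smul])))
  have e := congrArg (B (Comb.eval l m (atomVal R a) (Comb.quarter .sigOneTable 1 [(1, 0, 1)])))
    (eval_perp_eq (T := .sigOneTable) (k := 1) (p := [(1, 0, 1)]) (a := a) (l := l) (m := m))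
  rw [map_add, ho, zero_add] at e
  rw [← e, ← Comb.eval_form class_one isForm_formOneTable ha, ← ha.eval_substTwo]
  have := Comb.eval_eq l m (atomForm B a) (x := Comb.substTwo (Comb.form Table.formOneTable
    (Comb.quarter .sigOneTable 1 [(1, 0, 1)]) (Comb.perp 1 [(1, 0, 1)])))
    (y := [(.one, [(2, 0, -16), (1, 0, 16), (0, 1, 1/4), (0, 0, -1/4)])]) (by decide +kernel)
  rw [this]
  simp [Comb.eval, atomForm]

theorem IsDihedralOne.mul_sigTwo : a 0 * atomVal R a (.sigTwo true) =
    Comb.eval l (B (a 1) (a (-1))) (atomVal R a) axSigOtherComb := by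
  have e := eval_squareRelation class_one isMul_sigOneTable ha ha.form_zero_one ha.form_quarter
  -- The square of `perp` contributes 2 σ₂ᵒ and the term with -2 `quarter` contributes -1/2 σ₂ᵒ,
  -- through a_1 a_{-1}; the total coefficient 3/2 is inverted.
  have := Comb.eval_eq_of_follows (red := id) (x := Comb.single (.prod (.ax 0) (.sigTwo true)))
    (y := axSigOtherComb) (fun _ => rfl) (2 / 3) e (by decide +kernel)
  rwa [Comb.eval_single] at this

/-- Reading σ₂ᵒ as σ(a_1, a_{-1}) and moving a_1 across the form leaves ⟨a_0 a_1, a_{-1}⟩, which is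
known up to ⟨a_1, a_{-1}⟩. -/
theorem IsDihedralOne.form_sigTwo : B (a 0) (atomVal R a (.sigTwo true)) =
    Poly.eval l (B (a 1) (a (-1))) [(1, 0, 15/16), (0, 1, 1/32), (0, 0, -1/32)] := by
  have h1 : atomVal R a (.sigTwo true) = sig R (a 1) (a (-1)) := (ha.sig_two' 1).symm
  have h2 := Comb.eval_formSig class_one isForm_formOneTable
    (isMul_sigOneTable (m := B (a 1) (a (-1)))) ha (Comb.single (.ax 0)) (.ax 1) (.ax (-1))
  rw [Comb.eval_single] at h2
  rw [h1]
  refine h2.symm.trans ?_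
  rw [← ha.eval_substTwo]
  refine (Comb.eval_eq _ _ _ (y := [(.one, [(1, 0, 15/16), (0, 1, 1/32), (0, 0, -1/32)])])
    (by decide +kernel)).trans ?_
  simp [Comb.eval, atomForm]

/-- Evaluate ⟨a_0, a_0 σ₂ᵒ⟩ = ⟨a_0, σ₂ᵒ⟩ in two ways. The formula for a_0 σ₂ᵒ involves a_{±2} and
σ₂ᵉ, hence ⟨a_0, a_2⟩, whereas the direct value involves only ⟨a_1, a_{-1}⟩. -/
theorem IsDihedralOne.form_two_eq : B (a 0) (a 2) = B (a 1) (a (-1)) := by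
  have e : Comb.eval l (B (a 1) (a (-1))) (atomForm B a)
      (Comb.sub (Comb.form .formOneTable (Comb.single (.ax 0)) axSigOtherComb)
        [(.one, [(1, 0, 15/16), (0, 1, 1/32), (0, 0, -1/32)])]) = 0 := by
    rw [Comb.eval_sub, Comb.eval_form class_one isForm_formOneTable ha, ← ha.mul_sigTwo,
      Comb.eval_single, atomVal, ← ha.assoc, (ha.axis 0).idem, ha.form_sigTwo]
    simp [Comb.eval, atomForm]
  -- The coefficient of ⟨a_0, a_2⟩ is 2 · 7/6144 from a_{±2} plus (7/96)(31/32) from σ₂ᵉ, which is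
  -- 7/96.
  have := Comb.eval_eq_of_follows ha.eval_substTwo
    (x := Comb.single (.prod (.ax 0) (.ax 2))) (y := [(.one, [(0, 1, 1)])]) (96 / 7) e
    (by decide +kernel)
  rw [Comb.eval_single] at this
  simpa [Comb.eval, Poly.eval, atomForm, atomVal] using this

theorem IsDihedralOne.isDihedralTwo : IsDihedralTwo B l (B (a 0) (a 2)) a := by
  refine ⟨ha, fun i => ?_⟩
  have hs : ∀ i, B (a (i + 1)) (a (i + 1 + 2)) = B (a i) (a (i + 2)) := fun i => by
    have := (class_one.move a ha (i + 1) 1 (Or.inl rfl)).form_two_eq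
    rw [ha.symm (a (i + 1 + 1 * 1))] at this
    rw [show i + 1 = i + 1 + 1 * 0 by ring, show i + 1 + 1 * 0 + 2 = i + 1 + 1 * 2 by ring, this]
    congr 2 <;> ring_nf
  induction i using Int.induction_on with
  | zero => rw [zero_add]
  | succ i ih => rw [hs, ih]
  | pred i ih => rw [← ih, ← hs]; congr 2 <;> ring_nf

end One

/-! ### Products with σ₁ and σ₂, the square of σ₁, and the recurrence -/

section Two

theorem IsDihedralTwo.form_zero_two (h : IsDihedralTwo B l m a) :
    B (a 0) (a 2) = Poly.eval l m [(0, 1, 1)] := by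
  have := h.form_two 0
  rw [zero_add] at this
  simp [this, Poly.eval]

theorem isMul_sigOneTable_two : Table.sigOneTable.IsMul l m (IsDihedralTwo B l m) :=
  { isMul_axesTable class_two with
    axSigOne := fun a ha => isMul_sigOneTable.axSigOne a ha.toIsDihedralOne }

theorem isMul_sigTwoTable : Table.sigTwoTable.IsMul l m (IsDihedralTwo B l m) :=
  { isMul_sigOneTable_two with
    axSigSame := fun a ha => by
      have e := eval_quarterRelation class_two isMul_sigOneTable_two ha (k := 2) ha.form_zero_two
      have := Comb.eval_eq_of_follows (red := id)
        (x := Comb.single (.prod (.ax 0) (.sigTwo false))) (y := axSigSameComb) (fun _ => rfl)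
        (1 / 8) e (by decide +kernel)
      rwa [Comb.eval_single] at this
    axSigOther := fun a ha => by
      have := ha.mul_sigTwo
      have h2 := ha.form_two 0
      rw [zero_add] at h2
      rwa [← ha.form_two_eq, h2] at this }

theorem isMul_squareTable : Table.squareTable.IsMul l m (IsDihedralTwo B l m) :=
  { isMul_sigTwoTable with
    sigOneSigOne := fun a ha => by
      have e := eval_fusionRelation class_two isMul_sigTwoTable ha (k := 1) (n := 1)
        ha.form_zero_one ha.form_zero_one (red := id) (fun _ => rfl)
      -- The A_0-component contains -8 σ₁ and the A_{1/4}-component 8 σ₁, so σ₁² has coefficient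
      -- (-1/4)(-64) = 16 in the relation. The same factor serves for σ₁σ₂ᵉ and (σ₂ᵉ)².
      have := Comb.eval_eq_of_follows (red := id)
        (x := Comb.single (.prod .sigOne .sigOne)) (y := sigOneSigOneComb) (fun _ => rfl)
        (1 / 16) e (by decide +kernel)
      rwa [Comb.eval_single] at this }

variable (ha : IsDihedralTwo B l m a)
include ha

/-- The square of σ₁ is expressed around a_0, but σ₁ is invariant under the shift. Equating the
expressions around a_0 and a_1 gives a linear relation in which a_3 occurs with an invertible
coefficient. -/
theorem IsDihedralTwo.recurrence : a 3 = Comb.eval l m (atomVal R a) recurrenceComb := by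
  have h1 := isMul_squareTable.sigOneSigOne a ha
  have h2 := isMul_squareTable.sigOneSigOne _ (class_two.move a ha 1 1 (Or.inl rfl))
  rw [← Comb.eval_move l m (ha.atomVal_move 1 (Or.inl rfl)), ha.atomVal_move 1 (Or.inl rfl)] at h2
  have e : Comb.eval l m (atomVal R a)
      (Comb.sub sigOneSigOneComb (sigOneSigOneComb.move 1 1)) = 0 := by
    rw [Comb.eval_sub]
    exact sub_eq_zero.2 (h1.symm.trans h2)
  -- The coefficient of a_3 in the difference is -49/196608, from the term a_{i+2} of the shifted
  -- expression.
  have := Comb.eval_eq_of_follows (red := id) (x := Comb.single (.ax 3)) (y := recurrenceComb)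
    (fun _ => rfl) (-196608 / 49) e (by decide +kernel)
  rwa [Comb.eval_single] at this

theorem IsDihedralTwo.eval_reduce (x : Comb) :
    Comb.eval l m (atomVal R a) (Comb.reduce x) = Comb.eval l m (atomVal R a) x := by
  have key : ∀ i d : ℤ, d = 1 ∨ d = -1 → a (i + d * 3) =
      Comb.eval l m (atomVal R a) (recurrenceComb.move i d) := fun i d hd => by
    rw [Comb.eval_move l m (ha.atomVal_move i hd)]
    exact (class_two.move a ha i d hd).recurrence
  have h : ∀ x, _ = Comb.eval l m (atomVal R a) x := fun x =>
    Comb.eval_lift l m (atomVal R a) (atomVal R a) LinearMap.id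
    (fun s => match s with
    | .ax i =>
      if 3 ≤ i then recurrenceComb.move (i - 3) 1
      else if i ≤ -3 then recurrenceComb.move (i + 3) (-1)
      else Comb.single (.ax i)
    | s => Comb.single s) (fun s => by
      cases s with
      | ax i =>
        dsimp only
        split_ifs with h1 h2
        · rw [← key _ _ (Or.inl rfl)]
          exact congrArg a (by ring)
        · rw [← key _ _ (Or.inr rfl)]
          exact congrArg a (by ring)
        · rw [Comb.eval_single]; rfl
      | _ => exact (Comb.eval_single l m (atomVal R a) _).symm) x
  -- One step for each of the three passes of `reduce`. A pass lowers the absolute value of every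
  -- index beyond 2 by at least one, so indices up to 5 in absolute value are eliminated.
  exact (h _).trans ((h _).trans (h x))

end Two

end Derivation

/-! ### Distant axes and the remaining products of σ's -/

section Tables

variable {R A : Type*} [CommRing R] [Algebra ℚ R] [NonUnitalNonAssocCommRing A] [Module R A]
  [IsScalarTower R A A] [SMulCommClass R A A]
  {B : A →ₗ[R] A →ₗ[R] R} {a : ℤ → A} {l m : R}

theorem isMul_threeTable : Table.threeTable.IsMul l m (IsDihedralTwo B l m) :=
  { isMul_squareTable with
    ax := fun a ha n => by
      by_cases hn : n = 3
      · subst hn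
        -- No relation has to be solved: the empty combination with factor 0 makes this a pure
        -- computation, multiplying the recurrence by a_0.
        refine Eq.trans ?_ (Comb.eval_eq_of_follows (ha.eval_reduce) (e := []) 0 rfl
          (x := Comb.mul .squareTable (Comb.single (.ax 0)) recurrenceComb)
          (y := axThreeComb) (by decide +kernel))
        rw [Comb.eval_mul class_two isMul_squareTable ha, ← ha.recurrence, Comb.eval_single]
        rfl
      · rw [isMul_squareTable.ax a ha n]
        have : n ≤ 2 ↔ n ≤ 3 := by omega
        simp only [Table.threeTable, Table.squareTable, Table.sigTwoTable, Table.sigOneTable,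
          Table.axesTable, axCombUpTo, this] }

theorem IsDihedralTwo.four (ha : IsDihedralTwo B l m a) :
    a 4 = Comb.eval l m (atomVal R a) (recurrenceComb.move 1 1) := by
  rw [Comb.eval_move l m (ha.atomVal_move 1 (Or.inl rfl))]
  exact (class_two.move a ha 1 1 (Or.inl rfl)).recurrence

theorem isMul_fourTable : Table.fourTable.IsMul l m (IsDihedralTwo B l m) :=
  { isMul_threeTable with
    ax := fun a ha n => by
      by_cases hn : n = 4
      · subst hn
        refine Eq.trans ?_ (Comb.eval_eq_of_follows (ha.eval_reduce) (e := []) 0 rfl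
          (x := Comb.mul .threeTable (Comb.single (.ax 0)) (recurrenceComb.move 1 1))
          (y := axFourComb) (by decide +kernel))
        rw [Comb.eval_mul class_two isMul_threeTable ha, ← ha.four, Comb.eval_single]
        rfl
      · rw [isMul_threeTable.ax a ha n]
        have : n ≤ 3 ↔ n ≤ 4 := by omega
        simp only [Table.fourTable, Table.threeTable, axCombUpTo, this] }

theorem isMul_sigOneSigTwoTable : Table.sigOneSigTwoTable.IsMul l m (IsDihedralTwo B l m) :=
  { isMul_fourTable with
    sigOneSigTwo := fun a ha => by
      have e := eval_fusionRelation class_two isMul_fourTable ha (k := 1) (n := 2)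
        ha.form_zero_one ha.form_zero_two (red := Comb.reduce) ha.eval_reduce
      have := Comb.eval_eq_of_follows ha.eval_reduce
        (x := Comb.single (.prod .sigOne (.sigTwo false))) (y := sigOneSigTwoComb)
        (1 / 16) e (by decide +kernel)
      rwa [Comb.eval_single] at this }

/-- The fusion relation with both pairs at distance two contains a_2 a_{-2}, which is why axes at
distance four are needed beforehand. -/
theorem isMul_sigSameTable : Table.sigSameTable.IsMul l m (IsDihedralTwo B l m) :=
  { isMul_sigOneSigTwoTable with
    sigSame := fun a ha => by
      have e := eval_fusionRelation class_two isMul_sigOneSigTwoTable ha (k := 2) (n := 2)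
        ha.form_zero_two ha.form_zero_two (red := Comb.reduce) ha.eval_reduce
      have := Comb.eval_eq_of_follows ha.eval_reduce
        (x := Comb.single (.prod (.sigTwo false) (.sigTwo false))) (y := sigSameComb)
        (1 / 16) e (by decide +kernel)
      rwa [Comb.eval_single] at this }

/-- The recurrence contains 32 σ₂ᵒ, so multiplying it by σ₂ᵉ expresses σ₂ᵉσ₂ᵒ through products
already known. -/
theorem isMul_mulTable : Table.mulTable.IsMul l m (IsDihedralTwo B l m) :=
  { isMul_sigSameTable with
    sigOther := fun a ha => by
      let x := Comb.mul .sigSameTable (Comb.single (.sigTwo false))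
        (Comb.sub (Comb.single (.ax 3)) recurrenceComb)
      have h : ∀ a, IsDihedralTwo B l m a → Comb.eval l m (atomVal R a) x = 0 := fun a ha => by
        rw [Comb.eval_mul class_two isMul_sigSameTable ha, Comb.eval_sub, ← ha.recurrence,
          Comb.eval_single, Comb.eval_single, atomVal.eq_2, sub_self, mul_zero]
      -- Adding the mirror image in a_0 gives a_k and a_{-k} the same coefficients, as in
      -- `sigOtherComb`.
      have e : Comb.eval l m (atomVal R a) (Comb.add x (x.move 0 (-1))) = 0 := by
        rw [Comb.eval_add, Comb.eval_move l m (ha.atomVal_move 0 (Or.inr rfl)), h a ha,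
          h _ (class_two.move a ha 0 (-1) (Or.inr rfl)), add_zero]
      -- Both x and its mirror image contain -32 σ₂ᵉσ₂ᵒ.
      have := Comb.eval_eq_of_follows ha.eval_reduce
        (x := Comb.single (.prod (.sigTwo false) (.sigTwo true))) (y := sigOtherComb)
        (-1 / 64) e (by decide +kernel)
      rwa [Comb.eval_single] at this }

/-! ### The form -/

theorem isForm_formSigTable : Table.formSigTable.IsForm B l m (IsDihedralTwo B l m) :=
  { Table.valid_unknown fun _ _ _ => rfl with
    ax := fun a ha n => by
      match n with
      | 0 =>
        simpa [Table.formSigTable, formAxCombUpTo, formAxComb, Comb.eval, Poly.eval, atomForm]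
          using ha.norm 0
      | 1 =>
        simpa [Table.formSigTable, formAxCombUpTo, formAxComb, Comb.eval, Poly.eval, atomForm]
          using ha.form_one 0
      | 2 =>
        simpa [Table.formSigTable, formAxCombUpTo, formAxComb, Comb.eval, Poly.eval, atomForm]
          using ha.form_two 0
      | n + 3 => exact (Table.valid_unknown (Q := IsDihedralTwo B l m) (l := l) (m := m) (f := B)
          (V := fun a => atomForm B a) fun _ _ _ => rfl).ax a ha (n + 3)
    axSigOne := fun a ha => by
      have h1 := ha.form_sig 1
      rw [ha.form_zero_one (m := m)] at h1
      simp [Table.formSigTable, axSigOnePoly, Comb.eval, Poly.eval, atomForm, atomVal, h1, neg_div,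
        sub_eq_add_neg]
    axSigSame := fun a ha => by
      have h1 := ha.form_sig 2
      rw [ha.form_zero_two] at h1
      simp [Table.formSigTable, axSigSamePoly, Comb.eval, Poly.eval, atomForm, atomVal, h1,
        neg_div, sub_eq_add_neg]
    axSigOther := fun a ha => by
      have h2 := ha.form_two 0
      rw [zero_add] at h2
      have := ha.form_sigTwo
      rw [← ha.form_two_eq, h2] at this
      simp [Table.formSigTable, axSigOtherPoly, Comb.eval, atomForm, this] }

theorem isForm_formThreeTable : Table.formThreeTable.IsForm B l m (IsDihedralTwo B l m) :=
  { isForm_formSigTable with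
    ax := fun a ha n => by
      by_cases hn : n = 3
      · subst hn
        refine Eq.trans ?_ (Comb.eval_eq l m (atomForm B a)
          (x := Comb.form .formSigTable (Comb.single (.ax 0)) recurrenceComb)
          (y := [(.one, axThreePoly)]) (by decide +kernel))
        rw [Comb.eval_form class_two isForm_formSigTable ha, ← ha.recurrence, Comb.eval_single]
        rfl
      · rw [isForm_formSigTable.ax a ha n]
        have : n ≤ 2 ↔ n ≤ 3 := by omega
        simp only [Table.formThreeTable, Table.formSigTable, formAxCombUpTo, this] }

theorem isForm_formFourTable : Table.formFourTable.IsForm B l m (IsDihedralTwo B l m) :=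
  { isForm_formThreeTable with
    ax := fun a ha n => by
      by_cases hn : n = 4
      · subst hn
        refine Eq.trans ?_ (Comb.eval_eq l m (atomForm B a)
          (x := Comb.form .formThreeTable (Comb.single (.ax 0)) (recurrenceComb.move 1 1))
          (y := [(.one, axFourPoly)]) (by decide +kernel))
        rw [Comb.eval_form class_two isForm_formThreeTable ha, ← ha.four, Comb.eval_single]
        rfl
      · rw [isForm_formThreeTable.ax a ha n]
        have : n ≤ 3 ↔ n ≤ 4 := by omega
        simp only [Table.formFourTable, Table.formThreeTable, formAxCombUpTo, this] }

/-- Associativity turns ⟨s, uv⟩ into ⟨su, v⟩. With u and v axes, the product table reduces values on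
two σ's to values with an axis as one argument. -/
theorem IsDihedralTwo.form_sig_eq (ha : IsDihedralTwo B l m a) {s u v : Atom} {p : Poly}
    (h : Comb.isZero (Comb.sub
      (Comb.formSig .formFourTable .mulTable (Comb.single s) u v) [(.one, p)]) = true) :
    B (atomVal R a s) (sig R (atomVal R a u) (atomVal R a v)) =
      Comb.eval l m (atomForm B a) [(.one, p)] := by
  rw [← Comb.eval_eq l m (atomForm B a) h,
    Comb.eval_formSig class_two isForm_formFourTable isMul_mulTable ha, Comb.eval_single]

theorem isForm_formTable : Table.formTable.IsForm B l m (IsDihedralTwo B l m) :=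
  { isForm_formFourTable with
    sigOneSigOne := fun a ha =>
      ha.form_sig_eq (s := .sigOne) (u := .ax 0) (v := .ax 1) (by decide +kernel)
    sigOneSigTwo := fun a ha =>
      ha.form_sig_eq (s := .sigOne) (u := .ax 0) (v := .ax 2) (by decide +kernel)
    sigSame := fun a ha =>
      ha.form_sig_eq (s := .sigTwo false) (u := .ax 0) (v := .ax 2) (by decide +kernel)
    sigOther := fun a ha =>
      ha.form_sig_eq (s := .sigTwo false) (u := .ax 1) (v := .ax 3) (by decide +kernel) }

end Tables

/-! ### The tables in expanded form -/

section Expanded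

variable {R A : Type*} [CommRing R] [Algebra ℚ R] [NonUnitalNonAssocCommRing A] [Module R A]
  [IsScalarTower R A A] [SMulCommClass R A A]
  {B : A →ₗ[R] A →ₗ[R] R} {a : ℤ → A} {l m : R}

theorem IsDihedralTwo.shift (ha : IsDihedralTwo B l m a) (i : ℤ) :
    IsDihedralTwo B l m fun k => a (i + k) := by
  simpa using class_two.move a ha i 1 (Or.inl rfl)

variable {s : ℤ → A} (ha : IsDihedralTwo B l m a) (hs : ∀ i, s i = sig R (a i) (a (i + 2)))
  (i : ℤ)

omit [IsScalarTower R A A] [SMulCommClass R A A] in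
theorem atomVal_shift_ax (k : ℤ) : atomVal R (fun k => a (i + k)) (.ax k) = a (i + k) := rfl

include ha in
theorem atomVal_shift_sigOne :
    atomVal R (fun k => a (i + k)) .sigOne = sig R (a 0) (a 1) := by
  rw [← ha.sig_one i, atomVal, add_zero]

omit [IsScalarTower R A A] [SMulCommClass R A A] in
include hs in
theorem atomVal_shift_sigTwo_false :
    atomVal R (fun k => a (i + k)) (.sigTwo false) = s i := by
  simp [hs, atomVal]

omit [IsScalarTower R A A] [SMulCommClass R A A] in
include hs in
theorem atomVal_shift_sigTwo_true :
    atomVal R (fun k => a (i + k)) (.sigTwo true) = s (i + 1) := by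
  simp [hs, atomVal, add_assoc]

include ha hs

set_option linter.unusedSimpArgs false in
theorem IsDihedralTwo.isMulTable : IsMulTable l m a (sig R (a 0) (a 1)) s where
  recurrence i := by
    have h := (ha.shift i).recurrence
    simp only [recurrenceComb, Comb.eval, Poly.eval, atomVal_shift_ax, atomVal_shift_sigOne ha,
      atomVal_shift_sigTwo_false hs, atomVal_shift_sigTwo_true hs, neg_div, map_neg, pow_zero,
      pow_one, one_mul, mul_one, map_one, add_zero, ← sub_eq_add_neg] at h
    rw [h]
    module
  axis_zero i := (ha.axis i).idem
  axis_one i := by rw [← ha.sig_one i]; exact mul_eq_sig _ _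
  axis_two i := by rw [hs]; exact mul_eq_sig _ _
  axis_three i := by
    have h := isMul_mulTable.ax _ (ha.shift i) 3
    simp only [Table.mulTable, Table.sigSameTable, Table.sigOneSigTwoTable, Table.fourTable, axThreeComb,
      Comb.eval, Poly.eval, atomVal_shift_ax, atomVal_shift_sigOne ha,
      atomVal_shift_sigTwo_false hs, atomVal_shift_sigTwo_true hs, neg_div, map_neg, pow_zero,
      pow_one, one_mul, mul_one, map_one, add_zero, ← sub_eq_add_neg, LinearMap.mul_apply',
      Nat.cast_ofNat, axCombUpTo, axComb, le_refl, if_true, show (3 : ℕ) ≤ 4 by decide] at h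
    rw [h]
    module
  axis_four i := by
    have h := isMul_mulTable.ax _ (ha.shift i) 4
    simp only [Table.mulTable, Table.sigSameTable, Table.sigOneSigTwoTable, Table.fourTable, axFourComb,
      Comb.eval, Poly.eval, atomVal_shift_ax, atomVal_shift_sigOne ha,
      atomVal_shift_sigTwo_false hs, atomVal_shift_sigTwo_true hs, neg_div, map_neg, pow_zero,
      pow_one, one_mul, mul_one, map_one, add_zero, ← sub_eq_add_neg, LinearMap.mul_apply',
      Nat.cast_ofNat, axCombUpTo, axComb, le_refl, if_true, show (3 : ℕ) ≤ 4 by decide] at h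
    rw [h]
    module
  axis_sig_one i := by
    have h := isMul_mulTable.axSigOne _ (ha.shift i)
    simp only [Table.mulTable, Table.sigSameTable, Table.sigOneSigTwoTable, Table.fourTable, Table.threeTable,
      Table.squareTable, Table.sigTwoTable, Table.sigOneTable, axSigOneComb,
      Comb.eval, Poly.eval, atomVal_shift_ax, atomVal_shift_sigOne ha,
      atomVal_shift_sigTwo_false hs, atomVal_shift_sigTwo_true hs, neg_div, map_neg, pow_zero,
      pow_one, one_mul, mul_one, map_one, add_zero, ← sub_eq_add_neg, LinearMap.mul_apply'] at h
    rw [h]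
    module
  axis_sig_same i := by
    have h := isMul_mulTable.axSigSame _ (ha.shift i)
    simp only [Table.mulTable, Table.sigSameTable, Table.sigOneSigTwoTable, Table.fourTable, Table.threeTable,
      Table.squareTable, Table.sigTwoTable, axSigSameComb,
      Comb.eval, Poly.eval, atomVal_shift_ax, atomVal_shift_sigOne ha,
      atomVal_shift_sigTwo_false hs, atomVal_shift_sigTwo_true hs, neg_div, map_neg, pow_zero,
      pow_one, one_mul, mul_one, map_one, add_zero, ← sub_eq_add_neg, LinearMap.mul_apply'] at h
    rw [h]
    module
  axis_sig_other i := by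
    have h := isMul_mulTable.axSigOther _ (ha.shift i)
    simp only [Table.mulTable, Table.sigSameTable, Table.sigOneSigTwoTable, Table.fourTable, Table.threeTable,
      Table.squareTable, Table.sigTwoTable, axSigOtherComb,
      Comb.eval, Poly.eval, atomVal_shift_ax, atomVal_shift_sigOne ha,
      atomVal_shift_sigTwo_false hs, atomVal_shift_sigTwo_true hs, neg_div, map_neg, pow_zero,
      pow_one, one_mul, mul_one, map_one, add_zero, ← sub_eq_add_neg, LinearMap.mul_apply'] at h
    rw [h]
    module
  sig_one_sig_one i := by
    have h := isMul_mulTable.sigOneSigOne _ (ha.shift i)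
    simp only [Table.mulTable, Table.sigSameTable, Table.sigOneSigTwoTable, Table.fourTable, Table.threeTable,
      Table.squareTable, sigOneSigOneComb,
      Comb.eval, Poly.eval, atomVal_shift_ax, atomVal_shift_sigOne ha,
      atomVal_shift_sigTwo_false hs, atomVal_shift_sigTwo_true hs, neg_div, map_neg, pow_zero,
      pow_one, one_mul, mul_one, map_one, add_zero, ← sub_eq_add_neg, LinearMap.mul_apply'] at h
    rw [h]
    module
  sig_one_sig i := by
    have h := isMul_mulTable.sigOneSigTwo _ (ha.shift i)
    simp only [Table.mulTable, Table.sigSameTable, Table.sigOneSigTwoTable, sigOneSigTwoComb,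
      Comb.eval, Poly.eval, atomVal_shift_ax, atomVal_shift_sigOne ha,
      atomVal_shift_sigTwo_false hs, atomVal_shift_sigTwo_true hs, neg_div, map_neg, pow_zero,
      pow_one, one_mul, mul_one, map_one, add_zero, ← sub_eq_add_neg, LinearMap.mul_apply'] at h
    rw [h]
    module
  sig_same i := by
    have h := isMul_mulTable.sigSame _ (ha.shift i)
    simp only [Table.mulTable, Table.sigSameTable, sigSameComb,
      Comb.eval, Poly.eval, atomVal_shift_ax, atomVal_shift_sigOne ha,
      atomVal_shift_sigTwo_false hs, atomVal_shift_sigTwo_true hs, neg_div, map_neg, pow_zero,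
      pow_one, one_mul, mul_one, map_one, add_zero, ← sub_eq_add_neg, LinearMap.mul_apply'] at h
    rw [h]
    module
  sig_other i := by
    have h := isMul_mulTable.sigOther _ (ha.shift i)
    simp only [Table.mulTable, sigOtherComb,
      Comb.eval, Poly.eval, atomVal_shift_ax, atomVal_shift_sigOne ha,
      atomVal_shift_sigTwo_false hs, atomVal_shift_sigTwo_true hs, neg_div, map_neg, pow_zero,
      pow_one, one_mul, mul_one, map_one, add_zero, ← sub_eq_add_neg, LinearMap.mul_apply'] at h
    rw [h]
    module

set_option linter.unusedSimpArgs false in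
theorem IsDihedralTwo.isFormTable : IsFormTable l m B a (sig R (a 0) (a 1)) s where
  symm := ha.symm
  axis_zero := ha.norm
  axis_one := ha.form_one
  axis_two := ha.form_two
  axis_three i := by
    have h := isForm_formTable.ax _ (ha.shift i) 3
    simp only [Table.formTable, Table.formFourTable, axThreePoly,
      Comb.eval, Poly.eval, atomVal_shift_ax, atomVal_shift_sigOne ha,
      atomVal_shift_sigTwo_false hs, atomVal_shift_sigTwo_true hs, neg_div, map_neg, pow_zero,
      pow_one, one_mul, mul_one, map_one, add_zero, ← sub_eq_add_neg, atomForm,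
      smul_eq_mul, Nat.cast_ofNat, formAxCombUpTo, formAxComb, le_refl, if_true,
      show (3 : ℕ) ≤ 4 by decide] at h
    rw [h]
    ring
  axis_four i := by
    have h := isForm_formTable.ax _ (ha.shift i) 4
    simp only [Table.formTable, Table.formFourTable, axFourPoly,
      Comb.eval, Poly.eval, atomVal_shift_ax, atomVal_shift_sigOne ha,
      atomVal_shift_sigTwo_false hs, atomVal_shift_sigTwo_true hs, neg_div, map_neg, pow_zero,
      pow_one, one_mul, mul_one, map_one, add_zero, ← sub_eq_add_neg, atomForm,
      smul_eq_mul, Nat.cast_ofNat, formAxCombUpTo, formAxComb, le_refl, if_true,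
      show (3 : ℕ) ≤ 4 by decide] at h
    rw [h]
    ring
  axis_sig_one i := by
    have h := isForm_formTable.axSigOne _ (ha.shift i)
    simp only [Table.formTable, Table.formFourTable, Table.formThreeTable, Table.formSigTable, axSigOnePoly,
      Comb.eval, Poly.eval, atomVal_shift_ax, atomVal_shift_sigOne ha,
      atomVal_shift_sigTwo_false hs, atomVal_shift_sigTwo_true hs, neg_div, map_neg, pow_zero,
      pow_one, one_mul, mul_one, map_one, add_zero, ← sub_eq_add_neg, atomForm,
      smul_eq_mul] at h
    rw [h]
  axis_sig_same i := by
    have h := isForm_formTable.axSigSame _ (ha.shift i)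
    simp only [Table.formTable, Table.formFourTable, Table.formThreeTable, Table.formSigTable, axSigSamePoly,
      Comb.eval, Poly.eval, atomVal_shift_ax, atomVal_shift_sigOne ha,
      atomVal_shift_sigTwo_false hs, atomVal_shift_sigTwo_true hs, neg_div, map_neg, pow_zero,
      pow_one, one_mul, mul_one, map_one, add_zero, ← sub_eq_add_neg, atomForm,
      smul_eq_mul] at h
    rw [h]
  axis_sig_other i := by
    have h := isForm_formTable.axSigOther _ (ha.shift i)
    simp only [Table.formTable, Table.formFourTable, Table.formThreeTable, Table.formSigTable, axSigOtherPoly,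
      Comb.eval, Poly.eval, atomVal_shift_ax, atomVal_shift_sigOne ha,
      atomVal_shift_sigTwo_false hs, atomVal_shift_sigTwo_true hs, neg_div, map_neg, pow_zero,
      pow_one, one_mul, mul_one, map_one, add_zero, ← sub_eq_add_neg, atomForm,
      smul_eq_mul] at h
    rw [h]
    ring
  sig_one_sig_one := by
    have h := isForm_formTable.sigOneSigOne _ (ha.shift 0)
    simp only [Table.formTable, sigOneSigOnePoly,
      Comb.eval, Poly.eval, atomVal_shift_ax, atomVal_shift_sigOne ha,
      atomVal_shift_sigTwo_false hs, atomVal_shift_sigTwo_true hs, neg_div, map_neg, pow_zero,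
      pow_one, one_mul, mul_one, map_one, add_zero, ← sub_eq_add_neg, atomForm,
      smul_eq_mul] at h
    rw [h]
    ring
  sig_one_sig i := by
    have h := isForm_formTable.sigOneSigTwo _ (ha.shift i)
    simp only [Table.formTable, sigOneSigTwoPoly,
      Comb.eval, Poly.eval, atomVal_shift_ax, atomVal_shift_sigOne ha,
      atomVal_shift_sigTwo_false hs, atomVal_shift_sigTwo_true hs, neg_div, map_neg, pow_zero,
      pow_one, one_mul, mul_one, map_one, add_zero, ← sub_eq_add_neg, atomForm,
      smul_eq_mul] at h
    rw [h]
    ring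
  sig_same i := by
    have h := isForm_formTable.sigSame _ (ha.shift i)
    simp only [Table.formTable, sigSamePoly,
      Comb.eval, Poly.eval, atomVal_shift_ax, atomVal_shift_sigOne ha,
      atomVal_shift_sigTwo_false hs, atomVal_shift_sigTwo_true hs, neg_div, map_neg, pow_zero,
      pow_one, one_mul, mul_one, map_one, add_zero, ← sub_eq_add_neg, atomForm,
      smul_eq_mul] at h
    rw [h]
    ring
  sig_other i := by
    have h := isForm_formTable.sigOther _ (ha.shift i)
    simp only [Table.formTable, sigOtherPoly,
      Comb.eval, Poly.eval, atomVal_shift_ax, atomVal_shift_sigOne ha,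
      atomVal_shift_sigTwo_false hs, atomVal_shift_sigTwo_true hs, neg_div, map_neg, pow_zero,
      pow_one, one_mul, mul_one, map_one, add_zero, ← sub_eq_add_neg, atomForm,
      smul_eq_mul] at h
    rw [h]
    ring

end Expanded

/-! ### The sequence of axes generated by two axes -/

section Sequence

variable {R A : Type*} [CommRing R] [Algebra ℚ R] [NonUnitalNonAssocCommRing A] [Module R A]
  [IsScalarTower R A A] [SMulCommClass R A A]

/-- The automorphisms of an algebra with a bilinear form. -/
def formAut (B : A →ₗ[R] A →ₗ[R] R) : Subgroup (A ≃ₗ[R] A) where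
  carrier := {φ | (∀ x y, φ (x * y) = φ x * φ y) ∧ ∀ x y, B (φ x) (φ y) = B x y}
  mul_mem' {φ ψ} hφ hψ :=
    ⟨fun x y => by simp [hφ.1, hψ.1], fun x y => by simp [hφ.2, hψ.2]⟩
  one_mem' := ⟨fun _ _ => rfl, fun _ _ => rfl⟩
  inv_mem' {φ} hφ := by
    have hi : ∀ x, φ (φ⁻¹ x) = x := fun x => LinearEquiv.apply_symm_apply φ x
    refine ⟨fun x y => φ.injective ?_, fun x y => ?_⟩
    · rw [hφ.1, hi, hi, hi]
    · rw [← hφ.2, hi, hi]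

variable {B : A →ₗ[R] A →ₗ[R] R} {φ : A ≃ₗ[R] A} (hφ : φ ∈ formAut B) (a : A)
include hφ

theorem eig_map (θ : ℚ) : eig R (φ a) θ = (eig R a θ).map φ.toLinearMap := by
  ext x
  rw [mem_eig, Submodule.mem_map]
  constructor
  · intro hx
    refine ⟨φ.symm x, mem_eig.2 (φ.injective ?_), φ.apply_symm_apply x⟩
    rw [hφ.1, map_smul, φ.apply_symm_apply, hx]
  · rintro ⟨y, hy, rfl⟩
    have := congrArg φ (mem_eig.1 hy)
    rwa [hφ.1, map_smul] at this

theorem plusPart_map : plusPart R (φ a) = (plusPart R a).map φ.toLinearMap := by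
  rw [plusPart, plusPart, Submodule.map_sup, Submodule.map_sup, eig_map hφ, eig_map hφ,
    eig_map hφ]

variable {a}

theorem IsAxis.map {F : FusionRules} (h : IsAxis R F a) : IsAxis R F (φ a) where
  idem := by rw [← hφ.1, h.idem]
  semisimple := by
    simp only [eig_map hφ, ← Submodule.map_iSup, h.semisimple, Submodule.map_top]
    exact LinearEquiv.range φ
  primitive := by
    rw [eig_map hφ, h.primitive, Submodule.map_span, Set.image_singleton]
    rfl
  fusion θ hθ η hη x hx y hy := by
    rw [eig_map hφ] at hx hy
    obtain ⟨x, hx, rfl⟩ := hx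
    obtain ⟨y, hy, rfl⟩ := hy
    simp only [eig_map hφ, ← Submodule.map_iSup]
    exact ⟨x * y, h.fusion θ hθ η hη x hx y hy, hφ.1 x y⟩

end Sequence

section Sequence

variable {R A : Type*} [CommRing R] [Algebra ℚ R] [NonUnitalNonAssocCommRing A] [Module R A]
  [IsScalarTower R A A] [SMulCommClass R A A]
  {B : A →ₗ[R] A →ₗ[R] R} {a₀ a₁ : A} {τ₀ τ₁ : A ≃ₗ[R] A}

omit [Algebra ℚ R] [IsScalarTower R A A] [SMulCommClass R A A] in
theorem axisSeq_add (j n : ℤ) :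
    axisSeq τ₀ τ₁ a₀ a₁ (j + 2 * n) = ((τ₁ * τ₀) ^ n) (axisSeq τ₀ τ₁ a₀ a₁ j) := by
  have h1 : (j + 2 * n) / 2 = n + j / 2 := by omega
  have h2 : Even (j + 2 * n) ↔ Even j := by simp [Int.even_add]
  simp only [axisSeq, h1, h2, zpow_add]
  rfl

omit [Algebra ℚ R] [IsScalarTower R A A] [SMulCommClass R A A] in
theorem axisSeq_zero : axisSeq τ₀ τ₁ a₀ a₁ 0 = a₀ := by simp [axisSeq]

omit [Algebra ℚ R] [IsScalarTower R A A] [SMulCommClass R A A] in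
theorem axisSeq_one : axisSeq τ₀ τ₁ a₀ a₁ 1 = a₁ := by simp [axisSeq]

variable (h₀ : IsAxis R V43 a₀) (h₁ : IsAxis R V43 a₁) (hτ₀ : IsMiyamoto a₀ τ₀)
  (hτ₁ : IsMiyamoto a₁ τ₁)
include h₀ h₁ hτ₀ hτ₁

/-- Conjugation by τ₀ inverts ρ = τ₁τ₀. Moreover τ₀ fixes a_0, and it maps a_1 to ρ⁻¹ a_1 because τ₁
fixes a_1. -/
theorem map_axisSeq_zero (j : ℤ) : τ₀ (axisSeq τ₀ τ₁ a₀ a₁ j) = axisSeq τ₀ τ₁ a₀ a₁ (-j) := by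
  have s0 : τ₀ * τ₀ = 1 := LinearEquiv.ext (hτ₀.map_map h₀)
  have s1 : τ₁ * τ₁ = 1 := LinearEquiv.ext (hτ₁.map_map h₁)
  have i0 : τ₀⁻¹ = τ₀ := inv_eq_of_mul_eq_one_right s0
  have i1 : τ₁⁻¹ = τ₁ := inv_eq_of_mul_eq_one_right s1
  have hc : τ₀ * (τ₁ * τ₀) * τ₀⁻¹ = (τ₁ * τ₀)⁻¹ := by
    rw [mul_inv_rev, i0, i1, mul_assoc, mul_assoc, s0, mul_one]
  have hk : ∀ n : ℤ, ∀ x, τ₀ (((τ₁ * τ₀) ^ n) x) = ((τ₁ * τ₀) ^ (-n)) (τ₀ x) := fun n x => by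
    have : τ₀ * (τ₁ * τ₀) ^ n = (τ₁ * τ₀) ^ (-n) * τ₀ := by
      rw [zpow_neg, ← inv_zpow, ← hc, conj_zpow, inv_mul_cancel_right]
    exact LinearEquiv.congr_fun this x
  have ha : τ₀ a₁ = ((τ₁ * τ₀) ^ (-1 : ℤ)) a₁ := by
    rw [zpow_neg_one, mul_inv_rev, i0, i1]
    exact congrArg τ₀ (hτ₁.map_self h₁).symm
  rcases Int.even_or_odd' j with ⟨n, rfl | rfl⟩
  · have e1 := axisSeq_add (τ₀ := τ₀) (τ₁ := τ₁) (a₀ := a₀) (a₁ := a₁) 0 n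
    have e2 := axisSeq_add (τ₀ := τ₀) (τ₁ := τ₁) (a₀ := a₀) (a₁ := a₁) 0 (-n)
    rw [zero_add] at e1 e2
    rw [← mul_neg, e1, e2, hk, axisSeq_zero, hτ₀.map_self h₀]
  · have e1 := axisSeq_add (τ₀ := τ₀) (τ₁ := τ₁) (a₀ := a₀) (a₁ := a₁) 1 n
    have e2 := axisSeq_add (τ₀ := τ₀) (τ₁ := τ₁) (a₀ := a₀) (a₁ := a₁) 1 (-n + -1)
    rw [add_comm (2 * n), e1, show -(1 + 2 * n) = 1 + 2 * (-n + -1) by ring, e2, hk, axisSeq_one,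
      ha, zpow_add]
    rfl

/-- Since τ₁ = ρτ₀, the involution acts as reflection in 0 followed by a shift by two. -/
theorem map_axisSeq_one (j : ℤ) :
    τ₁ (axisSeq τ₀ τ₁ a₀ a₁ j) = axisSeq τ₀ τ₁ a₀ a₁ (2 - j) := by
  have h := map_axisSeq_zero h₀ h₁ hτ₀ hτ₁ (-j)
  rw [neg_neg] at h
  rw [← h, show 2 - j = -j + 2 * 1 by ring, axisSeq_add, zpow_one]
  rfl

variable (hB : IsAssocForm B) (hs : ∀ x y, B x y = B y x) (hn₀ : B a₀ a₀ = 1) (hn₁ : B a₁ a₁ = 1)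
include hB hs hn₀ hn₁

/-- The conditions attached to an axis are checked at a_0 and a_1, where the reflections are τ₀ and
τ₁, and transported by powers of ρ, which are automorphisms preserving the form. -/
theorem isDihedral_axisSeq : IsDihedral B (axisSeq τ₀ τ₁ a₀ a₁) := by
  set a := axisSeq τ₀ τ₁ a₀ a₁ with ha
  have m0 : τ₀ ∈ formAut B := ⟨hτ₀.map_mul, hτ₀.form h₀ hB⟩
  have m1 : τ₁ ∈ formAut B := ⟨hτ₁.map_mul, hτ₁.form h₁ hB⟩
  have mρ : ∀ n : ℤ, (τ₁ * τ₀) ^ n ∈ formAut B := fun n => zpow_mem (mul_mem m1 m0) n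
  have t0 : ∀ j, τ₀ (a j) = a (-j) := map_axisSeq_zero h₀ h₁ hτ₀ hτ₁
  have t1 : ∀ j, τ₁ (a j) = a (2 - j) := map_axisSeq_one h₀ h₁ hτ₀ hτ₁
  have hadd : ∀ j n, a (j + 2 * n) = ((τ₁ * τ₀) ^ n) (a j) := axisSeq_add
  have ha0 : a 0 = a₀ := axisSeq_zero
  have ha1 : a 1 = a₁ := axisSeq_one
  have key : ∀ p : A → Prop, p (a 0) → p (a 1) →
      (∀ x, ∀ n : ℤ, p x → p (((τ₁ * τ₀) ^ n) x)) → ∀ i, p (a i) := by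
    intro p p0 p1 hp i
    rcases Int.even_or_odd' i with ⟨n, rfl | rfl⟩
    · rw [← zero_add (2 * n), hadd]; exact hp _ n p0
    · rw [add_comm, hadd]; exact hp _ n p1
  have base : ∀ i : ℤ, ∃ n e : ℤ, (e = 0 ∨ e = 1) ∧ ∀ k, i + k = e + k + 2 * n := by
    intro i
    rcases Int.even_or_odd' i with ⟨n, rfl | rfl⟩
    · exact ⟨n, 0, Or.inl rfl, fun k => by ring⟩
    · exact ⟨n, 1, Or.inr rfl, fun k => by ring⟩
  have shift : ∀ i, ∃ n e : ℤ, (e = 0 ∨ e = 1) ∧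
      ∀ k, a (i + k) = ((τ₁ * τ₀) ^ n) (a (e + k)) := fun i => by
    obtain ⟨n, e, he, h⟩ := base i
    exact ⟨n, e, he, fun k => by rw [h, hadd]⟩
  refine ⟨hs, hB, key _ (ha0 ▸ h₀) (ha1 ▸ h₁) fun x n hx => hx.map (mρ n),
    key (fun x => B x x = 1) (ha0 ▸ hn₀) (ha1 ▸ hn₁) fun x n hx => by rw [(mρ n).2, hx],
    fun i k => ?_, fun i k => ?_, fun i j k => ?_⟩
  · obtain ⟨n, e, he, h⟩ := shift i
    have h0 := h 0
    rw [add_zero, add_zero] at h0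
    rw [h0, sub_eq_add_neg i, h, h, ← map_sub, eig_map (mρ n)]
    refine Submodule.mem_map_of_mem ?_
    rcases he with rfl | rfl
    · rw [zero_add, zero_add, ← t0, ha0]
      exact hτ₀.sub_mem_minus h₀ _
    · rw [show 1 + -k = 2 - (1 + k) by ring, ← t1, ha1]
      exact hτ₁.sub_mem_minus h₁ _
  · obtain ⟨n, e, he, h⟩ := shift i
    have h0 := h 0
    rw [add_zero, add_zero] at h0
    rw [h0, sub_eq_add_neg i, h, h, ← map_add, plusPart_map (mρ n)]
    refine Submodule.mem_map_of_mem ?_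
    rcases he with rfl | rfl
    · rw [zero_add, zero_add, ← t0, ha0]
      exact hτ₀.add_mem_plus h₀ _
    · rw [show 1 + -k = 2 - (1 + k) by ring, ← t1, ha1]
      exact hτ₁.add_mem_plus h₁ _
  -- The reflection j ↦ 2i - j of indices is induced by ρ^i τ₀.
  · rw [show 2 * i - j = -j + 2 * i by ring, show 2 * i - k = -k + 2 * i by ring, hadd, hadd,
      (mρ i).2, ← t0, ← t0, m0.2]

end Sequence

/-! ### Polynomials in the multiplication by an element -/

section Polynomials

open Polynomial

variable {R A : Type*} [CommRing R] [Algebra ℚ R] [NonUnitalNonAssocCommRing A] [Module R A]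
  [IsScalarTower R A A] [SMulCommClass R A A]

/-- The value of a rational polynomial at the multiplication by `a`. -/
noncomputable def adPoly (R : Type*) {A : Type*} [CommRing R] [Algebra ℚ R] [NonUnitalNonAssocCommRing A]
    [Module R A] [IsScalarTower R A A] [SMulCommClass R A A] (f : ℚ[X]) (a : A) : End R A :=
  aeval (LinearMap.mulLeft R a) (f.map (algebraMap ℚ R))

theorem rat_neg (c : ℚ) : rat R (-c) = -rat R c := map_neg _ c

theorem adPoly_add (f g : ℚ[X]) (a x : A) :
    adPoly R (f + g) a x = adPoly R f a x + adPoly R g a x := by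
  rw [adPoly, Polynomial.map_add, map_add, LinearMap.add_apply, adPoly, adPoly]

theorem adPoly_mul (f g : ℚ[X]) (a x : A) :
    adPoly R (f * g) a x = adPoly R f a (adPoly R g a x) := by
  rw [adPoly, Polynomial.map_mul, map_mul, Module.End.mul_apply, adPoly, adPoly]

theorem adPoly_X (a x : A) : adPoly R X a x = a * x := by
  rw [adPoly, Polynomial.map_X, aeval_X, LinearMap.mulLeft_apply]

theorem adPoly_C (c : ℚ) (a x : A) : adPoly R (C c) a x = rat R c • x := by
  rw [adPoly, Polynomial.map_C, aeval_C, Module.algebraMap_end_apply]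

theorem adPoly_sub_C (θ : ℚ) (a x : A) : adPoly R (X - C θ) a x = a * x - rat R θ • x := by
  rw [sub_eq_add_neg, adPoly_add, ← C_neg, adPoly_C, adPoly_X, rat_neg, neg_smul, sub_eq_add_neg]

theorem adPoly_eig {a x : A} {θ : ℚ} (hx : x ∈ eig R a θ) (f : ℚ[X]) :
    adPoly R f a x = rat R (f.eval θ) • x := by
  induction f using Polynomial.induction_on' with
  | add f g hf hg => rw [adPoly_add, hf, hg, eval_add, rat_add, add_smul]
  | monomial n c =>
    rw [← C_mul_X_pow_eq_monomial, adPoly_mul, adPoly_C, eval_mul, eval_C, rat_mul, mul_smul]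
    congr 1
    induction n with
    | zero => rw [pow_zero, eval_one, ← C_1, adPoly_C]
    | succ n ih =>
      rw [pow_succ', adPoly_mul, ih, adPoly_X, mul_smul_comm, mem_eig.1 hx, eval_mul, eval_X,
        rat_mul, smul_smul, mul_comm]

/-- Semilinear multiplicative maps commute with polynomials in multiplications. -/
theorem map_adPoly {S C' : Type*} [CommRing S] [Algebra ℚ S] [NonUnitalNonAssocCommRing C']
    [Module S C'] [IsScalarTower S C' C'] [SMulCommClass S C' C'] (p : R →+* S) (q : A →+ C')
    (hs : ∀ r x, q (r • x) = p r • q x) (hm : ∀ x y, q (x * y) = q x * q y) (f : ℚ[X]) (a x : A) :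
    q (adPoly R f a x) = adPoly S f (q a) (q x) := by
  induction f using Polynomial.induction_on' with
  | add f g hf hg => rw [adPoly_add, map_add, hf, hg, adPoly_add]
  | monomial n c =>
    rw [← C_mul_X_pow_eq_monomial, adPoly_mul, adPoly_C, adPoly_mul, adPoly_C, hs,
      RingHom.map_rat_algebraMap]
    congr 1
    induction n with
    | zero => rw [pow_zero, ← C_1, adPoly_C, adPoly_C, hs, RingHom.map_rat_algebraMap]
    | succ n ih => rw [pow_succ', adPoly_mul, adPoly_mul, adPoly_X, adPoly_X, hm, ih]

/-- Over a general R containing ℚ the factors t - θ are still pairwise coprime, their differences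
being units, so the kernel of the product is the sum of the kernels. -/
theorem ker_adPoly_rootPoly (s : Finset ℚ) (a : A) :
    LinearMap.ker (adPoly R (rootPoly s) a) = ⨆ ζ ∈ s, eig R a ζ := by
  induction s using Finset.induction_on with
  | empty =>
    rw [rootPoly, Finset.prod_empty, adPoly, Polynomial.map_one, map_one]
    simp [LinearMap.ker_eq_bot']
  | insert θ s hθ ih =>
    have hc : IsCoprime (X - C θ) (rootPoly s) :=
      IsCoprime.prod_right fun ζ hζ => isCoprime_X_sub_C_of_isUnit_sub
        (sub_ne_zero.2 (ne_of_mem_of_not_mem hζ hθ).symm).isUnit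
    have he : LinearMap.ker (adPoly R (X - C θ) a) = eig R a θ := by
      ext x
      rw [LinearMap.mem_ker, adPoly_sub_C, mem_eig, sub_eq_zero]
    rw [rootPoly, Finset.prod_insert hθ, Finset.iSup_insert, ← ih, ← he, adPoly,
      Polynomial.map_mul]
    exact (sup_ker_aeval_eq_ker_aeval_mul_of_coprime _
      (hc.map (mapRingHom (algebraMap ℚ R)))).symm

theorem adPoly_rootPoly_eq_zero {s : Finset ℚ} {a x : A} :
    adPoly R (rootPoly s) a x = 0 ↔ x ∈ ⨆ ζ ∈ s, eig R a ζ := by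
  rw [← ker_adPoly_rootPoly, LinearMap.mem_ker]

theorem adPoly_erase_mem {s : Finset ℚ} {θ : ℚ} (hθ : θ ∈ s) {a x : A}
    (hx : adPoly R (rootPoly s) a x = 0) : adPoly R (rootPoly (s.erase θ)) a x ∈ eig R a θ := by
  rw [rootPoly, ← Finset.mul_prod_erase _ _ hθ, adPoly_mul, adPoly_sub_C, sub_eq_zero] at hx
  exact mem_eig.2 hx

theorem rootPoly_erase_ne_zero (s : Finset ℚ) (θ : ℚ) : (rootPoly (s.erase θ)).eval θ ≠ 0 := by
  rw [rootPoly, eval_prod]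
  refine Finset.prod_ne_zero_iff.2 fun ζ hζ => ?_
  rw [eval_sub, eval_X, eval_C]
  exact sub_ne_zero.2 (Finset.ne_of_mem_erase hζ).symm

/-! ### A characterization of axes by polynomial identities -/

/-- The component of `x` orthogonal to `a`, if `a` has length `1`. -/
def perp (B : A →ₗ[R] A →ₗ[R] R) (a x : A) : A := x - B a x • a

/-- The polynomial identities which hold for axes. -/
structure IsPolyAxis (F : FusionRules) (B : A →ₗ[R] A →ₗ[R] R) (a : A) : Prop where
  idem : a * a = a
  norm : B a a = 1
  semisimple : ∀ x, adPoly R (rootPoly (F.fields.erase 1)) a (perp B a x) = 0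
  fusion : ∀ x y, ∀ θ ∈ F.fields.erase 1, ∀ η ∈ F.fields.erase 1,
    adPoly R (rootPoly (F.star θ η)) a
      (adPoly R (rootPoly ((F.fields.erase 1).erase θ)) a (perp B a x) *
        adPoly R (rootPoly ((F.fields.erase 1).erase η)) a (perp B a y)) = 0

theorem one_mem_V43 : (1 : ℚ) ∈ V43.fields := by simp [V43]

theorem star_one_V43 (η : ℚ) : V43.star 1 η = {η} := by simp [V43, starV43]

theorem star_V43_one (θ : ℚ) : V43.star θ 1 = {θ} := by
  by_cases h : θ = 1 <;> simp [V43, starV43, h]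

theorem iSup_V43_erase {L : Type*} [CompleteLattice L] (p : ℚ → L) :
    ⨆ θ ∈ V43.fields, p θ = p 1 ⊔ ⨆ θ ∈ V43.fields.erase 1, p θ := by
  rw [← Finset.iSup_insert, Finset.insert_erase one_mem_V43]

variable {B : A →ₗ[R] A →ₗ[R] R} {a : A}

/-- By orthogonality of eigenspaces, `perp` removes exactly the A_1-component. Applying all factors
but t - θ to the rest lands in A_θ, so the fusion rules apply. -/
theorem IsAxis.isPolyAxis (hB : IsAssocForm B) (h : IsAxis R V43 a) (hn : B a a = 1) :
    IsPolyAxis V43 B a := by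
  have hs : ∀ x, adPoly R (rootPoly (V43.fields.erase 1)) a (perp B a x) = 0 := by
    intro x
    rw [adPoly_rootPoly_eq_zero]
    have hx : x ∈ eig R a 1 ⊔ ⨆ θ ∈ V43.fields.erase 1, eig R a θ := by
      rw [← iSup_V43_erase, h.semisimple]
      trivial
    obtain ⟨u, hu, y, hy, rfl⟩ := Submodule.mem_sup.1 hx
    rw [h.primitive, Submodule.mem_span_singleton] at hu
    obtain ⟨r, rfl⟩ := hu
    have hle : ⨆ θ ∈ V43.fields.erase 1, eig R a θ ≤ LinearMap.ker (B a) :=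
      iSup₂_le fun θ hθ z hz => h.form_eig hB (Finset.ne_of_mem_erase hθ) hz
    have hy0 : B a y = 0 := hle hy
    rwa [perp, map_add, map_smul, hn, hy0, smul_eq_mul, mul_one, add_zero, add_sub_cancel_left]
  refine ⟨h.idem, hn, hs, fun x y θ hθ η hη => adPoly_rootPoly_eq_zero.2 ?_⟩
  exact h.fusion θ (Finset.mem_of_mem_erase hθ) η (Finset.mem_of_mem_erase hη) _
    (adPoly_erase_mem hθ (hs x)) _ (adPoly_erase_mem hη (hs y))

/-- An eigenvector for θ ≠ 1 is orthogonal to a, and the polynomial projecting to A_θ acts on it by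
a nonzero rational; cancelling these scalars turns the identities into the fusion rules. -/
theorem IsPolyAxis.isAxis (hB : IsAssocForm B) (h : IsPolyAxis V43 B a) : IsAxis R V43 a := by
  have ha : a ∈ eig R a 1 := mem_eig.2 (by rw [h.idem, rat_one, one_smul])
  have hp : ∀ {θ : ℚ} {x : A}, θ ≠ 1 → x ∈ eig R a θ → perp B a x = x := by
    intro θ x hθ hx
    rw [perp, hB.orthogonal hθ.symm ha hx, zero_smul, sub_zero]
  have hprim : eig R a 1 = Submodule.span R {a} := by
    refine le_antisymm (fun x hx => ?_) ((Submodule.span_singleton_le_iff_mem _ _).2 ha)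
    -- For x in A_1, f(ad a) acts on x - ⟨a, x⟩ a as the unit f(1), so this difference vanishes.
    have hx' : perp B a x ∈ eig R a 1 := sub_mem hx (Submodule.smul_mem _ _ ha)
    have h0 := h.semisimple x
    rw [adPoly_eig hx'] at h0
    have := rat_mul_cancel (R := R) (rootPoly_erase_ne_zero _ _) h0
    rw [perp, sub_eq_zero] at this
    exact Submodule.mem_span_singleton.2 ⟨_, this.symm⟩
  refine ⟨h.idem, ?_, hprim, fun θ hθ η hη x hx y hy => ?_⟩
  · rw [iSup_V43_erase, eq_top_iff]
    intro x _
    refine Submodule.mem_sup.2 ⟨_, Submodule.smul_mem _ (B a x) ha, _,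
      adPoly_rootPoly_eq_zero.1 (h.semisimple x), ?_⟩
    rw [perp, add_sub_cancel]
  · by_cases hθ1 : θ = 1
    · subst hθ1
      rw [hprim, Submodule.mem_span_singleton] at hx
      obtain ⟨r, rfl⟩ := hx
      rw [star_one_V43, Finset.iSup_singleton, smul_mul_assoc, mem_eig.1 hy]
      exact Submodule.smul_mem _ _ (Submodule.smul_mem _ _ hy)
    by_cases hη1 : η = 1
    · subst hη1
      rw [hprim, Submodule.mem_span_singleton] at hy
      obtain ⟨r, rfl⟩ := hy
      rw [star_V43_one, Finset.iSup_singleton, mul_smul_comm, mul_comm, mem_eig.1 hx]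
      exact Submodule.smul_mem _ _ (Submodule.smul_mem _ _ hx)
    have hf := h.fusion x y θ (Finset.mem_erase.2 ⟨hθ1, hθ⟩) η (Finset.mem_erase.2 ⟨hη1, hη⟩)
    rw [hp hθ1 hx, hp hη1 hy, adPoly_eig hx, adPoly_eig hy, smul_mul_assoc, mul_smul_comm,
      map_smul, map_smul] at hf
    exact adPoly_rootPoly_eq_zero.1 (rat_mul_cancel (R := R) (rootPoly_erase_ne_zero _ _)
      (rat_mul_cancel (R := R) (rootPoly_erase_ne_zero _ _) hf))

end Polynomials

/-! ### Frobenius axial algebras -/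

section Frobenius

variable {R A : Type*} [CommRing R] [Algebra ℚ R] [NonUnitalNonAssocCommRing A] [Module R A]
  [IsScalarTower R A A] [SMulCommClass R A A] {B : A →ₗ[R] A →ₗ[R] R} {g : Fin 2 → A}

theorem charge_V43 : 2 * V43.charge = 1 := by norm_num [V43]

theorem IsFrobeniusAxial.norm_one (h : IsFrobeniusAxial V43 B g) (i : Fin 2) :
    B (g i) (g i) = 1 := by
  rw [h.norm_axis, charge_V43, map_one]

/-- Symmetry is not assumed. If x is a generator, both sides see only the A_1-component of y;
associativity propagates symmetry to products, hence to the generated algebra. -/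
theorem IsFrobeniusAxial.symm (h : IsFrobeniusAxial V43 B g) (x y : A) : B x y = B y x := by
  have hx : x ∈ NonUnitalAlgebra.adjoin R (Set.range g) := by rw [h.generate]; trivial
  induction hx using NonUnitalAlgebra.adjoin_induction generalizing y with
  | mem x hx =>
    obtain ⟨i, rfl⟩ := hx
    have hg := h.axis i
    obtain ⟨y, hy, z, hz, rfl⟩ := hg.exists_decomp y
    obtain ⟨u, hu, w, hw, e⟩ := hg.plus_decomp h.assoc (h.norm_one i) hy
    rw [e]
    simp only [map_add, LinearMap.add_apply, map_smul, LinearMap.smul_apply]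
    rw [hg.form_eig h.assoc (by norm_num) hu, hg.form_eig h.assoc (by norm_num) hw,
      hg.form_eig h.assoc (by norm_num) hz, hg.form_eig' h.assoc (by norm_num) hu,
      hg.form_eig' h.assoc (by norm_num) hw, hg.form_eig' h.assoc (by norm_num) hz]
  | add x x' _ _ hx hx' => rw [map_add, map_add, LinearMap.add_apply, hx, hx']
  | zero => rw [map_zero, map_zero, LinearMap.zero_apply]
  | mul x x' _ _ hx hx' =>
    -- ⟨xx', y⟩ = ⟨x, x'y⟩ = ⟨x'y, x⟩ = ⟨x', yx⟩ = ⟨yx, x'⟩ = ⟨y, xx'⟩.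
    rw [h.assoc, hx, h.assoc, hx', h.assoc]
  | smul r x _ hx => rw [map_smul, map_smul, LinearMap.smul_apply, hx]

end Frobenius

/-! ### Induction principles for the universal algebra -/

theorem CMagma.induction {P : CMagma → Prop} (gen : ∀ i, P (CMagma.gen i))
    (mul : ∀ x y, P x → P y → P (x * y)) (x : CMagma) : P x := by
  induction x using Con.induction_on with | _ x => ?_
  induction x using FreeMagma.recOnMul with
  | ih1 i => exact gen i
  | ih2 x y hx hy => exact mul _ _ hx hy

theorem FreeAlg.of_mul (x y : CMagma) : FreeAlg.of (x * y) = FreeAlg.of x * FreeAlg.of y := by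
  simp [FreeAlg.of]

theorem FreeAlg.single_eq (x : CMagma) (r : FreeCoeff) :
    (MonoidAlgebra.single x r : FreeAlg) = r • FreeAlg.of x := by
  simp [FreeAlg.of]

theorem FreeAlg.induction {P : FreeAlg → Prop} (of : ∀ x, P (FreeAlg.of x))
    (add : ∀ x y, P x → P y → P (x + y)) (smul : ∀ (r : FreeCoeff) x, P x → P (r • x))
    (x : FreeAlg) : P x := by
  induction x using MonoidAlgebra.induction_linear with
  | zero => simpa using smul 0 _ (of (CMagma.gen 0))
  | add x y hx hy => exact add _ _ hx hy
  | single m r => rw [FreeAlg.single_eq]; exact smul _ _ (of m)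

theorem freeForm_of (x y : CMagma) : freeForm (FreeAlg.of x) (FreeAlg.of y) = lamVar x y := by
  simp [FreeAlg.of, freeForm]

theorem freeForm_assoc : IsAssocForm freeForm := by
  intro x y z
  induction x using FreeAlg.induction with
  | add x x' hx hx' => simp only [add_mul, map_add, LinearMap.add_apply, hx, hx']
  | smul r x hx => simp only [smul_mul_assoc, map_smul, LinearMap.smul_apply, hx]
  | of x =>
    induction y using FreeAlg.induction with
    | add x x' hx hx' => simp only [mul_add, add_mul, map_add, LinearMap.add_apply, hx, hx']
    | smul r x hx =>
      simp only [mul_smul_comm, smul_mul_assoc, map_smul, LinearMap.smul_apply, hx]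
    | of y =>
      induction z using FreeAlg.induction with
      | add x x' hx hx' => simp only [mul_add, map_add, hx, hx']
      | smul r x hx => simp only [mul_smul_comm, map_smul, hx]
      | of z =>
        rw [← FreeAlg.of_mul, ← FreeAlg.of_mul, freeForm_of, freeForm_of]
        exact congrArg MvPolynomial.X (Quot.sound ⟨x, y, z, rfl, rfl⟩)

namespace UAlg

variable (F : FusionRules)

/-- The class of a magma element. -/
noncomputable def of (x : CMagma) : UAlg F := mk F (FreeAlg.of x)

theorem of_mul (x y : CMagma) : of F (x * y) = of F x * of F y := by
  rw [of, FreeAlg.of_mul, mk_mul, of, of]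

theorem form_of (x y : CMagma) :
    form F (of F x) (of F y) = Ideal.Quotient.mk (coeffIdeal F) (lamVar x y) := by
  rw [of, of, form_mk, freeForm_of]

theorem induction {P : UAlg F → Prop} (hof : ∀ x, P (of F x))
    (add : ∀ x y, P x → P y → P (x + y)) (smul : ∀ (r : UCoeff F) x, P x → P (r • x))
    (u : UAlg F) : P u := by
  induction u using ind with | _ x => ?_
  induction x using FreeAlg.induction with
  | of x => exact hof x
  | add x y hx hy => rw [mk_add]; exact add _ _ hx hy
  | smul r x hx => rw [mk_smul]; exact smul _ _ hx

/-- The projection of the free algebra. -/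
noncomputable def mkHom : FreeAlg →+ UAlg F where
  toFun := mk F
  map_zero' := mk_zero F
  map_add' := mk_add F

theorem mk_polyAd (f : Polynomial ℚ) (m x : FreeAlg) :
    mk F (polyAd f m x) = adPoly (UCoeff F) f (mk F m) (mk F x) :=
  map_adPoly (Ideal.Quotient.mk (coeffIdeal F)) (mkHom F) (mk_smul F) (mk_mul F) f m x

theorem form_assoc : IsAssocForm (form F) := by
  intro x y z
  induction x using ind with | _ x => ?_
  induction y using ind with | _ y => ?_
  induction z using ind with | _ z => ?_
  rw [← mk_mul, ← mk_mul, form_mk, form_mk, freeForm_assoc]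

theorem mk_eq_zero_of_mem {x : FreeAlg} (hx : x ∈ algRelators F) : mk F x = 0 := by
  rw [← mk_zero F, mk_eq, sub_zero]
  refine Submodule.mem_sup_left ?_
  rw [relIdeal, Submodule.mem_sInf]
  exact fun N hN => hN.1 hx

theorem gen_mul_gen (i : Fin 2) : gen F i * gen F i = gen F i := by
  have h := mk_eq_zero_of_mem F (Or.inl (Or.inl ⟨i, rfl⟩))
  rwa [← sub_zero (mark i * mark i - mark i), ← mk_zero F, mk_eq, sub_zero, sub_zero, ← mk_eq,
    mk_mul] at h

theorem form_gen_gen (i : Fin 2) :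
    form F (gen F i) (gen F i) = algebraMap ℚ (UCoeff F) (2 * F.charge) := by
  rw [gen, form_mk]
  exact Ideal.Quotient.eq.2 (Ideal.subset_span (Or.inl ⟨i, rfl⟩))

theorem mk_perpPart (i : Fin 2) (x : CMagma) :
    mk V43 (perpPart V43 i x) = perp (form V43) (gen V43 i) (of V43 x) := by
  rw [perpPart, charge_V43, inv_one, map_one, one_mul, sub_eq_add_neg, ← neg_smul, mk_add, mk_smul,
    map_neg, neg_smul, ← form_mk, ← sub_eq_add_neg]
  rfl

theorem perp_add {R A : Type*} [CommRing R] [NonUnitalNonAssocCommRing A] [Module R A]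
    (B : A →ₗ[R] A →ₗ[R] R) (a x y : A) : perp B a (x + y) = perp B a x + perp B a y := by
  rw [perp, perp, perp, map_add, add_smul]
  abel

theorem perp_smul {R A : Type*} [CommRing R] [NonUnitalNonAssocCommRing A] [Module R A]
    (B : A →ₗ[R] A →ₗ[R] R) (a : A) (r : R) (x : A) : perp B a (r • x) = r • perp B a x := by
  rw [perp, perp, map_smul, smul_sub, smul_assoc]

/-- All identities are linear in x and in y, so magma elements suffice, and for these they are
relators. -/
theorem isPolyAxis (i : Fin 2) : IsPolyAxis V43 (form V43) (gen V43 i) where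
  idem := gen_mul_gen V43 i
  norm := by rw [form_gen_gen, charge_V43, map_one]
  semisimple x := by
    induction x using induction with
    | add x y hx hy => rw [perp_add, map_add, hx, hy, add_zero]
    | smul r x hx => rw [perp_smul, map_smul, hx, smul_zero]
    | hof x =>
      rw [← mk_perpPart, gen, ← mk_polyAd]
      exact mk_eq_zero_of_mem V43 (Or.inl (Or.inr ⟨i, x, rfl⟩))
  fusion x y θ hθ η hη := by
    induction x using induction with
    | add x y hx hy => rw [perp_add, map_add, add_mul, map_add, hx, hy, add_zero]
    | smul r x hx => rw [perp_smul, map_smul, smul_mul_assoc, map_smul, hx, smul_zero]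
    | hof x =>
      induction y using induction with
      | add x y hx hy => rw [perp_add, map_add, mul_add, map_add, hx, hy, add_zero]
      | smul r x hx => rw [perp_smul, map_smul, mul_smul_comm, map_smul, hx, smul_zero]
      | hof y =>
        rw [← mk_perpPart, ← mk_perpPart, gen, ← mk_polyAd, ← mk_polyAd, ← mk_mul, ← mk_polyAd]
        exact mk_eq_zero_of_mem V43 (Or.inr ⟨i, x, y, θ, hθ, η, hη, rfl⟩)

theorem adjoin_gen : NonUnitalAlgebra.adjoin (UCoeff F) (Set.range (gen F)) = ⊤ := by
  rw [eq_top_iff]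
  rintro u -
  induction u using induction with
  | add x y hx hy => exact add_mem hx hy
  | smul r x hx => exact SMulMemClass.smul_mem r hx
  | hof x =>
    induction x using CMagma.induction with
    | gen i => exact NonUnitalAlgebra.subset_adjoin _ ⟨i, rfl⟩
    | mul x y hx hy => rw [of_mul]; exact mul_mem hx hy

end UAlg

/-! ### Morphisms from the universal algebra -/

section Lift

variable {S : Type*} {C : Type*} [CommRing S] [Algebra ℚ S] [NonUnitalNonAssocCommRing C]
  [Module S C]

/-- The value of a magma element at a pair of elements. -/
noncomputable def CMagma.eval (h : Fin 2 → C) (x : CMagma) : C :=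
  Con.liftOn x (FreeMagma.lift h) fun _ _ hab =>
    (Con.conGen_le (c := Con.ker (FreeMagma.lift h))).2
      (by rintro _ _ ⟨u, v, rfl, rfl⟩; exact (Con.ker_rel _).2 (by simp [_root_.mul_comm])) hab

theorem CMagma.eval_gen (h : Fin 2 → C) (i : Fin 2) : CMagma.eval h (CMagma.gen i) = h i :=
  FreeMagma.lift_of h i

theorem CMagma.eval_mul (h : Fin 2 → C) (x y : CMagma) :
    CMagma.eval h (x * y) = CMagma.eval h x * CMagma.eval h y := by
  induction x using Con.induction_on with | _ x => ?_
  induction y using Con.induction_on with | _ y => ?_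
  exact map_mul (FreeMagma.lift h) x y

variable [IsScalarTower S C C] [SMulCommClass S C C] {D : C →ₗ[S] C →ₗ[S] S}
  (hD : IsAssocForm D) (h : Fin 2 → C)

/-- The homomorphism of the free coefficient ring determined by a pair of elements. -/
noncomputable def coeffLift : FreeCoeff →+* S :=
  MvPolynomial.eval₂Hom (algebraMap ℚ S)
    (Quot.lift (fun p : CMagma × CMagma => D (CMagma.eval h p.1) (CMagma.eval h p.2)) (by
      rintro _ _ ⟨x, y, z, rfl, rfl⟩
      rw [CMagma.eval_mul, CMagma.eval_mul, hD]))

omit [IsScalarTower S C C] [SMulCommClass S C C] in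
theorem coeffLift_lamVar (x y : CMagma) :
    coeffLift hD h (lamVar x y) = D (CMagma.eval h x) (CMagma.eval h y) :=
  MvPolynomial.eval₂Hom_X' _ _ _

/-- The semilinear map of the free algebra determined by a pair of elements. -/
noncomputable def algLift : FreeAlg →ₛₗ[coeffLift hD h] C where
  toFun x := Finsupp.liftAddHom
    (fun m => ((LinearMap.toSpanSingleton S C (CMagma.eval h m)).toAddMonoidHom.comp
      (coeffLift hD h).toAddMonoidHom)) (MonoidAlgebra.coeffLinearEquiv FreeCoeff x)
  map_add' x y := by rw [map_add, map_add]
  map_smul' r x := by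
    rw [map_smul]
    generalize MonoidAlgebra.coeffLinearEquiv FreeCoeff x = f
    induction f using Finsupp.induction_linear with
    | zero => simp
    | add f g hf hg => rw [smul_add, map_add, hf, hg, map_add, smul_add]
    | single m s =>
      rw [Finsupp.smul_single, Finsupp.liftAddHom_apply_single, Finsupp.liftAddHom_apply_single]
      simp [mul_smul]

omit [IsScalarTower S C C] [SMulCommClass S C C] in
theorem algLift_of (x : CMagma) : algLift hD h (FreeAlg.of x) = CMagma.eval h x := by
  simp [algLift, FreeAlg.of]

omit [IsScalarTower S C C] [SMulCommClass S C C] in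
theorem algLift_mark (i : Fin 2) : algLift hD h (mark i) = h i := by
  rw [mark, algLift_of, CMagma.eval_gen]

theorem algLift_mul (x y : FreeAlg) : algLift hD h (x * y) = algLift hD h x * algLift hD h y := by
  induction x using FreeAlg.induction with
  | add x x' hx hx' => simp only [add_mul, map_add, hx, hx']
  | smul r x hx => simp only [smul_mul_assoc, map_smulₛₗ, hx]
  | of x =>
    induction y using FreeAlg.induction with
    | add x x' hx hx' => simp only [mul_add, map_add, hx, hx']
    | smul r x hx => simp only [mul_smul_comm, map_smulₛₗ, hx]
    | of y => rw [← FreeAlg.of_mul, algLift_of, algLift_of, algLift_of, CMagma.eval_mul]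

omit [IsScalarTower S C C] [SMulCommClass S C C] in
theorem form_algLift (x y : FreeAlg) :
    D (algLift hD h x) (algLift hD h y) = coeffLift hD h (freeForm x y) := by
  induction x using FreeAlg.induction with
  | add x x' hx hx' => simp only [map_add, LinearMap.add_apply, hx, hx']
  | smul r x hx =>
    simp only [map_smulₛₗ, LinearMap.smul_apply, hx, smul_eq_mul, map_mul, RingHom.id_apply]
  | of x =>
    induction y using FreeAlg.induction with
    | add x x' hx hx' => simp only [map_add, hx, hx']
    | smul r x hx =>
      simp only [map_smulₛₗ, hx, smul_eq_mul, map_mul, RingHom.id_apply]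
    | of y => rw [freeForm_of, algLift_of, algLift_of, coeffLift_lamVar]

theorem algLift_polyAd (f : Polynomial ℚ) (m x : FreeAlg) :
    algLift hD h (polyAd f m x) = adPoly S f (algLift hD h m) (algLift hD h x) :=
  map_adPoly (coeffLift hD h) (algLift hD h).toAddMonoidHom (map_smulₛₗ (algLift hD h))
    (algLift_mul hD h) f m x

omit [IsScalarTower S C C] [SMulCommClass S C C] in
theorem algLift_perpPart (i : Fin 2) (x : CMagma) :
    algLift hD h (perpPart V43 i x) = perp D (h i) (CMagma.eval h x) := by
  rw [perpPart, charge_V43, inv_one, map_one, one_mul, map_sub, map_smulₛₗ, ← form_algLift,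
    algLift_mark, algLift_of, perp]

variable {h} (H : ∀ i, IsPolyAxis V43 D (h i))
include hD H

/-- The kernel is an ideal containing the relators, hence one of the submodules whose infimum is
`relIdeal`. -/
theorem relIdeal_le_ker : relIdeal V43 ≤ LinearMap.ker (algLift hD h) := by
  refine sInf_le ⟨?_, fun x hx y => ?_⟩
  · rintro _ ((⟨i, rfl⟩ | ⟨i, x, rfl⟩) | ⟨i, x, y, θ, hθ, η, hη, rfl⟩)
    · rw [SetLike.mem_coe, LinearMap.mem_ker, map_sub, algLift_mul, algLift_mark, (H i).idem,
        sub_self]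
    · rw [SetLike.mem_coe, LinearMap.mem_ker, algLift_polyAd, algLift_mark, algLift_perpPart,
        (H i).semisimple]
    · rw [SetLike.mem_coe, LinearMap.mem_ker, algLift_polyAd, algLift_mul, algLift_polyAd,
        algLift_polyAd, algLift_mark, algLift_perpPart, algLift_perpPart,
        (H i).fusion _ _ θ hθ η hη]
  · rw [LinearMap.mem_ker] at hx ⊢
    rw [algLift_mul, hx, zero_mul]

theorem coeffIdeal_le_ker : coeffIdeal V43 ≤ RingHom.ker (coeffLift hD h) := by
  refine Ideal.span_le.2 ?_
  rintro _ (⟨i, rfl⟩ | ⟨x, hx, y, rfl | rfl⟩)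
  · rw [SetLike.mem_coe, RingHom.mem_ker, map_sub, ← form_algLift, algLift_mark, (H i).norm,
      charge_V43, map_one, map_one, sub_self]
  · rw [SetLike.mem_coe, RingHom.mem_ker, ← form_algLift,
      LinearMap.mem_ker.1 (relIdeal_le_ker hD H hx), map_zero, LinearMap.zero_apply]
  · rw [SetLike.mem_coe, RingHom.mem_ker, ← form_algLift,
      LinearMap.mem_ker.1 (relIdeal_le_ker hD H hx), map_zero]

theorem algIdeal_le_ker : algIdeal V43 ≤ LinearMap.ker (algLift hD h) := by
  refine sup_le (relIdeal_le_ker hD H) (Submodule.smul_le.2 fun r hr x _ => ?_)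
  rw [LinearMap.mem_ker, map_smulₛₗ, RingHom.mem_ker.1 (coeffIdeal_le_ker hD H hr), zero_smul]

theorem UAlg.exists_lift : ∃ p : (UCoeff V43 →+* S) × (UAlg V43 →+ C),
    (∀ r x, p.2 (r • x) = p.1 r • p.2 x) ∧ (∀ x y, p.2 (x * y) = p.2 x * p.2 y) ∧
    (∀ x y, D (p.2 x) (p.2 y) = p.1 (UAlg.form V43 x y)) ∧
    ∀ i, p.2 (UAlg.gen V43 i) = h i := by
  let q : UAlg V43 →+ C :=
    ((algIdeal V43).liftQ (algLift hD h) (algIdeal_le_ker hD H)).toAddMonoidHom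
  have hq : ∀ x, q (UAlg.mk V43 x) = algLift hD h x := fun x => rfl
  let p : UCoeff V43 →+* S :=
    Ideal.Quotient.lift (coeffIdeal V43) (coeffLift hD h) fun r hr => coeffIdeal_le_ker hD H hr
  have hp : ∀ r, p (Ideal.Quotient.mk (coeffIdeal V43) r) = coeffLift hD h r := fun r => rfl
  refine ⟨(p, q), fun r x => ?_, fun x y => ?_, fun x y => ?_, fun i => ?_⟩
  · obtain ⟨r, rfl⟩ := Ideal.Quotient.mk_surjective r
    induction x using UAlg.ind with | _ x => ?_
    rw [← UAlg.mk_smul, hq, hq, hp, map_smulₛₗ]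
  · induction x using UAlg.ind with | _ x => ?_
    induction y using UAlg.ind with | _ y => ?_
    rw [← UAlg.mk_mul, hq, hq, hq, algLift_mul]
  · induction x using UAlg.ind with | _ x => ?_
    induction y using UAlg.ind with | _ y => ?_
    rw [UAlg.form_mk, hq, hq, hp, form_algLift]
  · rw [UAlg.gen, hq, algLift_mark]

omit hD H [Algebra ℚ S] [IsScalarTower S C C] [SMulCommClass S C C] in
/-- A morphism from the universal algebra is determined by its values on the generators. -/
theorem UAlg.lift_unique (F : FusionRules) {p p' : (UCoeff F →+* S) × (UAlg F →+ C)}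
    (h₁ : ∀ r x, p.2 (r • x) = p.1 r • p.2 x) (h₂ : ∀ x y, p.2 (x * y) = p.2 x * p.2 y)
    (h₃ : ∀ x y, D (p.2 x) (p.2 y) = p.1 (UAlg.form F x y))
    (h₁' : ∀ r x, p'.2 (r • x) = p'.1 r • p'.2 x) (h₂' : ∀ x y, p'.2 (x * y) = p'.2 x * p'.2 y)
    (h₃' : ∀ x y, D (p'.2 x) (p'.2 y) = p'.1 (UAlg.form F x y))
    (h₄ : ∀ i, p.2 (UAlg.gen F i) = p'.2 (UAlg.gen F i)) : p = p' := by
  have e : ∀ x, p.2 (UAlg.of F x) = p'.2 (UAlg.of F x) := fun x => by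
    induction x using CMagma.induction with
    | gen i => exact h₄ i
    | mul x y hx hy => rw [UAlg.of_mul, h₂, h₂', hx, hy]
  have e1 : p.1 = p'.1 := by
    -- The coefficient ring is generated over ℚ by the values of the form on magma elements, and
    -- these are transported by the map of algebras.
    refine Ideal.Quotient.ringHom_ext (MvPolynomial.ringHom_ext (fun c => ?_) fun i => ?_)
    · exact congrArg (fun φ : ℚ →+* S => φ c) (RingHom.ext_rat
        ((p.1.comp (Ideal.Quotient.mk (coeffIdeal F))).comp MvPolynomial.C)
        ((p'.1.comp (Ideal.Quotient.mk (coeffIdeal F))).comp MvPolynomial.C))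
    · obtain ⟨⟨x, y⟩, rfl⟩ := Quot.exists_rep i
      have := UAlg.form_of F x y
      change p.1 (Ideal.Quotient.mk (coeffIdeal F) (lamVar x y)) =
        p'.1 (Ideal.Quotient.mk (coeffIdeal F) (lamVar x y))
      rw [← this, ← h₃, ← h₃', e, e]
  refine Prod.ext e1 (AddMonoidHom.ext fun u => ?_)
  induction u using UAlg.induction with
  | hof x => exact e x
  | add x y hx hy => rw [map_add, map_add, hx, hy]
  | smul r x hx => rw [h₁, h₁', hx, e1]

end Lift

/-! ### The universal algebra is a Frobenius axial algebra -/

/-- Here every `perp` vanishes, so the identities are trivial. The resulting homomorphism to ℚ shows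
that the universal coefficient ring is nonzero. -/
theorem isPolyAxis_one : IsPolyAxis V43 (LinearMap.mul ℚ ℚ) (1 : ℚ) where
  idem := mul_one 1
  norm := mul_one 1
  semisimple x := by simp [perp]
  fusion x y θ _ η _ := by simp [perp]

theorem isFrobeniusAxial_V43 : IsFrobeniusAxial V43 form43 (UAlg.gen V43) where
  nontrivial := by
    obtain ⟨p, -⟩ := UAlg.exists_lift (D := LinearMap.mul ℚ ℚ) (h := fun _ => (1 : ℚ))
      (fun x y z => mul_assoc x y z) fun _ => isPolyAxis_one
    exact p.1.domain_nontrivial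
  assoc := UAlg.form_assoc V43
  axis i := (UAlg.isPolyAxis i).isAxis (UAlg.form_assoc V43)
  norm_axis := UAlg.form_gen_gen V43
  generate := UAlg.adjoin_gen V43

theorem isUniversal_V43 : IsUniversal.{u, v, 0, 0} V43 form43 (UAlg.gen V43) := by
  refine ⟨isFrobeniusAxial_V43, fun S C _ _ _ _ _ _ D h H => ?_⟩
  obtain ⟨p, h₁, h₂, h₃, h₄⟩ := UAlg.exists_lift (D := D) (h := h) H.assoc
    fun i => (H.axis i).isPolyAxis H.assoc (H.norm_one i)
  refine ⟨p, ⟨h₁, h₂, h₃, h₄⟩, fun p' ⟨h₁', h₂', h₃', h₄'⟩ => ?_⟩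
  exact UAlg.lift_unique V43 h₁' h₂' h₃' h₁ h₂ h₃ fun i => by rw [h₄, h₄']

/-! ### The algebra spanned by eight elements -/

section Span

/-- The names of the spanning elements. -/
def basicAtoms : List Atom :=
  [.ax (-2), .ax (-1), .ax 0, .ax 1, .ax 2, .sigOne, .sigTwo false, .sigTwo true]

theorem mulTable_basicAtoms : ∀ s ∈ basicAtoms, ∀ t ∈ basicAtoms,
    ∀ u ∈ Comb.reduce (Table.mulTable.rule s t), u.1 ∈ basicAtoms := by
  decide +kernel

theorem formTable_basicAtoms : ∀ s ∈ basicAtoms, ∀ t ∈ basicAtoms,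
    ∀ u ∈ Table.formTable.rule s t, u.1 = .one := by
  decide +kernel

variable {R A : Type*} [CommRing R] [Algebra ℚ R] [NonUnitalNonAssocCommRing A] [Module R A]
  [IsScalarTower R A A] [SMulCommClass R A A]

/-- The span of the eight basic elements over a subring of the coefficient ring. -/
def basicSpan (S : Subalgebra ℚ R) (a : ℤ → A) : Submodule S A :=
  Submodule.span S {x | ∃ s ∈ basicAtoms, x = atomVal R a s}

variable {B : A →ₗ[R] A →ₗ[R] R} {a : ℤ → A} {l m : R} {S : Subalgebra ℚ R}

omit [IsScalarTower R A A] [SMulCommClass R A A] in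
theorem atomVal_mem_basicSpan {s : Atom} (hs : s ∈ basicAtoms) :
    atomVal R a s ∈ basicSpan S a :=
  Submodule.subset_span ⟨s, hs, rfl⟩

theorem IsDihedral.sig_two_odd (h : IsDihedral B a) :
    sig R (a (-1)) (a 1) = atomVal R a (.sigTwo true) := by
  have := h.sig_two (-1)
  rwa [show (-1 : ℤ) + 2 = 1 by norm_num] at this

variable (ha : IsDihedralTwo B l m a) (hl : l ∈ S) (hm : m ∈ S)
include ha hl hm

/-- On the eight elements the product table followed by `reduce` returns the same eight elements
with coefficients polynomial in l and m, hence in S. -/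
theorem mul_mem_basicSpan {x y : A} (hx : x ∈ basicSpan S a) (hy : y ∈ basicSpan S a) :
    x * y ∈ basicSpan S a := by
  refine Submodule.span_induction₂ (p := fun x y _ _ => x * y ∈ basicSpan S a) ?_ ?_ ?_ ?_ ?_ ?_ ?_
    hx hy
  · rintro _ _ ⟨s, hs, rfl⟩ ⟨t, ht, rfl⟩
    have h := isMul_mulTable.rule class_two ⟨mul_comm, fun _ _ _ => rfl, fun a ha j d hd s =>
      ha.atomVal_move j hd s⟩ ha s t
    rw [← ha.eval_reduce] at h
    change LinearMap.mul R A _ _ ∈ _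
    rw [h]
    exact Comb.eval_mem l m _ (N := (basicSpan S a).toAddSubmonoid) _ fun u hu =>
      (basicSpan S a).smul_mem (⟨_, Poly.eval_mem l m S hl hm u.2⟩ : S)
        (atomVal_mem_basicSpan (mulTable_basicAtoms s hs t ht u hu))
  · intro y _; rw [zero_mul]; exact zero_mem _
  · intro x _; rw [mul_zero]; exact zero_mem _
  · intro x y z _ _ _ h1 h2; rw [add_mul]; exact add_mem h1 h2
  · intro x y z _ _ _ h1 h2; rw [mul_add]; exact add_mem h1 h2
  · intro r x y _ _ h; rw [S.smul_def, smul_mul_assoc]; exact Submodule.smul_mem _ r h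
  · intro r x y _ _ h; rw [S.smul_def, mul_smul_comm]; exact Submodule.smul_mem _ r h

theorem form_mem_of_basicSpan {x y : A} (hx : x ∈ basicSpan S a) (hy : y ∈ basicSpan S a) :
    B x y ∈ S := by
  refine Submodule.span_induction₂ (p := fun x y _ _ => B x y ∈ S) ?_ ?_ ?_ ?_ ?_ ?_ ?_ hx hy
  · rintro _ _ ⟨s, hs, rfl⟩ ⟨t, ht, rfl⟩
    have h := isForm_formTable.rule class_two ⟨ha.symm, fun _ _ _ => rfl, fun a ha j d hd s =>
      ha.atomForm_move j hd s⟩ ha s t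
    rw [h]
    refine Comb.eval_mem l m _ (N := S.toSubsemiring.toAddSubmonoid) _ fun u hu => ?_
    rw [formTable_basicAtoms s hs t ht u hu]
    exact S.mul_mem (Poly.eval_mem l m S hl hm u.2) S.one_mem
  · intro y _; rw [map_zero, LinearMap.zero_apply]; exact zero_mem _
  · intro x _; rw [map_zero]; exact zero_mem _
  · intro x y z _ _ _ h1 h2; rw [map_add]; exact add_mem h1 h2
  · intro x y z _ _ _ h1 h2; rw [map_add]; exact add_mem h1 h2
  · intro r x y _ _ h; rw [S.smul_def, map_smul]; exact S.mul_mem r.2 h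
  · intro r x y _ _ h; rw [S.smul_def, map_smul]; exact S.mul_mem r.2 h

end Span

/-! ### Coefficient ring and spanning set of the universal algebra -/

section Universal

variable {a : ℤ → U43} {l m : R43} (ha : IsDihedralTwo form43 l m a)
  (h₀ : a 0 = UAlg.gen V43 0) (h₁ : a 1 = UAlg.gen V43 1)
include ha h₀ h₁

theorem of_mem_basicSpan (x : CMagma) :
    UAlg.of V43 x ∈ basicSpan (Algebra.adjoin ℚ {l, m}) a := by
  have hl : l ∈ Algebra.adjoin ℚ {l, m} := Algebra.subset_adjoin (by simp)
  have hm : m ∈ Algebra.adjoin ℚ {l, m} := Algebra.subset_adjoin (by simp)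
  induction x using CMagma.induction with
  | mul x y hx hy => rw [UAlg.of_mul]; exact mul_mem_basicSpan ha hl hm hx hy
  | gen i =>
    fin_cases i
    · have := atomVal_mem_basicSpan (a := a) (S := Algebra.adjoin ℚ {l, m}) (s := .ax 0)
        (by decide)
      rwa [atomVal, h₀] at this
    · have := atomVal_mem_basicSpan (a := a) (S := Algebra.adjoin ℚ {l, m}) (s := .ax 1)
        (by decide)
      rwa [atomVal, h₁] at this

/-- The ring is generated by the classes of the λ_[x, y], which are form values on magma elements;
these elements lie in the span over ℚ[l, m], where the form takes values in ℚ[l, m]. -/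
theorem adjoin_eq_top : Algebra.adjoin ℚ {l, m} = (⊤ : Subalgebra ℚ R43) := by
  have hl : l ∈ Algebra.adjoin ℚ {l, m} := Algebra.subset_adjoin (by simp)
  have hm : m ∈ Algebra.adjoin ℚ {l, m} := Algebra.subset_adjoin (by simp)
  rw [eq_top_iff]
  rintro r -
  obtain ⟨r, rfl⟩ := Ideal.Quotient.mk_surjective r
  induction r using MvPolynomial.induction_on with
  | C c => exact (Algebra.adjoin ℚ {l, m}).algebraMap_mem c
  | add p q hp hq => rw [map_add]; exact add_mem hp hq
  | mul_X p i hp =>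
    rw [map_mul]
    refine mul_mem hp ?_
    obtain ⟨⟨x, y⟩, rfl⟩ := Quot.exists_rep i
    have := form_mem_of_basicSpan ha hl hm (of_mem_basicSpan ha h₀ h₁ x)
      (of_mem_basicSpan ha h₀ h₁ y)
    rwa [UAlg.form_of] at this

theorem span_eq_top :
    Submodule.span R43 {a (-2), a (-1), a 0, a 1, a 2, sig R43 (a 0) (a 1), sig R43 (a 0) (a 2),
      sig R43 (a (-1)) (a 1)} = ⊤ := by
  set N := Submodule.span R43 {a (-2), a (-1), a 0, a 1, a 2, sig R43 (a 0) (a 1),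
    sig R43 (a 0) (a 2), sig R43 (a (-1)) (a 1)} with hN
  have hle : ∀ x ∈ basicSpan (Algebra.adjoin ℚ {l, m}) a, x ∈ N := by
    intro x hx
    refine Submodule.span_induction (R := Algebra.adjoin ℚ {l, m})
      (s := {x | ∃ s ∈ basicAtoms, x = atomVal R43 a s}) (p := fun x _ => x ∈ N) ?_ (zero_mem _)
      (fun _ _ _ _ => add_mem) (fun r _ _ h => N.smul_mem (r : R43) h) hx
    rintro _ ⟨s, hs, rfl⟩
    refine Submodule.subset_span ?_
    have hσ := ha.sig_two_odd
    simp only [basicAtoms, List.mem_cons, List.not_mem_nil, or_false] at hs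
    rcases hs with rfl | rfl | rfl | rfl | rfl | rfl | rfl | rfl
    iterate 7 simp [atomVal]
    simp [← hσ]
  rw [eq_top_iff]
  rintro u -
  induction u using UAlg.induction with
  | hof x => exact hle _ (of_mem_basicSpan ha h₀ h₁ x)
  | add x y hx hy => exact add_mem hx hy
  | smul r x hx => exact N.smul_mem r hx

end Universal

end Axial

theorem mainTheorem4 :
    Axial.IsUniversal.{u, v, 0, 0} Axial.V43 Axial.form43 (Axial.UAlg.gen Axial.V43) ∧
    ∃ τ₀ τ₁ : Axial.U43 ≃ₗ[Axial.R43] Axial.U43,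
      Axial.IsMiyamoto (Axial.UAlg.gen Axial.V43 0) τ₀ ∧
      Axial.IsMiyamoto (Axial.UAlg.gen Axial.V43 1) τ₁ ∧
      ∀ (a : ℤ → Axial.U43) (lam mu : Axial.R43) (σ₁ σe σo : Axial.U43),
        a = Axial.axisSeq τ₀ τ₁ (Axial.UAlg.gen Axial.V43 0) (Axial.UAlg.gen Axial.V43 1) →
        lam = Axial.form43 (a 0) (a 1) →
        mu = Axial.form43 (a 0) (a 2) →
        σ₁ = Axial.sig Axial.R43 (a 0) (a 1) →
        σe = Axial.sig Axial.R43 (a 0) (a 2) →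
        σo = Axial.sig Axial.R43 (a (-1)) (a 1) →
        Algebra.adjoin ℚ {lam, mu} = ⊤ ∧
        Submodule.span Axial.R43 {a (-2), a (-1), a 0, a 1, a 2, σ₁, σe, σo} = ⊤ ∧
        Axial.IsMulTable lam mu a σ₁ (fun i => if Even i then σe else σo) ∧
        Axial.IsFormTable lam mu Axial.form43 a σ₁ (fun i => if Even i then σe else σo) := by
  have H := Axial.isFrobeniusAxial_V43
  obtain ⟨τ₀, hτ₀⟩ := (H.axis 0).exists_miyamoto
  obtain ⟨τ₁, hτ₁⟩ := (H.axis 1).exists_miyamoto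
  refine ⟨Axial.isUniversal_V43, τ₀, τ₁, hτ₀, hτ₁, ?_⟩
  rintro a lam mu σ₁ σe σo haeq rfl rfl rfl rfl rfl
  have h₀ : a 0 = Axial.UAlg.gen Axial.V43 0 := by rw [haeq, Axial.axisSeq_zero]
  have h₁ : a 1 = Axial.UAlg.gen Axial.V43 1 := by rw [haeq, Axial.axisSeq_one]
  have hd : Axial.IsDihedral Axial.form43 a := by
    rw [haeq]
    exact Axial.isDihedral_axisSeq (H.axis 0) (H.axis 1) hτ₀ hτ₁ H.assoc H.symm (H.norm_one 0)
      (H.norm_one 1)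
  have ha := hd.isDihedralOne.isDihedralTwo
  -- The tables are indexed by parity; this identifies σ₂ᵉ and σ₂ᵒ with σ(a_i, a_{i+2}) for every i
  -- of the given parity, including σ(a_{-1}, a_1) with σ(a_1, a_3).
  have hs : ∀ i : ℤ, (if Even i then Axial.sig Axial.R43 (a 0) (a 2)
      else Axial.sig Axial.R43 (a (-1)) (a 1)) = Axial.sig Axial.R43 (a i) (a (i + 2)) := by
    intro i
    rw [hd.sig_two, hd.sig_two_odd]
    split_ifs with hi
    · rw [Int.even_iff.1 hi]; rfl
    · rw [Int.not_even_iff.1 hi]; rfl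
  exact ⟨Axial.adjoin_eq_top ha h₀ h₁, Axial.span_eq_top ha h₀ h₁, ha.isMulTable hs,
    ha.isFormTable hs⟩
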